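/- Let $(\mathcal{C},\mathbb{E},\mathfrak{s})$ be a small extriangulated category with higher extension bifunctors $\mathbb{E}^i$, $i\ge 1$ (where $\mathbb{E}^1=\mathbb{E}$ and $\mathbb{E}^{i+1}(X,A)=\int^{M}\mathbb{E}^{i}(X,M)\otimes_{\mathbb{Z}}\mathbb{E}(M,A)$). For classes of objects $\mathcal{X},\mathcal{Y}$, let $\mathrm{free}(\mathcal{X})$ and $\mathrm{smd}(\mathcal{X})$ be the classes of finite coproducts (including $0$), respectively of direct summands, of objects of $\mathcal{X}$; let $\mathcal{X}_m^{\wedge}$ be the class of the objects that have a finite $\mathcal{X}$-resolution by $\mathbb{E}$-triangles of length at most $m$. A morphism $g$ is $\mathbb{E}$-injective if $\mathbb{E}(-,g)=0$; $\mathcal{I}_{\mathbb{E}}(\mathcal{C})$ is the class of $\mathbb{E}$-injective objects; $\mathcal{Y}$ has enough inflations (enough $\mathbb{E}$-injective morphisms) to $\mathcal{X}$ if each $Y\in\mathcal{Y}$ admits an inflation (an inflation that is an $\mathbb{E}$-injective morphism) $Y\to X$ with $X\in\mathcal{X}$. Let $\Sigma(\mathcal{X})$ be the class of the objects $Z$ with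 a conflation $X\to I\to Z$, $X\in\mathcal{X}$, $I\in\mathcal{I}_{\mathbb{E}}(\mathcal{C})$. Let $n\ge 0$ and let $\mathcal{X}=\mathrm{free}(\mathcal{X})$ be $(n+2)$-rigid, i.e. $\mathbb{E}^{i}(\mathcal{X},\mathcal{X})=0$ for $1\le i\le n+1$, and assume that $\mathcal{X}_n^{\wedge}$ has enough $\mathbb{E}$-injective morphisms to $\mathcal{X}$. Let $\mathcal{X}_{n+1}^{\wedge}/[\mathcal{X}]$ be the quotient of the full subcategory $\mathcal{X}_{n+1}^{\wedge}$ by the ideal $[\mathcal{X}]$ of the morphisms that factor through an object of $\mathcal{X}$, and let $\overline{\mathcal{X}_n^{\wedge}}$ be the quotient of $\mathcal{X}_n^{\wedge}$ by the ideal of its morphisms that are $\mathbb{E}$-injective in $\mathcal{C}$. Left modules over $\overline{\mathcal{X}_n^{\wedge}}$ are additive functors $\overline{\mathcal{X}_n^{\wedge}}\to\mathrm{Ab}$; let $\overline{\mathcal{X}_n^{\wedge}}\mathrm{fp}$ be the full subcategory of the finitely presented ones and $\mathcal{L}_{\mathcal{X}}^{n}$ that of the modules $G$ with an exact sequence $\overline{\mathcal{X}_n^{\wedge}}(X_0,-)\to\overline{\mathcal{X}_n^{\wedge}}(X_1,-)\to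 G\to 0$, $X_0\in\mathcal{X}$, $X_1\in\mathcal{X}_n^{\wedge}$, each with the class of the short exact sequences of modules with all terms in the subcategory. Then $M\mapsto\mathbb{E}(M,-)|_{\mathcal{X}_n^{\wedge}}$ induces a well-defined contravariant functor $\mathbb{K}$ from $\mathcal{X}_{n+1}^{\wedge}/[\mathcal{X}]$ to left $\overline{\mathcal{X}_n^{\wedge}}$-modules. Let $\varepsilon_{\mathbb{K}}$ be the class of the pairs $A'\xrightarrow{i}A\xrightarrow{p}A''$ in $\mathcal{X}_{n+1}^{\wedge}/[\mathcal{X}]$ such that $0\to\mathbb{K}(A'')\to\mathbb{K}(A)\to\mathbb{K}(A')\to 0$ is exact. The following statements hold. (a) $\mathrm{Im}(\mathbb{K})\subseteq\mathcal{L}_{\mathcal{X}}^{n}$, both $(\mathcal{X}_{n+1}^{\wedge}/[\mathcal{X}],\varepsilon_{\mathbb{K}})$ and $\mathcal{L}_{\mathcal{X}}^{n}$ are exact categories, and $\mathbb{K}:\mathcal{X}_{n+1}^{\wedge}/[\mathcal{X}]\to\mathcal{L}_{\mathcal{X}}^{n}$ is a duality of exact categories. If moreover $\mathcal{X}=\mathrm{smd}(\mathcal{X})$,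 then: (a1) $\mathcal{X}_{n+1}^{\wedge}/[\mathcal{X}]$ is weakly idempotent complete if $\mathcal{X}_{n+1}^{\wedge}$ has enough inflations to $\mathcal{X}$; (a2) $\mathcal{X}_{n+1}^{\wedge}/[\mathcal{X}]$ is Krull–Schmidt if $\mathcal{C}$ is. (b) Suppose that $\mathcal{X}_n^{\wedge}=\mathcal{X}$. Then: (b1) $\overline{\mathcal{X}}\mathrm{fp}$ is an exact category and $\mathbb{K}:\mathcal{X}_{n+1}^{\wedge}/[\mathcal{X}]\to\overline{\mathcal{X}}\mathrm{fp}$ is a duality of exact categories; (b2) if $\mathcal{C}$ has enough $\mathbb{E}$-injectives and $\mathcal{I}_{\mathbb{E}}(\mathcal{C})\subseteq\mathcal{X}$, then $\Sigma(\mathcal{X})\subseteq\mathcal{X}_{n+1}^{\wedge}$, and the objects of $\mathcal{X}_{n+1}^{\wedge}/[\mathcal{X}]$ that are injective with respect to all monomorphisms of this category are exactly the direct summands, in $\mathcal{X}_{n+1}^{\wedge}/[\mathcal{X}]$, of objects of $\Sigma(\mathcal{X})$: $\mathrm{Inj}(\mathcal{X}_{n+1}^{\wedge}/[\mathcal{X}])=\mathrm{smd}(\Sigma(\mathcal{X})/[\mathcal{X}])$.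 If in addition $\mathcal{C}$ is Krull–Schmidt and $\mathcal{X}=\mathrm{smd}(\mathcal{X})$, then they are exactly the objects isomorphic in $\mathcal{X}_{n+1}^{\wedge}/[\mathcal{X}]$ to an object of $\Sigma(\mathcal{X})$: $\mathrm{Inj}(\mathcal{X}_{n+1}^{\wedge}/[\mathcal{X}])=\Sigma(\mathcal{X})/[\mathcal{X}]$. -/

import Mathlib

open CategoryTheory CategoryTheory.Limits Opposite

universe v u

noncomputable section

attribute [local instance] hasBinaryBiproducts_of_finite_biproducts
  CategoryTheory.Abelian.hasFiniteBiproducts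

namespace ExtriQuot

/-! ### Additive categories: finite sums, summands, Krull-Schmidt, weak idempotent completeness -/

section Additive

variable {A : Type u} [Category.{v} A] [Preadditive A]

/-- `Y` is a (finite) coproduct of the finite family `f`. -/
def IsFiniteSum {k : ℕ} (f : Fin k → A) (Y : A) : Prop :=
  ∃ b : Bicone f, Nonempty b.IsBilimit ∧ Nonempty (b.pt ≅ Y)

/-- `Y` is a coproduct of `Y₁` and `Y₂`. -/
def IsBinarySum (Y₁ Y₂ Y : A) : Prop :=
  ∃ b : BinaryBicone Y₁ Y₂, Nonempty b.IsBilimit ∧ Nonempty (b.pt ≅ Y)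

/-- `free P`: all finite coproducts (the empty one included) of objects in `P`. -/
def free (P : ObjectProperty A) : ObjectProperty A := fun Y =>
  ∃ (k : ℕ) (f : Fin k → A), (∀ i, P (f i)) ∧ IsFiniteSum f Y

/-- `smd P`: all direct summands of objects in `P`. -/
def smd (P : ObjectProperty A) : ObjectProperty A := fun Y =>
  ∃ Y' Z : A, P Z ∧ IsBinarySum Y Y' Z

variable (A) in
/-- Every object is a finite coproduct of objects with local endomorphism ring. -/
def IsKrullSchmidt : Prop :=
  ∀ Y : A, ∃ (k : ℕ) (f : Fin k → A), (∀ i, IsLocalRing (End (f i))) ∧ IsFiniteSum f Y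

variable (A) in
/-- Additive, and every split epimorphism has a kernel. -/
structure IsWeaklyIdempotentComplete : Prop where
  additive : HasFiniteBiproducts A
  hasKernel : ∀ ⦃Y Z : A⦄ (p : Y ⟶ Z), IsSplitEpi p → HasKernel p

theorem free_zero {P : ObjectProperty A} [HasFiniteBiproducts A] (hP : free P = P) :
    ∃ Z : A, P Z := by
  refine ⟨⨁ (fun i : Fin 0 => i.elim0), ?_⟩
  rw [← hP]
  exact ⟨0, fun i => i.elim0, fun i => i.elim0, biproduct.bicone _,
    ⟨biproduct.isBilimit _⟩, ⟨Iso.refl _⟩⟩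

theorem free_sum {P : ObjectProperty A} [HasFiniteBiproducts A] (hP : free P = P) {k : ℕ}
    (f : Fin k → A) (hf : ∀ i, P (f i)) : P (⨁ f) := by
  rw [← hP]
  exact ⟨k, f, hf, biproduct.bicone _, ⟨biproduct.isBilimit _⟩, ⟨Iso.refl _⟩⟩

end Additive

/-! ### Ideals and quotient categories -/

/-- A two-sided ideal of a preadditive category. -/
structure CatIdeal (A : Type u) [Category.{v} A] [Preadditive A] where
  carrier : ∀ Y Z : A, AddSubgroup (Y ⟶ Z)
  precomp : ∀ {W Y Z : A} (f : W ⟶ Y) {g : Y ⟶ Z}, g ∈ carrier Y Z → f ≫ g ∈ carrier W Z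
  postcomp : ∀ {Y Z W : A} {f : Y ⟶ Z} (g : Z ⟶ W), f ∈ carrier Y Z → f ≫ g ∈ carrier Y W

namespace CatIdeal

section

variable {A : Type u} [Category.{v} A] [Preadditive A]

/-- Two morphisms are identified when their difference lies in the ideal. -/
def rel (I : CatIdeal A) : HomRel A := fun Y Z f g => f - g ∈ I.carrier Y Z

instance (I : CatIdeal A) : Congruence I.rel where
  equivalence :=
    { refl := fun f => by simp [rel, (I.carrier _ _).zero_mem]
      symm := fun {f g} h => by
        have := (I.carrier _ _).neg_mem h
        rwa [neg_sub] at this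
      trans := fun {f g k} h₁ h₂ => by
        have := (I.carrier _ _).add_mem h₁ h₂
        rwa [sub_add_sub_cancel] at this }
  comp_left f g g' h := by
    have := I.precomp f h
    rwa [Preadditive.comp_sub] at this
  comp_right g h := by
    have := I.postcomp g h
    rwa [Preadditive.sub_comp] at this

/-- The quotient category `A / I`. -/
abbrev Quot (I : CatIdeal A) : Type u := CategoryTheory.Quotient I.rel

instance (I : CatIdeal A) : Preadditive I.Quot :=
  CategoryTheory.Quotient.preadditive I.rel (fun Y Z f₁ f₂ g₁ g₂ h₁ h₂ => by
    have := (I.carrier _ _).add_mem h₁ h₂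
    rwa [sub_add_sub_comm] at this)

/-- The ideal induced on a full subcategory. -/
def restrict (I : CatIdeal A) (Q : ObjectProperty A) : CatIdeal Q.FullSubcategory where
  carrier Y Z :=
    { carrier := {f | f.hom ∈ I.carrier Y.obj Z.obj}
      zero_mem' := (I.carrier _ _).zero_mem
      add_mem' := fun h₁ h₂ => (I.carrier _ _).add_mem h₁ h₂
      neg_mem' := fun h => (I.carrier _ _).neg_mem h }
  precomp f _ h := I.precomp f.hom h
  postcomp g h := I.postcomp g.hom h

/-- `[X]`: the ideal of the morphisms that factor through an object of `X`,
where `X` is closed under finite coproducts. -/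
def through [HasFiniteBiproducts A] (X : ObjectProperty A) (hX : free X = X) : CatIdeal A where
  carrier Y Z :=
    { carrier := {f | ∃ (W : A) (a : Y ⟶ W) (b : W ⟶ Z), X W ∧ a ≫ b = f}
      zero_mem' := by
        obtain ⟨W, hW⟩ := free_zero hX
        exact ⟨W, 0, 0, hW, by simp⟩
      add_mem' := by
        rintro f g ⟨W, a, b, hW, rfl⟩ ⟨W', a', b', hW', rfl⟩
        let w : Fin 2 → A := fun i => Fin.cases W (fun _ => W') i
        have hw : ∀ i, X (w i) := fun i => Fin.cases hW (fun _ => hW') i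
        let p : ∀ i, Y ⟶ w i := fun i => Fin.cases (motive := fun i => Y ⟶ w i) a (fun _ => a') i
        let q : ∀ i, w i ⟶ Z := fun i => Fin.cases (motive := fun i => w i ⟶ Z) b (fun _ => b') i
        refine ⟨⨁ w, biproduct.lift p, biproduct.desc q, free_sum hX w hw, ?_⟩
        rw [biproduct.lift_desc, Fin.sum_univ_two]
        rfl
      neg_mem' := by
        rintro f ⟨W, a, b, hW, rfl⟩
        exact ⟨W, -a, b, hW, by simp⟩ }
  precomp := by
    rintro _ _ _ f _ ⟨W, a, b, hW, rfl⟩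
    exact ⟨W, f ≫ a, b, hW, by simp⟩
  postcomp := by
    rintro _ _ _ _ g ⟨W, a, b, hW, rfl⟩
    exact ⟨W, a, b ≫ g, hW, by simp⟩

end

end CatIdeal

/-! ### Exact categories -/

/-- A class of composable pairs of morphisms. -/
abbrev PairClass (A : Type u) [Category.{v} A] : Type (max u v) :=
  ∀ ⦃X Y Z : A⦄, (X ⟶ Y) → (Y ⟶ Z) → Prop

section Exact

variable {A : Type u} [Category.{v} A]

/-- `i` is an admissible monomorphism. -/
def PairClass.AdmMono (ε : PairClass A) {X Y : A} (i : X ⟶ Y) : Prop :=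
  ∃ (Z : A) (p : Y ⟶ Z), ε i p

/-- `p` is an admissible epimorphism. -/
def PairClass.AdmEpi (ε : PairClass A) {Y Z : A} (p : Y ⟶ Z) : Prop :=
  ∃ (X : A) (i : X ⟶ Y), ε i p

/-- `(A, ε)` is an exact category in the sense of Quillen: `A` is additive and `ε` is a class of
kernel-cokernel pairs, closed under isomorphisms, that satisfies the axioms
`[E0]`, `[E0op]`, `[E1]`, `[E1op]`, `[E2]`, `[E2op]`. -/
structure IsExactCategory [Preadditive A] (ε : PairClass A) : Prop where
  additive : HasFiniteBiproducts A
  kernel_cokernel : ∀ ⦃X Y Z : A⦄ (i : X ⟶ Y) (p : Y ⟶ Z), ε i p →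
    ∃ w : i ≫ p = 0, Nonempty (IsLimit (KernelFork.ofι i w)) ∧
      Nonempty (IsColimit (CokernelCofork.ofπ p w))
  iso_closed : ∀ ⦃X Y Z X' Y' Z' : A⦄ (i : X ⟶ Y) (p : Y ⟶ Z) (i' : X' ⟶ Y') (p' : Y' ⟶ Z')
    (a : X ≅ X') (b : Y ≅ Y') (c : Z ≅ Z'), i ≫ b.hom = a.hom ≫ i' → p ≫ c.hom = b.hom ≫ p' →
    ε i p → ε i' p'
  id_mono : ∀ X : A, ε.AdmMono (𝟙 X)
  id_epi : ∀ X : A, ε.AdmEpi (𝟙 X)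
  comp_mono : ∀ ⦃X Y Z : A⦄ (i : X ⟶ Y) (j : Y ⟶ Z), ε.AdmMono i → ε.AdmMono j →
    ε.AdmMono (i ≫ j)
  comp_epi : ∀ ⦃X Y Z : A⦄ (p : X ⟶ Y) (q : Y ⟶ Z), ε.AdmEpi p → ε.AdmEpi q →
    ε.AdmEpi (p ≫ q)
  pushout : ∀ ⦃X Y X' : A⦄ (i : X ⟶ Y) (f : X ⟶ X'), ε.AdmMono i →
    ∃ (Y' : A) (g : Y ⟶ Y') (i' : X' ⟶ Y'), IsPushout i f g i' ∧ ε.AdmMono i'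
  pullback : ∀ ⦃Y Z Z' : A⦄ (p : Y ⟶ Z) (f : Z' ⟶ Z), ε.AdmEpi p →
    ∃ (Y' : A) (g : Y' ⟶ Y) (p' : Y' ⟶ Z'), IsPullback g p' p f ∧ ε.AdmEpi p'

/-- The class of the pairs that a functor to an abelian category takes to short exact
sequences. -/
def inducedPairs {D : Type*} [Category D] [Abelian D] (F : A ⥤ D) : PairClass A :=
  fun _ _ _ i p => ∃ w : F.map i ≫ F.map p = 0, (ShortComplex.mk (F.map i) (F.map p) w).ShortExact

/-- The class of the pairs that a contravariant functor to an abelian category takes to short exact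
sequences. -/
def inducedPairsOp {D : Type*} [Category D] [Abelian D] (F : Aᵒᵖ ⥤ D) : PairClass A :=
  fun _ _ _ i p => inducedPairs F p.op i.op

/-- The exact structure that a full subcategory inherits from an abelian category: the short exact
sequences with all terms in the subcategory. -/
abbrev subcategoryPairs {D : Type*} [Category D] [Abelian D] (P : ObjectProperty D) :
    PairClass P.FullSubcategory :=
  inducedPairs P.ι

/-- The contravariant functor `F` is a duality of exact categories from `(A, ε)` to `(B, ε')`:
an additive anti-equivalence such that it and its quasi-inverses preserve conflations. -/
structure IsExactDuality [Preadditive A] {B : Type*} [Category B] [Preadditive B]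
    (ε : PairClass A) (ε' : PairClass B) (F : Aᵒᵖ ⥤ B) : Prop where
  isEquivalence : F.IsEquivalence
  additive : F.Additive
  conflation_iff : ∀ ⦃X Y Z : A⦄ (i : X ⟶ Y) (p : Y ⟶ Z), ε i p ↔ ε' (F.map p.op) (F.map i.op)

end Exact

/-! ### Modules over a small preadditive category -/

section Modules

variable {Z : Type u} [SmallCategory Z] [Preadditive Z]

/-- The representable left module `Z(W, -)`. -/
abbrev rep (W : Z) : Z ⥤ AddCommGrpCat.{u} := preadditiveCoyoneda.obj (op W)

/-- `Zfp`: the finitely presented left `Z`-modules, i.e. the additive functors from `Z` to abelian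
groups that are a cokernel of a morphism between finite coproducts of representable functors.
Exactness of a sequence of modules is exactness in the category of all functors,
that is, exactness at every object. -/
def finitelyPresented (Z : Type u) [SmallCategory Z] [Preadditive Z] :
    ObjectProperty (Z ⥤ AddCommGrpCat.{u}) := fun G =>
  G.Additive ∧ ∃ (k l : ℕ) (V : Fin k → Z) (W : Fin l → Z)
    (α : (⨁ fun i => rep (V i)) ⟶ (⨁ fun j => rep (W j))) (π : (⨁ fun j => rep (W j)) ⟶ G)
    (w : α ≫ π = 0), (ShortComplex.mk α π w).Exact ∧ Epi π

/-- The left `Z`-modules `G` with an exact sequence `Z(X₀, -) ⟶ Z(X₁, -) ⟶ G ⟶ 0`,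
where `X₀` lies in `P`. -/
def presentedBy (P : ObjectProperty Z) : ObjectProperty (Z ⥤ AddCommGrpCat.{u}) := fun G =>
  G.Additive ∧ ∃ (X₀ X₁ : Z) (_ : P X₀) (α : rep X₀ ⟶ rep X₁) (π : rep X₁ ⟶ G)
    (w : α ≫ π = 0), (ShortComplex.mk α π w).Exact ∧ Epi π

end Modules

/-! ### Extriangulated categories -/

section Bifunctor

variable {C : Type u} [SmallCategory C] (E : Cᵒᵖ ⥤ C ⥤ AddCommGrpCat.{u})

/-- `a · δ` for `δ ∈ E(Z, Y)` and `a : Y ⟶ Y'`. -/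
abbrev push {Z Y Y' : C} (a : Y ⟶ Y') (δ : (E.obj (op Z)).obj Y) : (E.obj (op Z)).obj Y' :=
  (E.obj (op Z)).map a δ

/-- `δ · c` for `δ ∈ E(Z, Y)` and `c : Z' ⟶ Z`. -/
abbrev pull {Z Z' Y : C} (δ : (E.obj (op Z)).obj Y) (c : Z' ⟶ Z) : (E.obj (op Z')).obj Y :=
  (E.map c.op).app Y δ

/-- `δ ⊕ δ'`: the extension with matrix `diag(δ, δ')`. -/
def sumExt [Preadditive C] [HasFiniteBiproducts C] {Z Y Z' Y' : C}
    (δ : (E.obj (op Z)).obj Y) (δ' : (E.obj (op Z')).obj Y') :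
    (E.obj (op (Z ⊞ Z'))).obj (Y ⊞ Y') :=
  push E biprod.inl (pull E δ biprod.fst) + push E biprod.inr (pull E δ' biprod.snd)

end Bifunctor

/-- An external triangulation of an additive category `C`: an additive bifunctor `E` and an additive
realization of `E` with (ET3), (ET4) and their duals. The realization assigns to each extension
`δ ∈ E(Z, X)` an equivalence class of sequences `X ⟶ Y ⟶ Z`; `Realizes x y δ` says that
`x, y` belongs to that class. -/
structure Extriangulation (C : Type u) [SmallCategory C] [Preadditive C]
    [HasFiniteBiproducts C] where
  E : Cᵒᵖ ⥤ C ⥤ AddCommGrpCat.{u}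
  additive_right : ∀ Z : Cᵒᵖ, (E.obj Z).Additive
  additive_left : ∀ Y : C, (E.flip.obj Y).Additive
  Realizes : ∀ {X Y Z : C}, (X ⟶ Y) → (Y ⟶ Z) → (E.obj (op Z)).obj X → Prop
  exists_realizes : ∀ {X Z : C} (δ : (E.obj (op Z)).obj X),
    ∃ (Y : C) (x : X ⟶ Y) (y : Y ⟶ Z), Realizes x y δ
  realizes_iff : ∀ {X Y Y' Z : C} {x : X ⟶ Y} {y : Y ⟶ Z} {δ : (E.obj (op Z)).obj X}
    (x' : X ⟶ Y') (y' : Y' ⟶ Z), Realizes x y δ →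
    (Realizes x' y' δ ↔ ∃ b : Y ≅ Y', x ≫ b.hom = x' ∧ b.hom ≫ y' = y)
  realizes_morphism : ∀ {X Y Z X' Y' Z' : C} {x : X ⟶ Y} {y : Y ⟶ Z} {δ : (E.obj (op Z)).obj X}
    {x' : X' ⟶ Y'} {y' : Y' ⟶ Z'} {δ' : (E.obj (op Z')).obj X'},
    Realizes x y δ → Realizes x' y' δ' → ∀ (a : X ⟶ X') (c : Z ⟶ Z'),
    push E a δ = pull E δ' c → ∃ b : Y ⟶ Y', x ≫ b = a ≫ x' ∧ y ≫ c = b ≫ y'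
  realizes_zero : ∀ X Z : C,
    Realizes (biprod.inl : X ⟶ X ⊞ Z) (biprod.snd : X ⊞ Z ⟶ Z) 0
  realizes_sum : ∀ {X Y Z X' Y' Z' : C} {x : X ⟶ Y} {y : Y ⟶ Z} {δ : (E.obj (op Z)).obj X}
    {x' : X' ⟶ Y'} {y' : Y' ⟶ Z'} {δ' : (E.obj (op Z')).obj X'},
    Realizes x y δ → Realizes x' y' δ' →
    Realizes (biprod.map x x') (biprod.map y y') (sumExt E δ δ')
  et3 : ∀ {X Y Z X' Y' Z' : C} {x : X ⟶ Y} {y : Y ⟶ Z} {δ : (E.obj (op Z)).obj X}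
    {x' : X' ⟶ Y'} {y' : Y' ⟶ Z'} {δ' : (E.obj (op Z')).obj X'},
    Realizes x y δ → Realizes x' y' δ' → ∀ (a : X ⟶ X') (b : Y ⟶ Y'), x ≫ b = a ≫ x' →
    ∃ c : Z ⟶ Z', y ≫ c = b ≫ y' ∧ push E a δ = pull E δ' c
  et3op : ∀ {X Y Z X' Y' Z' : C} {x : X ⟶ Y} {y : Y ⟶ Z} {δ : (E.obj (op Z)).obj X}
    {x' : X' ⟶ Y'} {y' : Y' ⟶ Z'} {δ' : (E.obj (op Z')).obj X'},
    Realizes x y δ → Realizes x' y' δ' → ∀ (b : Y ⟶ Y') (c : Z ⟶ Z'), y ≫ c = b ≫ y' →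
    ∃ a : X ⟶ X', x ≫ b = a ≫ x' ∧ push E a δ = pull E δ' c
  et4 : ∀ {A B D G F : C} {f : A ⟶ B} {f' : B ⟶ D} {δ : (E.obj (op D)).obj A}
    {g : B ⟶ G} {g' : G ⟶ F} {δ' : (E.obj (op F)).obj B},
    Realizes f f' δ → Realizes g g' δ' →
    ∃ (H : C) (d : D ⟶ H) (e : H ⟶ F) (h : A ⟶ G) (h' : G ⟶ H) (δ'' : (E.obj (op H)).obj A),
      f ≫ g = h ∧ f' ≫ d = g ≫ h' ∧ h' ≫ e = g' ∧ Realizes h h' δ'' ∧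
      Realizes d e (push E f' δ') ∧ pull E δ'' d = δ ∧ push E f δ'' = pull E δ' e
  et4op : ∀ {A B D G F : C} {f' : D ⟶ A} {f : A ⟶ B} {δ : (E.obj (op B)).obj D}
    {g' : F ⟶ B} {g : B ⟶ G} {δ' : (E.obj (op G)).obj F},
    Realizes f' f δ → Realizes g' g δ' →
    ∃ (H : C) (d : D ⟶ H) (e : H ⟶ F) (h' : H ⟶ A) (h : A ⟶ G) (δ'' : (E.obj (op G)).obj H),
      d ≫ h' = f' ∧ h' ≫ f = e ≫ g' ∧ f ≫ g = h ∧ Realizes h' h δ'' ∧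
      Realizes d e (pull E δ g') ∧ δ' = push E e δ'' ∧ push E d δ = pull E δ'' g

/-! ### Higher extension groups

The higher extension bifunctors of a small extriangulated category are the iterated coends
`Eⁱ⁺¹(X, A) = ∫^M Eⁱ(X, M) ⊗ E(M, A)`. -/

section Coend

variable {C : Type u} [SmallCategory C]

/-- Generators of the coend `∫^M F(M) ⊗ G(M)`. -/
abbrev CoendGen (F : C ⥤ AddCommGrpCat.{u}) (G : Cᵒᵖ ⥤ AddCommGrpCat.{u}) : Type u :=
  Σ M : C, F.obj M × G.obj (op M)

/-- The generator `x ⊗ y` at `M`. -/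
abbrev coendGen (F : C ⥤ AddCommGrpCat.{u}) (G : Cᵒᵖ ⥤ AddCommGrpCat.{u}) (M : C)
    (x : F.obj M) (y : G.obj (op M)) : FreeAbelianGroup (CoendGen F G) :=
  FreeAbelianGroup.of ⟨M, x, y⟩

/-- The relations of the coend: biadditivity and `f x ⊗ y = x ⊗ y f`. -/
inductive CoendRel (F : C ⥤ AddCommGrpCat.{u}) (G : Cᵒᵖ ⥤ AddCommGrpCat.{u}) :
    FreeAbelianGroup (CoendGen F G) → Prop
  | add_left (M : C) (x x' : F.obj M) (y : G.obj (op M)) :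
      CoendRel F G (coendGen F G M (x + x') y - coendGen F G M x y - coendGen F G M x' y)
  | add_right (M : C) (x : F.obj M) (y y' : G.obj (op M)) :
      CoendRel F G (coendGen F G M x (y + y') - coendGen F G M x y - coendGen F G M x y')
  | balanced {M N : C} (f : M ⟶ N) (x : F.obj M) (y : G.obj (op N)) :
      CoendRel F G (coendGen F G N (F.map f x) y - coendGen F G M x (G.map f.op y))

/-- The subgroup generated by the relations. -/
def coendSub (F : C ⥤ AddCommGrpCat.{u}) (G : Cᵒᵖ ⥤ AddCommGrpCat.{u}) :
    AddSubgroup (FreeAbelianGroup (CoendGen F G)) :=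
  AddSubgroup.closure {z | CoendRel F G z}

/-- The coend `∫^M F(M) ⊗ G(M)`. -/
abbrev Coend (F : C ⥤ AddCommGrpCat.{u}) (G : Cᵒᵖ ⥤ AddCommGrpCat.{u}) : Type u :=
  FreeAbelianGroup (CoendGen F G) ⧸ coendSub F G

/-- The map on generators induced by `φ : G ⟶ G'`. -/
def coendGenMap (F : C ⥤ AddCommGrpCat.{u}) {G G' : Cᵒᵖ ⥤ AddCommGrpCat.{u}} (φ : G ⟶ G') :
    CoendGen F G → CoendGen F G' :=
  fun t => ⟨t.1, t.2.1, φ.app (op t.1) t.2.2⟩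

theorem coendSub_le (F : C ⥤ AddCommGrpCat.{u}) {G G' : Cᵒᵖ ⥤ AddCommGrpCat.{u}} (φ : G ⟶ G') :
    coendSub F G ≤ (coendSub F G').comap (FreeAbelianGroup.map (coendGenMap F φ)) := by
  rw [coendSub, AddSubgroup.closure_le]
  rintro z hz
  refine AddSubgroup.subset_closure ?_
  cases hz with
  | add_left M x x' y =>
    simpa [coendGen, coendGenMap] using! CoendRel.add_left M x x' (φ.app (op M) y)
  | add_right M x y y' =>
    simpa [coendGen, coendGenMap] using!
      CoendRel.add_right M x (φ.app (op M) y) (φ.app (op M) y')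
  | @balanced M N f x y =>
    have h : φ.app (op M) (G.map f.op y) = G'.map f.op (φ.app (op N) y) :=
      NatTrans.naturality_apply φ f.op y
    simpa [coendGen, coendGenMap, h] using! CoendRel.balanced f x (φ.app (op N) y)

/-- Functoriality of the coend in the second variable. -/
def coendMap (F : C ⥤ AddCommGrpCat.{u}) {G G' : Cᵒᵖ ⥤ AddCommGrpCat.{u}} (φ : G ⟶ G') :
    Coend F G →+ Coend F G' :=
  QuotientAddGroup.map _ _ (FreeAbelianGroup.map (coendGenMap F φ)) (coendSub_le F φ)

/-- The functor `A ↦ ∫^M F(M) ⊗ E(M, A)`. -/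
def coendFunctor (E : Cᵒᵖ ⥤ C ⥤ AddCommGrpCat.{u}) (F : C ⥤ AddCommGrpCat.{u}) :
    C ⥤ AddCommGrpCat.{u} where
  obj A := AddCommGrpCat.of (Coend F (E.flip.obj A))
  map a := AddCommGrpCat.ofHom (coendMap F (E.flip.map a))
  map_id A := by
    apply AddCommGrpCat.hom_ext
    apply AddMonoidHom.ext
    intro z
    obtain ⟨z, rfl⟩ := QuotientAddGroup.mk_surjective z
    have h : coendGenMap F (E.flip.map (𝟙 A)) = id := by
      funext t
      simp [coendGenMap]
    change QuotientAddGroup.mk (FreeAbelianGroup.map (coendGenMap F (E.flip.map (𝟙 A))) z) = _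
    rw [h, FreeAbelianGroup.map_id_apply]
    rfl
  map_comp a b := by
    apply AddCommGrpCat.hom_ext
    apply AddMonoidHom.ext
    intro z
    obtain ⟨z, rfl⟩ := QuotientAddGroup.mk_surjective z
    have h : coendGenMap F (E.flip.map (a ≫ b)) =
        coendGenMap F (E.flip.map b) ∘ coendGenMap F (E.flip.map a) := by
      funext t
      simp [coendGenMap]
      rfl
    change QuotientAddGroup.mk (FreeAbelianGroup.map (coendGenMap F (E.flip.map (a ≫ b))) z) = _
    rw [h, FreeAbelianGroup.map_comp_apply]
    rfl

/-- `higherExt E X i` is the functor `Eⁱ⁺¹(X, -)`. -/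
def higherExt (E : Cᵒᵖ ⥤ C ⥤ AddCommGrpCat.{u}) (X : C) : ℕ → (C ⥤ AddCommGrpCat.{u})
  | 0 => E.obj (op X)
  | i + 1 => coendFunctor E (higherExt E X i)

end Coend

/-! ### Notions in extriangulated categories -/

namespace Extriangulation

variable {C : Type u} [SmallCategory C] [Preadditive C] [HasFiniteBiproducts C]
  (T : Extriangulation C)

/-- `x, y` is a conflation. -/
def IsConflation {X Y Z : C} (x : X ⟶ Y) (y : Y ⟶ Z) : Prop :=
  ∃ δ : (T.E.obj (op Z)).obj X, T.Realizes x y δ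

/-- `x` is an inflation. -/
def IsInflation {X Y : C} (x : X ⟶ Y) : Prop :=
  ∃ (Z : C) (y : Y ⟶ Z), T.IsConflation x y

/-- `X` is `(n+2)`-rigid: `Eⁱ(X, X) = 0` for `1 ≤ i ≤ n + 1`. -/
def IsRigid (n : ℕ) (X : ObjectProperty C) : Prop :=
  ∀ i : ℕ, i ≤ n → ∀ Y Z : C, X Y → X Z → ∀ δ : (higherExt T.E Y i).obj Z, δ = 0

/-- `Z` has a finite `X`-resolution `0 ⟶ Xₖ ⟶ ⋯ ⟶ X₀ ⟶ Z ⟶ 0` of length `k`. -/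
def HasResolution (X : ObjectProperty C) : ℕ → C → Prop
  | 0, Z => ∃ X₀ : C, X X₀ ∧ Nonempty (X₀ ≅ Z)
  | k + 1, Z => ∃ (K X₀ : C) (f : K ⟶ X₀) (g : X₀ ⟶ Z),
      HasResolution X k K ∧ X X₀ ∧ T.IsConflation f g

/-- `X_n^∧`: the objects of `X`-resolution dimension at most `n`. -/
def resClass (X : ObjectProperty C) (n : ℕ) : ObjectProperty C := fun Z =>
  ∃ k ≤ n, T.HasResolution X k Z

/-- `E`-injective morphisms: `E(-, g) = 0`. -/
def IsInjMor {Y Z : C} (g : Y ⟶ Z) : Prop :=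
  ∀ (W : C) (δ : (T.E.obj (op W)).obj Y), push T.E g δ = 0

/-- The class of `E`-injective objects. -/
def injObj : ObjectProperty C := fun I =>
  ∀ ⦃X Y Z : C⦄ (x : X ⟶ Y) (y : Y ⟶ Z), T.IsConflation x y →
    ∀ f : X ⟶ I, ∃ g : Y ⟶ I, x ≫ g = f

/-- `C` has enough `E`-injectives. -/
def EnoughInjectives : Prop :=
  ∀ Y : C, ∃ (I Z : C) (x : Y ⟶ I) (y : I ⟶ Z), T.injObj I ∧ T.IsConflation x y

/-- `Y` has enough inflations to `X`. -/
def EnoughInflations (Y X : ObjectProperty C) : Prop :=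
  ∀ Z : C, Y Z → ∃ (W : C) (g : Z ⟶ W), X W ∧ T.IsInflation g

/-- `Y` has enough `E`-injective morphisms to `X`. -/
def EnoughInjMor (Y X : ObjectProperty C) : Prop :=
  ∀ Z : C, Y Z → ∃ (W : C) (g : Z ⟶ W), X W ∧ T.IsInflation g ∧ T.IsInjMor g

/-- The cosyzygy class `Σ X`: the objects `Z` with a conflation `X' ⟶ I ⟶ Z`,
`X'` in `X` and `I` an `E`-injective object. -/
def cosyzygy (X : ObjectProperty C) : ObjectProperty C := fun Z =>
  ∃ (X' I : C) (f : X' ⟶ I) (g : I ⟶ Z), X X' ∧ T.injObj I ∧ T.IsConflation f g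

/-- The ideal of `E`-injective morphisms of `C`. -/
def injIdeal : CatIdeal C where
  carrier Y Z :=
    { carrier := {g | T.IsInjMor g}
      zero_mem' := fun W δ => by
        have := T.additive_right (op W)
        simp [push]
      add_mem' := fun {f g} hf hg W δ => by
        have := T.additive_right (op W)
        have h₁ : (T.E.obj (op W)).map f δ = 0 := hf W δ
        have h₂ : (T.E.obj (op W)).map g δ = 0 := hg W δ
        simp [push, Functor.map_add, h₁, h₂]
      neg_mem' := fun {f} hf W δ => by
        have := T.additive_right (op W)
        have h₁ : (T.E.obj (op W)).map f δ = 0 := hf W δ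
        simp [push, Functor.map_neg, h₁] }
  precomp {_ _ _} f {g} h W δ := by
    have := h W (push T.E f δ)
    simpa [push] using this
  postcomp {_ _ _ f} g h W δ := by
    have h₁ : (T.E.obj (op W)).map f δ = 0 := h W δ
    simp [push, h₁]

/-- The costable category of a full subcategory `P`: its quotient by the morphisms of `P` that are
`E`-injective in `C`. -/
abbrev Costable (P : ObjectProperty C) : Type u := (T.injIdeal.restrict P).Quot

/-- A class of objects of `C`, as a class of objects of the costable category of `P`. -/
def costableClass (P X : ObjectProperty C) : ObjectProperty (T.Costable P) := fun Z => X Z.as.obj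

/-- The left module `E(M, -)` over the costable category of `P`. -/
def extModule (P : ObjectProperty C) (M : C) : T.Costable P ⥤ AddCommGrpCat.{u} :=
  CategoryTheory.Quotient.lift _ (P.ι ⋙ T.E.obj (op M)) (fun Y Z f g h => by
    have := T.additive_right (op M)
    ext δ
    have h₁ : (T.E.obj (op M)).map (f.hom - g.hom) δ = 0 := h M δ
    rw [Functor.map_sub] at h₁
    simpa [sub_eq_zero] using h₁)

/-- The contravariant functor `M ↦ E(M, -)` to the left modules over the costable category
of `P`. -/
def extModuleFunctor (P : ObjectProperty C) : Cᵒᵖ ⥤ (T.Costable P ⥤ AddCommGrpCat.{u}) where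
  obj M := T.extModule P M.unop
  map h :=
    { app := fun Z => (T.E.map h).app Z.as.obj
      naturality := by
        rintro ⟨Y⟩ ⟨Z⟩ ⟨f⟩
        exact (T.E.map h).naturality f.hom }
  map_id M := by
    ext Z : 2
    exact congrArg (fun φ => NatTrans.app φ Z.as.obj) (T.E.map_id M)
  map_comp f g := by
    ext Z : 2
    exact congrArg (fun φ => NatTrans.app φ Z.as.obj) (T.E.map_comp f g)

/-- The ideal `I` of `C`, restricted to the full subcategory `Q`, is contained in the kernel of
`M ↦ E(M, -)|_P`. -/
def InKernel (P Q : ObjectProperty C) (I : CatIdeal C) : Prop :=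
  ∀ ⦃M N : Q.FullSubcategory⦄ (f : M ⟶ N), f.hom ∈ I.carrier M.obj N.obj →
    (T.extModuleFunctor P).map f.hom.op = 0

/-- The contravariant functor induced by `M ↦ E(M, -)|_P` on the quotient of the full subcategory
`Q` by the ideal `I`, which lies in its kernel. -/
def kFunctor (P Q : ObjectProperty C) (I : CatIdeal C) (hI : T.InKernel P Q I) :
    ((I.restrict Q).Quot)ᵒᵖ ⥤ (T.Costable P ⥤ AddCommGrpCat.{u}) :=
  (CategoryTheory.Quotient.lift (I.restrict Q).rel (Q.ι ⋙ (T.extModuleFunctor P).rightOp)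
    (fun M N f g h => by
      have h₁ : (T.extModuleFunctor P).map (f.hom.op - g.hom.op) = 0 := hI (f - g) h
      have h₂ : (T.extModuleFunctor P).map f.hom.op = (T.extModuleFunctor P).map g.hom.op := by
        ext Z δ
        have := T.additive_left Z.as.obj
        have h₃ : (T.E.flip.obj Z.as.obj).map (f.hom.op - g.hom.op) = 0 :=
          congrArg (fun φ => NatTrans.app φ Z) h₁
        rw [Functor.map_sub, sub_eq_zero] at h₃
        exact ConcreteCategory.congr_hom h₃ δ
      exact congrArg Quiver.Hom.op h₂)).leftOp

variable (X : ObjectProperty C) (n : ℕ) (hX : free X = X)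

/-- The quotient category `X_{n+1}^∧ / [X]`. -/
abbrev ResQuot : Type u :=
  ((CatIdeal.through X hX).restrict (T.resClass X (n + 1))).Quot

/-- The category of functors from the costable category of `X_n^∧` to abelian groups. The left
modules over this costable category are the additive ones. -/
abbrev CostableFunctors : Type (u + 1) :=
  T.Costable (T.resClass X n) ⥤ AddCommGrpCat.{u}

/-- The class `L_X^n` of left modules over the costable category of `X_n^∧`. -/
abbrev lClass : ObjectProperty (T.CostableFunctors X n) :=
  presentedBy (T.costableClass (T.resClass X n) X)

/-- The finitely presented left modules over the costable category of `X_n^∧`. -/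
abbrev fpClass : ObjectProperty (T.CostableFunctors X n) :=
  finitelyPresented (T.Costable (T.resClass X n))

/-- `[X]` is contained in the kernel of `M ↦ E(M, -)|_{X_n^∧}` on `X_{n+1}^∧`. -/
abbrev KWellDefined : Prop :=
  T.InKernel (T.resClass X n) (T.resClass X (n + 1)) (CatIdeal.through X hX)

/-- The contravariant functor `K` on `X_{n+1}^∧ / [X]` that takes `M` to `E(M, -)`, a module over
the costable category of `X_n^∧`. -/
abbrev K (hK : T.KWellDefined X n hX) : (T.ResQuot X n hX)ᵒᵖ ⥤ T.CostableFunctors X n :=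
  T.kFunctor (T.resClass X n) (T.resClass X (n + 1)) (CatIdeal.through X hX) hK

/-- `Σ(X) / [X]`, as a class of objects of `X_{n+1}^∧ / [X]`. -/
def cosyzygyQuot : ObjectProperty (T.ResQuot X n hX) := fun M => T.cosyzygy X M.as.obj

end Extriangulation

end ExtriQuot

end

open ExtriQuot

/-!
The key fact is `ext_eq_zero`: the rigidity of `X` gives `E(X, X_n^∧) = 0`. It follows by
dimension shifting along a resolution, which needs that, for a conflation `A ⟶ B ⟶ D` and a half
exact functor `F`, an element `x ∈ F(D)` whose image `x ⊗ δ` in `∫^M F(M) ⊗ E(M, A)` vanishes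
comes from `F(B)`. For this the coend is compared with the satellite of `F` at `A`, the directed
colimit of the cokernels of `F(Y) ⟶ F(M)` over the extensions of `M` by `A` with middle term `Y`,
where vanishing is detected at a finite stage (`HalfExact.mem_of_tensor_eq_zero`); that half
exactness passes from `F` to the coend makes the induction work.

An object `M` of `X_{n+1}^∧` has a conflation `A ⟶ X₀ ⟶ M` with class `δ`, where `X₀ ∈ X` and `A ∈
X_n^∧`. Since `E(X₀, -)` vanishes on `X_n^∧`, the module `E(M, -)` is generated by `δ` with the
single relation given by `A ⟶ X₀` (`K_presentation`). Thus `K` takes its values in `L`, and (ET3)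
and the long exact sequences show that it is full and faithful. It is dense (`K_essImage`): a
relation `V ⟶ X₀` becomes an inflation when the components of an `E`-injective inflation `V ⟶ W`,
`W ∈ X`, are added to it, and these are zero in the costable category. By the horseshoe lemma
(`presentedBy_of_shortExact`) `L` is closed under extensions in the abelian category of all
functors, so it is an exact category (`ExtensionClosed.isExactCategory`), and the exact structure
is transported along the duality.

If `X` is closed under direct summands, so is `X_{n+1}^∧` (`resClass_of_isBinarySum`). This gives
the Krull-Schmidt property, and the kernel of a split epimorphism of the quotient is found as a
direct summand in `C` after adding objects of `X`.

If `X_n^∧ = X`, then `L` consists of all finitely presented modules and is closed under cokernels.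
Hence monomorphisms in `X_{n+1}^∧ / [X]` correspond to epimorphisms of modules, cosyzygies of
objects of `X` correspond to representable modules, and these are the projective generators:
cosyzygies are injective, and every object embeds into one. The injective objects are therefore
the retracts of cosyzygies, and retracts have complements since `L` is closed under cokernels. In
the Krull-Schmidt case, the endomorphism ring of a cosyzygy of an indecomposable object is local
or zero, and the exchange property (`retract_of_binarySum`) shows that a retract of a cosyzygy is
a cosyzygy.
-/

noncomputable section

attribute [local instance] hasBinaryBiproducts_of_finite_biproducts
  CategoryTheory.Abelian.hasFiniteBiproducts

namespace ExtriQuot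

/-! ### Calculus of extensions -/

namespace Extriangulation

variable {C : Type u} [SmallCategory C] [Preadditive C] [HasFiniteBiproducts C]
  (T : Extriangulation C)

/-- The group `E(Z, Y)` of extensions. -/
abbrev Ext (Z Y : C) : Type u := (T.E.obj (op Z)).obj Y

theorem push_zero {Z Y Y' : C} (a : Y ⟶ Y') : push T.E a (0 : T.Ext Z Y) = 0 := map_zero _

theorem push_id {Z Y : C} (δ : T.Ext Z Y) : push T.E (𝟙 Y) δ = δ := by simp [push]

theorem push_comp {Z Y Y' Y'' : C} (a : Y ⟶ Y') (b : Y' ⟶ Y'') (δ : T.Ext Z Y) :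
    push T.E (a ≫ b) δ = push T.E b (push T.E a δ) := by simp [push]

theorem zero_push {Z Y Y' : C} (δ : T.Ext Z Y) : push T.E (0 : Y ⟶ Y') δ = 0 := by
  have := T.additive_right (op Z)
  simp [push]

theorem add_push {Z Y Y' : C} (a b : Y ⟶ Y') (δ : T.Ext Z Y) :
    push T.E (a + b) δ = push T.E a δ + push T.E b δ := by
  have := T.additive_right (op Z)
  simp [push, Functor.map_add]

theorem sub_push {Z Y Y' : C} (a b : Y ⟶ Y') (δ : T.Ext Z Y) :
    push T.E (a - b) δ = push T.E a δ - push T.E b δ := by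
  have := T.additive_right (op Z)
  simp [push, Functor.map_sub]

theorem pull_zero {Z Z' Y : C} (c : Z' ⟶ Z) : pull T.E (0 : T.Ext Z Y) c = 0 := map_zero _

theorem pull_add {Z Z' Y : C} (c : Z' ⟶ Z) (δ δ' : T.Ext Z Y) :
    pull T.E (δ + δ') c = pull T.E δ c + pull T.E δ' c := map_add _ _ _

theorem pull_id {Z Y : C} (δ : T.Ext Z Y) : pull T.E δ (𝟙 Z) = δ := by simp [pull]

theorem pull_comp {Z Z' Z'' Y : C} (c : Z'' ⟶ Z') (d : Z' ⟶ Z) (δ : T.Ext Z Y) :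
    pull T.E δ (c ≫ d) = pull T.E (pull T.E δ d) c := by simp [pull]

theorem zero_pull {Z Z' Y : C} (δ : T.Ext Z Y) : pull T.E δ (0 : Z' ⟶ Z) = 0 := by
  have := T.additive_left Y
  have h : (T.E.flip.obj Y).map (0 : Z' ⟶ Z).op = 0 := by
    rw [op_zero, Functor.map_zero]
  exact ConcreteCategory.congr_hom h δ

theorem add_pull {Z Z' Y : C} (c d : Z' ⟶ Z) (δ : T.Ext Z Y) :
    pull T.E δ (c + d) = pull T.E δ c + pull T.E δ d := by
  have := T.additive_left Y
  have h : (T.E.flip.obj Y).map (c + d).op =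
      (T.E.flip.obj Y).map c.op + (T.E.flip.obj Y).map d.op := by
    rw [op_add, Functor.map_add]
  exact ConcreteCategory.congr_hom h δ

theorem sub_pull {Z Z' Y : C} (c d : Z' ⟶ Z) (δ : T.Ext Z Y) :
    pull T.E δ (c - d) = pull T.E δ c - pull T.E δ d := by
  rw [eq_sub_iff_add_eq, ← add_pull, sub_add_cancel]

theorem push_pull {Z Z' Y Y' : C} (a : Y ⟶ Y') (c : Z' ⟶ Z) (δ : T.Ext Z Y) :
    push T.E a (pull T.E δ c) = pull T.E (push T.E a δ) c :=
  (NatTrans.naturality_apply (T.E.map c.op) a δ).symm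

variable {T}

theorem ext_eq_zero_right {Z Y : C} (hY : IsZero Y) (δ : T.Ext Z Y) : δ = 0 := by
  rw [← T.push_id δ, hY.eq_of_src (𝟙 Y) 0, zero_push]

/-! ### Exact sequences of a conflation -/

section Exactness

variable {A B D : C} {x : A ⟶ B} {y : B ⟶ D} {δ : T.Ext D A}

theorem Realizes.factors_inflation (h : T.Realizes x y δ) {Y : C} (f : A ⟶ Y)
    (hf : push T.E f δ = 0) : ∃ g : B ⟶ Y, x ≫ g = f := by
  obtain ⟨b, hb, -⟩ := T.realizes_morphism h (T.realizes_zero Y (⨁ fun i : Fin 0 => i.elim0))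
    f 0 (by rw [hf, pull_zero])
  exact ⟨b ≫ biprod.fst, by rw [← Category.assoc, hb]; simp⟩

theorem Realizes.lifts_deflation (h : T.Realizes x y δ) {W : C} (g : W ⟶ D)
    (hg : pull T.E δ g = 0) : ∃ f : W ⟶ B, f ≫ y = g := by
  obtain ⟨b, -, hb⟩ := T.realizes_morphism (T.realizes_zero (⨁ fun i : Fin 0 => i.elim0) W) h
    0 g (by rw [hg, push_zero])
  exact ⟨biprod.inr ≫ b, by rw [Category.assoc, ← hb]; simp⟩

/-- The zero object used to write the trivial conflations `Y ⟶ Y ⟶ 0` and `0 ⟶ Y ⟶ Y`. -/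
abbrev zeroObj (C : Type u) [SmallCategory C] [Preadditive C] [HasFiniteBiproducts C] : C :=
  ⨁ fun i : Fin 0 => i.elim0

theorem isZero_zeroObj : IsZero (zeroObj C) := by
  rw [IsZero.iff_id_eq_zero]
  apply biproduct.hom_ext
  exact fun i => i.elim0

theorem Realizes.comp_eq_zero (h : T.Realizes x y δ) : x ≫ y = 0 := by
  obtain ⟨b, hb, hb'⟩ := T.realizes_morphism (T.realizes_zero A (zeroObj C)) h (𝟙 A) 0
    (by rw [push_zero, zero_pull])
  have : x = biprod.inl ≫ b := by simpa using hb.symm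
  rw [this, Category.assoc, ← hb']
  simp

theorem Realizes.push_eq_zero (h : T.Realizes x y δ) : push T.E x δ = 0 := by
  obtain ⟨c, -, hc⟩ := T.et3 h (T.realizes_zero B (zeroObj C)) x biprod.inl rfl
  rw [hc, pull_zero]

theorem Realizes.pull_eq_zero (h : T.Realizes x y δ) : pull T.E δ y = 0 := by
  obtain ⟨a, -, ha⟩ := T.et3op (T.realizes_zero (zeroObj C) B) h biprod.snd y rfl
  rw [← ha, push_zero]

theorem Realizes.exists_desc (h : T.Realizes x y δ) {Y : C} (u : B ⟶ Y) (hu : x ≫ u = 0) :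
    ∃ v : D ⟶ Y, y ≫ v = u := by
  obtain ⟨c, hc, -⟩ := T.et3 h (T.realizes_zero (zeroObj C) Y) 0 (u ≫ biprod.inr)
    (by rw [← Category.assoc, hu]; simp)
  exact ⟨c, by simpa using hc⟩

theorem Realizes.exists_push_eq (h : T.Realizes x y δ) {Y : C} (ε : T.Ext D Y)
    (hε : pull T.E ε y = 0) : ∃ f : A ⟶ Y, push T.E f δ = ε := by
  obtain ⟨B', x', y', h'⟩ := T.exists_realizes ε
  obtain ⟨b, hb⟩ := h'.lifts_deflation y hε
  obtain ⟨a, -, ha⟩ := T.et3op h h' b (𝟙 D) (by simp [hb])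
  exact ⟨a, by rw [ha, pull_id]⟩

theorem Realizes.exists_pull_eq (h : T.Realizes x y δ) {W : C} (ε : T.Ext W A)
    (hε : push T.E x ε = 0) : ∃ c : W ⟶ D, pull T.E δ c = ε := by
  obtain ⟨B', x', y', h'⟩ := T.exists_realizes ε
  obtain ⟨b, hb⟩ := h'.factors_inflation x hε
  obtain ⟨c, -, hc⟩ := T.et3 h' h (𝟙 A) b (by simp [hb])
  exact ⟨c, by rw [← hc, push_id]⟩

/-- `E(W, -)` is half exact. -/
theorem Realizes.half_exact (h : T.Realizes x y δ) {W : C} (ε : T.Ext W B)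
    (hε : push T.E y ε = 0) : ∃ ε' : T.Ext W A, push T.E x ε' = ε := by
  obtain ⟨B', x', y', h'⟩ := T.exists_realizes ε
  obtain ⟨H, d, e, -, -, δ'', -, -, -, -, hde, -, h₂⟩ := T.et4 h h'
  obtain ⟨s, hs⟩ := hde.lifts_deflation (𝟙 W) (by rw [hε, pull_zero])
  refine ⟨pull T.E δ'' s, ?_⟩
  rw [push_pull, h₂, ← pull_comp, hs, pull_id]

end Exactness

/-! ### Isomorphisms, compositions and sums of conflations -/

/-- An endomorphism `u` of the middle term that is the identity on both ends is invertible: `u - 1`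
factors through `B ⟶ D ⟶ B` and is killed by `B ⟶ D`, so its square is zero. -/
theorem isIso_of_comp_unipotent {A B D : C} {x : A ⟶ B} {y : B ⟶ D} {δ : T.Ext D A}
    (h : T.Realizes x y δ) (u : B ⟶ B) (hx : x ≫ u = x) (hy : u ≫ y = y) : IsIso u := by
  obtain ⟨v, hv⟩ := h.exists_desc (u - 𝟙 B) (by simp [hx])
  have h₁ : (u - 𝟙 B) ≫ (u - 𝟙 B) = 0 := by
    nth_rw 2 [← hv]
    rw [← Category.assoc, Preadditive.sub_comp, hy]
    simp
  refine ⟨𝟙 B - (u - 𝟙 B), ?_, ?_⟩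
  · have : u ≫ (𝟙 B - (u - 𝟙 B)) = 𝟙 B - (u - 𝟙 B) ≫ (u - 𝟙 B) := by
      simp only [Preadditive.comp_sub, Preadditive.sub_comp, Category.comp_id, Category.id_comp]
      abel
    rw [this, h₁, sub_zero]
  · have : (𝟙 B - (u - 𝟙 B)) ≫ u = 𝟙 B - (u - 𝟙 B) ≫ (u - 𝟙 B) := by
      simp only [Preadditive.comp_sub, Preadditive.sub_comp, Category.comp_id, Category.id_comp]
      abel
    rw [this, h₁, sub_zero]

theorem isIso_of_realizes {A B D A' B' D' : C} {x : A ⟶ B} {y : B ⟶ D} {δ : T.Ext D A}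
    {x' : A' ⟶ B'} {y' : B' ⟶ D'} {δ' : T.Ext D' A'} (h : T.Realizes x y δ)
    (h' : T.Realizes x' y' δ') (a : A ≅ A') (c : D ≅ D')
    (hac : push T.E a.hom δ = pull T.E δ' c.hom) (b : B ⟶ B') (hb : x ≫ b = a.hom ≫ x')
    (hb' : y ≫ c.hom = b ≫ y') : IsIso b := by
  obtain ⟨b₁, hb₁, hb₁'⟩ := T.realizes_morphism h' h a.inv c.inv (by
    have : push T.E a.inv (pull T.E (push T.E a.hom δ) c.inv) =
      push T.E a.inv (pull T.E (pull T.E δ' c.hom) c.inv) := by rw [hac]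
    rw [push_pull, ← push_comp, ← pull_comp] at this
    simpa [push_id, pull_id] using this.symm)
  have i₁ : IsIso (b ≫ b₁) := isIso_of_comp_unipotent h _
    (by rw [← Category.assoc, hb, Category.assoc, hb₁]; simp)
    (by rw [Category.assoc, ← hb₁', ← Category.assoc, ← hb']; simp)
  have i₂ : IsIso (b₁ ≫ b) := isIso_of_comp_unipotent h' _
    (by rw [← Category.assoc, hb₁, Category.assoc, hb]; simp)
    (by rw [Category.assoc, ← hb', ← Category.assoc, ← hb₁']; simp)
  have : IsSplitMono b := ⟨⟨⟨b₁ ≫ inv (b ≫ b₁), by rw [← Category.assoc]; simp⟩⟩⟩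
  have : Epi b := by
    have : Epi (b₁ ≫ b) := inferInstance
    exact epi_of_epi b₁ b
  exact isIso_of_epi_of_isSplitMono b

theorem Realizes.of_iso {A B D A' D' : C} {x : A ⟶ B} {y : B ⟶ D} {δ : T.Ext D A}
    (h : T.Realizes x y δ) (a : A ≅ A') (c : D ≅ D') :
    T.Realizes (a.inv ≫ x) (y ≫ c.hom) (push T.E a.hom (pull T.E δ c.inv)) := by
  obtain ⟨B', x', y', h'⟩ := T.exists_realizes (push T.E a.hom (pull T.E δ c.inv))
  have hac : push T.E a.hom δ = pull T.E (push T.E a.hom (pull T.E δ c.inv)) c.hom := by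
    rw [← push_pull, ← pull_comp, Iso.hom_inv_id, pull_id]
  obtain ⟨b, hb, hb'⟩ := T.realizes_morphism h h' a.hom c.hom hac
  have := isIso_of_realizes h h' a c hac b hb hb'
  rw [T.realizes_iff _ _ h']
  refine ⟨(asIso b).symm, ?_, ?_⟩
  · rw [← cancel_mono b]; simp [hb]
  · simp [hb']

theorem Realizes.congr {A B B' D : C} {x : A ⟶ B} {y : B ⟶ D} {δ : T.Ext D A}
    (h : T.Realizes x y δ) (b : B ≅ B') {x' : A ⟶ B'} {y' : B' ⟶ D} (hx : x ≫ b.hom = x')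
    (hy : b.hom ≫ y' = y) : T.Realizes x' y' δ :=
  (T.realizes_iff x' y' h).2 ⟨b, hx, hy⟩

theorem realizes_zero_of_split {A B D : C} {x : A ⟶ B} {y : B ⟶ D} (r : B ⟶ A) (s : D ⟶ B)
    (hr : x ≫ r = 𝟙 A) (hs : s ≫ y = 𝟙 D) (hxy : x ≫ y = 0) (h : r ≫ x + y ≫ s = 𝟙 B) :
    T.Realizes x y 0 := by
  have hsr : s ≫ r = 0 := by
    have h₁ : s ≫ (r ≫ x + y ≫ s) ≫ r = s ≫ r := by rw [h]; simp
    rw [Preadditive.add_comp, Preadditive.comp_add, Category.assoc, hr, Category.assoc,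
      reassoc_of% hs, Category.comp_id] at h₁
    simpa using h₁
  refine (T.realizes_zero A D).congr ⟨biprod.desc x s, biprod.lift r y, ?_, ?_⟩ ?_ ?_
  · ext <;> simp [hr, hs, hxy, hsr]
  · simp [h]
  · simp
  · ext <;> simp [hs, hxy]

theorem IsConflation.comp_eq_zero {A B D : C} {x : A ⟶ B} {y : B ⟶ D}
    (h : T.IsConflation x y) : x ≫ y = 0 := h.choose_spec.comp_eq_zero

theorem IsInflation.comp {A B D : C} {f : A ⟶ B} {g : B ⟶ D} (hf : T.IsInflation f)
    (hg : T.IsInflation g) : T.IsInflation (f ≫ g) := by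
  obtain ⟨_, f', δ, h⟩ := hf
  obtain ⟨_, g', δ', h'⟩ := hg
  obtain ⟨H, d, e, k, k', δ'', rfl, -, -, hk, -⟩ := T.et4 h h'
  exact ⟨H, k', δ'', hk⟩

/-- The kernel of a composite of deflations is an extension of the kernels. -/
theorem IsConflation.comp_deflation {A B D F G : C} {f' : D ⟶ A} {f : A ⟶ B} {g' : F ⟶ B}
    {g : B ⟶ G} (h : T.IsConflation f' f) (h' : T.IsConflation g' g) :
    ∃ (H : C) (d : D ⟶ H) (e : H ⟶ F) (k : H ⟶ A),
      T.IsConflation k (f ≫ g) ∧ T.IsConflation d e ∧ k ≫ f = e ≫ g' ∧ d ≫ k = f' := by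
  obtain ⟨δ, h⟩ := h
  obtain ⟨δ', h'⟩ := h'
  obtain ⟨H, d, e, k, _, δ'', h₁, h₂, rfl, hk, hd, -⟩ := T.et4op h h'
  exact ⟨H, d, e, k, ⟨_, hk⟩, ⟨_, hd⟩, h₂, h₁⟩

theorem isConflation_of_split {A B D : C} {x : A ⟶ B} {y : B ⟶ D} (r : B ⟶ A) (s : D ⟶ B)
    (hr : x ≫ r = 𝟙 A) (hs : s ≫ y = 𝟙 D) (hxy : x ≫ y = 0) (h : r ≫ x + y ≫ s = 𝟙 B) :
    T.IsConflation x y := ⟨0, realizes_zero_of_split r s hr hs hxy h⟩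

theorem isConflation_id_left {A Z : C} (hZ : IsZero Z) : T.IsConflation (𝟙 A) (0 : A ⟶ Z) :=
  isConflation_of_split (𝟙 A) 0 (by simp) (hZ.eq_of_src _ _) (by simp) (by simp)

theorem isConflation_id_right {A Z : C} (hZ : IsZero Z) : T.IsConflation (0 : Z ⟶ A) (𝟙 A) :=
  isConflation_of_split 0 (𝟙 A) (hZ.eq_of_src _ _) (by simp) (by simp) (by simp)

theorem IsConflation.sum {A B D A' B' D' : C} {x : A ⟶ B} {y : B ⟶ D} {x' : A' ⟶ B'}
    {y' : B' ⟶ D'} (h : T.IsConflation x y) (h' : T.IsConflation x' y') :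
    T.IsConflation (biprod.map x x') (biprod.map y y') := by
  obtain ⟨δ, h⟩ := h
  obtain ⟨δ', h'⟩ := h'
  exact ⟨_, T.realizes_sum h h'⟩

theorem IsConflation.of_iso {A B D A' B' D' : C} {x : A ⟶ B} {y : B ⟶ D} {x' : A' ⟶ B'}
    {y' : B' ⟶ D'} (h : T.IsConflation x y) (a : A ≅ A') (b : B ≅ B') (c : D ≅ D')
    (hx : x ≫ b.hom = a.hom ≫ x') (hy : y ≫ c.hom = b.hom ≫ y') : T.IsConflation x' y' := by
  obtain ⟨δ, h⟩ := h
  refine ⟨_, (h.of_iso a c).congr b ?_ ?_⟩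
  · rw [Category.assoc, hx]; simp
  · exact hy.symm

/-- Adding components to an inflation gives an inflation: the graph of `f` is a split inflation. -/
theorem IsInflation.lift {A Y W : C} {j : A ⟶ W} (hj : T.IsInflation j) (f : A ⟶ Y) :
    T.IsInflation (biprod.lift f j) := by
  obtain ⟨Z, p, h⟩ := hj
  have h₁ : T.IsInflation (biprod.lift f (𝟙 A)) :=
    ⟨Y, biprod.fst - biprod.snd ≫ f, isConflation_of_split biprod.snd biprod.inl (by simp)
      (by simp) (by simp) (by ext <;> simp)⟩
  have h₂ : T.IsInflation (biprod.map (𝟙 Y) j) :=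
    ⟨_, _, (isConflation_id_left isZero_zeroObj).sum h⟩
  have h₃ : biprod.lift f j = biprod.lift f (𝟙 A) ≫ biprod.map (𝟙 Y) j := by ext <;> simp
  rw [h₃]
  exact h₁.comp h₂

end Extriangulation

namespace Extriangulation

variable {C : Type u} [SmallCategory C] [Preadditive C] [HasFiniteBiproducts C]
  {T : Extriangulation C}

/-! ### Pure tensors in the coend -/

section Tensor

variable (T) (F : C ⥤ AddCommGrpCat.{u})

/-- The class of `x ⊗ y` in `∫^M F(M) ⊗ E(M, A)`. -/
def tensor {M A : C} (x : F.obj M) (y : T.Ext M A) : (coendFunctor T.E F).obj A :=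
  QuotientAddGroup.mk (coendGen F (T.E.flip.obj A) M x y)

variable {F}

theorem tensor_eq_of_rel {A : C} {z : FreeAbelianGroup (CoendGen F (T.E.flip.obj A))}
    (h : CoendRel F (T.E.flip.obj A) z) :
    (QuotientAddGroup.mk z : Coend F (T.E.flip.obj A)) = 0 :=
  (QuotientAddGroup.eq_zero_iff _).2 (AddSubgroup.subset_closure h)

theorem add_tensor {M A : C} (x x' : F.obj M) (y : T.Ext M A) :
    T.tensor F (x + x') y = T.tensor F x y + T.tensor F x' y := by
  have h := T.tensor_eq_of_rel (CoendRel.add_left (G := T.E.flip.obj A) M x x' y)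
  rw [QuotientAddGroup.mk_sub, QuotientAddGroup.mk_sub, sub_sub, sub_eq_zero] at h
  exact h

theorem tensor_add {M A : C} (x : F.obj M) (y y' : T.Ext M A) :
    T.tensor F x (y + y') = T.tensor F x y + T.tensor F x y' := by
  have h := T.tensor_eq_of_rel (CoendRel.add_right (G := T.E.flip.obj A) M x y y')
  rw [QuotientAddGroup.mk_sub, QuotientAddGroup.mk_sub, sub_sub, sub_eq_zero] at h
  exact h

theorem map_tensor {M N A : C} (f : M ⟶ N) (x : F.obj M) (y : T.Ext N A) :
    T.tensor F (F.map f x) y = T.tensor F x (pull T.E y f) := by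
  have h := T.tensor_eq_of_rel (CoendRel.balanced (G := T.E.flip.obj A) f x y)
  rw [QuotientAddGroup.mk_sub, sub_eq_zero] at h
  exact h

theorem coendFunctor_map_tensor {M A B : C} (a : A ⟶ B) (x : F.obj M) (y : T.Ext M A) :
    (coendFunctor T.E F).map a (T.tensor F x y) = T.tensor F x (push T.E a y) := by
  change QuotientAddGroup.mk (FreeAbelianGroup.map _ (FreeAbelianGroup.of _)) = _
  rw [FreeAbelianGroup.map_of_apply]
  rfl

theorem tensor_zero {M A : C} (x : F.obj M) : T.tensor F x (0 : T.Ext M A) = 0 := by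
  have h := T.tensor_add x (0 : T.Ext M A) 0
  rw [add_zero] at h
  exact left_eq_add.1 h

theorem neg_tensor {M A : C} (x : F.obj M) (y : T.Ext M A) :
    T.tensor F (-x) y = - T.tensor F x y := by
  have h₀ : T.tensor F 0 y = 0 := by
    have h := T.add_tensor 0 (0 : F.obj M) y
    rw [add_zero] at h
    exact left_eq_add.1 h
  rw [eq_neg_iff_add_eq_zero, ← add_tensor, neg_add_cancel, h₀]

/-- Every element of the coend is a pure tensor, because a sum of pure tensors is a pure tensor
over the direct sum. -/
theorem exists_tensor {A : C} (z : (coendFunctor T.E F).obj A) :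
    ∃ (M : C) (x : F.obj M) (y : T.Ext M A), T.tensor F x y = z := by
  obtain ⟨z, rfl⟩ := QuotientAddGroup.mk_surjective z
  induction z using FreeAbelianGroup.induction_on with
  | zero => exact ⟨A, 0, 0, T.tensor_zero _⟩
  | of g => exact ⟨g.1, g.2.1, g.2.2, rfl⟩
  | neg g h =>
    obtain ⟨M, x, y, h⟩ := h
    exact ⟨M, -x, y, by rw [neg_tensor, h]; rfl⟩
  | add z z' h h' =>
    obtain ⟨M, x, y, h⟩ := h
    obtain ⟨M', x', y', h'⟩ := h'
    refine ⟨M ⊞ M', F.map biprod.inl x + F.map biprod.inr x',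
      pull T.E y biprod.fst + pull T.E y' biprod.snd, ?_⟩
    rw [add_tensor, map_tensor, map_tensor, pull_add, pull_add]
    simp only [← pull_comp, biprod.inl_fst, biprod.inl_snd, biprod.inr_fst, biprod.inr_snd,
      pull_id, zero_pull, add_zero, zero_add]
    rw [h, h']
    rfl

instance coendFunctor_additive : (coendFunctor T.E F).Additive where
  map_add {A B a b} := by
    ext z
    obtain ⟨M, x, y, rfl⟩ := T.exists_tensor z
    change (coendFunctor T.E F).map (a + b) _ =
      (coendFunctor T.E F).map a _ + (coendFunctor T.E F).map b _
    rw [coendFunctor_map_tensor, coendFunctor_map_tensor, coendFunctor_map_tensor, add_push,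
      tensor_add]

end Tensor

/-! ### The first satellite of a half exact functor -/

/-- `F` is exact in the middle of every conflation. -/
def HalfExact (T : Extriangulation C) (F : C ⥤ AddCommGrpCat.{u}) : Prop :=
  ∀ ⦃A B D : C⦄ ⦃x : A ⟶ B⦄ ⦃y : B ⟶ D⦄ ⦃δ : T.Ext D A⦄, T.Realizes x y δ →
    ∀ t : F.obj B, F.map y t = 0 → ∃ s : F.obj A, F.map x s = t

variable (T) in
/-- The extensions of objects of `C` by a fixed object `A`. -/
structure ExtOver (A : C) where
  /-- The quotient of the extension. -/
  left : C
  /-- The class of the extension. -/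
  ext : T.Ext left A

/-- `p ≤ q` when the extension `p` is a pullback of the extension `q`. -/
instance (A : C) : Preorder (T.ExtOver A) where
  le p q := ∃ c : p.left ⟶ q.left, pull T.E q.ext c = p.ext
  le_refl p := ⟨𝟙 _, T.pull_id _⟩
  le_trans p q r := by
    rintro ⟨c, hc⟩ ⟨d, hd⟩
    exact ⟨c ≫ d, by rw [pull_comp, hd, hc]⟩

instance (A : C) : IsDirectedOrder (T.ExtOver A) where
  directed p q := by
    refine ⟨⟨p.left ⊞ q.left, pull T.E p.ext biprod.fst + pull T.E q.ext biprod.snd⟩,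
      ⟨biprod.inl, ?_⟩, ⟨biprod.inr, ?_⟩⟩ <;>
    · rw [pull_add]
      simp only [← pull_comp, biprod.inl_fst, biprod.inl_snd, biprod.inr_fst, biprod.inr_snd,
        pull_id, zero_pull, add_zero, zero_add]

section Satellite

variable (F : C ⥤ AddCommGrpCat.{u})

/-- The elements of `F(M)` that come from a morphism `q : Y ⟶ M` along which the extension
`p ∈ E(M, A)` splits; equivalently, those coming from the middle term of `p`. -/
def splitSub {A : C} (p : T.ExtOver A) : AddSubgroup (F.obj p.left) where
  carrier := {x | ∃ (Y : C) (q : Y ⟶ p.left) (t : F.obj Y), pull T.E p.ext q = 0 ∧ F.map q t = x}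
  zero_mem' := ⟨p.left, 0, 0, zero_pull _ _, map_zero _⟩
  add_mem' := by
    rintro _ _ ⟨Y, q, t, hq, rfl⟩ ⟨Y', q', t', hq', rfl⟩
    refine ⟨Y ⊞ Y', biprod.desc q q', F.map biprod.inl t + F.map biprod.inr t', ?_, ?_⟩
    · have : biprod.desc q q' = biprod.fst ≫ q + biprod.snd ≫ q' := by ext <;> simp
      rw [this, add_pull, pull_comp, pull_comp, hq, hq', pull_zero, pull_zero, add_zero]
    · rw [map_add, ← ConcreteCategory.comp_apply, ← ConcreteCategory.comp_apply,
        ← F.map_comp, ← F.map_comp, biprod.inl_desc, biprod.inr_desc]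
  neg_mem' := by
    rintro _ ⟨Y, q, t, hq, rfl⟩
    exact ⟨Y, q, -t, hq, map_neg _ _⟩

/-- The terms of the directed system whose colimit is the satellite of `F` at `A`. -/
abbrev satTerm {A : C} (p : T.ExtOver A) : Type u := F.obj p.left ⧸ splitSub F p

theorem splitSub_le {A : C} {p q : T.ExtOver A} (c : p.left ⟶ q.left)
    (hc : pull T.E q.ext c = p.ext) :
    splitSub F p ≤ (splitSub F q).comap (F.map c).hom := by
  rintro _ ⟨Y, r, t, hr, rfl⟩
  exact ⟨Y, r ≫ c, t, by rw [pull_comp, hc, hr], by rw [F.map_comp]; rfl⟩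

/-- The transition maps of the directed system `satTerm`. -/
def satMap {A : C} (p q : T.ExtOver A) (h : p ≤ q) : satTerm F p →+ satTerm F q :=
  QuotientAddGroup.map _ _ (F.map h.choose).hom (splitSub_le F h.choose h.choose_spec)

/-- The transition maps do not depend on the morphism of extensions that is chosen, since the
difference of two choices splits the extension. -/
theorem satMap_mk [F.Additive] {A : C} {p q : T.ExtOver A} (h : p ≤ q) (c : p.left ⟶ q.left)
    (hc : pull T.E q.ext c = p.ext) (x : F.obj p.left) :
    satMap F p q h (QuotientAddGroup.mk x) = QuotientAddGroup.mk (F.map c x) := by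
  change QuotientAddGroup.mk (F.map h.choose x) = _
  rw [QuotientAddGroup.eq]
  refine ⟨p.left, c - h.choose, x, ?_, ?_⟩
  · rw [sub_pull, hc, h.choose_spec, sub_self]
  · rw [Functor.map_sub, neg_add_eq_sub]
    rfl

instance [F.Additive] {A : C} :
    DirectedSystem (fun p : T.ExtOver A => satTerm F p) fun p q h => satMap F p q h where
  map_self p x := by
    obtain ⟨x, rfl⟩ := QuotientAddGroup.mk_surjective x
    rw [satMap_mk F le_rfl (𝟙 _) (T.pull_id _)]
    simp
  map_map r q p hpq hqr x := by
    obtain ⟨x, rfl⟩ := QuotientAddGroup.mk_surjective x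
    obtain ⟨c, hc⟩ := id hpq
    obtain ⟨d, hd⟩ := id hqr
    rw [satMap_mk F hpq c hc, satMap_mk F hqr d hd,
      satMap_mk F (hpq.trans hqr) (c ≫ d) (by rw [pull_comp, hd, hc]), F.map_comp]
    rfl

open Classical in
/-- The first satellite of `F` at `A`. -/
abbrev Satellite (A : C) : Type u :=
  AddCommGroup.DirectLimit (fun p : T.ExtOver A => satTerm F p) (satMap F)

open Classical in
/-- The class in the satellite of an element `x ∈ F(M)` and an extension `y ∈ E(M, A)`. -/
def satOf {A M : C} (x : F.obj M) (y : T.Ext M A) : Satellite F A (T := T) :=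
  AddCommGroup.DirectLimit.of (fun p : T.ExtOver A => satTerm F p) (satMap F) ⟨M, y⟩
    (QuotientAddGroup.mk x)

theorem satOf_add {A M : C} (x x' : F.obj M) (y : T.Ext M A) :
    satOf F (x + x') y = satOf F x y + satOf F x' y := by
  classical
  rw [satOf, QuotientAddGroup.mk_add, map_add]
  rfl

variable [F.Additive]

theorem satOf_map {A M N : C} (f : M ⟶ N) (x : F.obj M) (y : T.Ext N A) :
    satOf F (F.map f x) y = satOf F x (pull T.E y f) := by
  classical
  have h : (⟨M, pull T.E y f⟩ : T.ExtOver A) ≤ ⟨N, y⟩ := ⟨f, rfl⟩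
  rw [satOf, satOf, ← AddCommGroup.DirectLimit.of_f h, satMap_mk F h f rfl]

theorem satOf_add_right {A M : C} (x : F.obj M) (y y' : T.Ext M A) :
    satOf F x (y + y') = satOf F x y + satOf F x y' := by
  have h : ∀ z : M ⟶ M ⊞ M,
      pull T.E (pull T.E y biprod.fst + pull T.E y' biprod.snd) z =
        pull T.E y (z ≫ biprod.fst) + pull T.E y' (z ≫ biprod.snd) := fun z => by
    rw [pull_add, pull_comp, pull_comp]
  have h₁ := satOf_map F (T := T) (A := A) (biprod.lift (𝟙 M) (𝟙 M)) x
    (pull T.E y biprod.fst + pull T.E y' biprod.snd)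
  have h₂ := satOf_map F (T := T) (A := A) (biprod.inl : M ⟶ M ⊞ M) x
    (pull T.E y biprod.fst + pull T.E y' biprod.snd)
  have h₃ := satOf_map F (T := T) (A := A) (biprod.inr : M ⟶ M ⊞ M) x
    (pull T.E y biprod.fst + pull T.E y' biprod.snd)
  rw [h] at h₁ h₂ h₃
  simp only [biprod.lift_fst, biprod.lift_snd, pull_id, biprod.inl_fst, biprod.inl_snd,
    biprod.inr_fst, biprod.inr_snd, zero_pull, add_zero, zero_add] at h₁ h₂ h₃
  rw [← h₁, ← h₂, ← h₃, ← satOf_add]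
  congr 1
  have : biprod.lift (𝟙 M) (𝟙 M) = biprod.inl + biprod.inr := by ext <;> simp
  rw [this, F.map_add]
  rfl

/-- The comparison from the coend to the satellite. -/
def tensorToSat (A : C) : Coend F (T.E.flip.obj A) →+ Satellite F A (T := T) :=
  QuotientAddGroup.lift _ (FreeAbelianGroup.lift fun g => satOf F g.2.1 g.2.2) (by
    intro z hz
    refine (AddSubgroup.closure_le _).2 ?_ hz
    intro z hz
    change FreeAbelianGroup.lift _ z = 0
    cases hz with
    | add_left M x x' y =>
      simp only [map_sub, FreeAbelianGroup.lift_apply_of]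
      rw [satOf_add]
      abel
    | add_right M x y y' =>
      simp only [map_sub, FreeAbelianGroup.lift_apply_of]
      erw [satOf_add_right]
      abel
    | @balanced M N f x y =>
      simp only [map_sub, FreeAbelianGroup.lift_apply_of]
      erw [satOf_map]
      exact sub_self _)

variable {F}

/-- A pure tensor `x ⊗ δ` vanishes only if `x` comes from the middle term of `δ`. The satellite is
a directed colimit, so `x` comes from the middle term after a morphism of extensions; half
exactness of `F` on the mapping cone of that morphism brings it back to `δ` itself. -/
theorem HalfExact.mem_of_tensor_eq_zero (hF : HalfExact T F) {A B D : C} {i : A ⟶ B} {p : B ⟶ D}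
    {δ : T.Ext D A} (h : T.Realizes i p δ) (x : F.obj D) (hx : T.tensor F x δ = 0) :
    ∃ t : F.obj B, F.map p t = x := by
  classical
  have h₀ : satOf F x δ = 0 := by
    rw [← (congrArg (tensorToSat F A) hx).trans (map_zero (tensorToSat F A))]
    exact (FreeAbelianGroup.lift_apply_of _ _).symm
  obtain ⟨⟨M, y⟩, ⟨c, hc⟩, hx'⟩ := AddCommGroup.DirectLimit.of.zero_exact _ _ h₀
  rw [satMap_mk F ⟨c, hc⟩ c hc, QuotientAddGroup.eq_zero_iff] at hx'
  obtain ⟨Y, q, t, hq, hqt⟩ := hx'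
  dsimp only at q hq c hc hqt
  obtain ⟨Y', i', p', h'⟩ := T.exists_realizes y
  obtain ⟨q', rfl⟩ := h'.lifts_deflation q hq
  have hsum := T.realizes_sum (T.realizes_zero (zeroObj C) D) h'
  -- the split conflation `D ⟶ D ⊞ M ⟶ M`, the graph of `c`
  have hgr : T.Realizes (biprod.lift (𝟙 D) (-c)) (biprod.desc c (𝟙 M)) 0 :=
    realizes_zero_of_split biprod.fst biprod.inr (by simp) (by simp) (by simp)
      (by ext <;> simp)
  -- `(x, -t)` maps to zero in `F(M)`, so it comes from the kernel of the deflation `D ⊞ Y' ⟶ M`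
  let s : F.obj ((zeroObj C ⊞ D) ⊞ Y') :=
    F.map (biprod.inr ≫ biprod.inl) x - F.map (q' ≫ biprod.inr) t
  obtain ⟨H, d, e, k, m, δ'', -, hk, hm, hkm, hde, -⟩ := T.et4op hsum hgr
  obtain ⟨w, hw⟩ := hF hkm s (by
    rw [map_sub, ← ConcreteCategory.comp_apply, ← ConcreteCategory.comp_apply,
        ← F.map_comp, ← F.map_comp, ← hm]
    have h₁ : (biprod.inr ≫ biprod.inl : D ⟶ (zeroObj C ⊞ D) ⊞ Y') ≫
      biprod.map biprod.snd p' ≫ biprod.desc c (𝟙 M) = c := by simp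
    have h₂ : (q' ≫ biprod.inr : Y ⟶ (zeroObj C ⊞ D) ⊞ Y') ≫
      biprod.map biprod.snd p' ≫ biprod.desc c (𝟙 M) = q' ≫ p' := by simp
    rw [h₁, h₂, hqt, sub_self])
  have he : k ≫ biprod.fst ≫ biprod.snd = e := by
    have := congrArg (fun f => f ≫ biprod.fst) hk
    simpa using this
  have hx₁ : F.map e w = x := by
    rw [← he, F.map_comp, ConcreteCategory.comp_apply, hw, map_sub,
      ← ConcreteCategory.comp_apply, ← ConcreteCategory.comp_apply, ← F.map_comp, ← F.map_comp]
    simp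
  have hpull : pull T.E δ e = 0 := by
    have h₁ := hde.pull_eq_zero
    have h₂ := congrArg (push T.E (biprod.snd : zeroObj C ⊞ A ⟶ A)) h₁
    rw [sumExt, pull_zero, push_zero, zero_add, push_zero] at h₂
    simp only [push_pull, ← push_comp, ← pull_comp, biprod.inr_snd, push_id, biprod.lift_snd,
      Preadditive.comp_neg] at h₂
    rw [← zero_sub, sub_pull, zero_pull, zero_sub, neg_eq_zero, pull_comp, hc] at h₂
    exact h₂
  obtain ⟨f, rfl⟩ := h.lifts_deflation e hpull
  exact ⟨F.map f w, by rw [← hx₁, F.map_comp]; rfl⟩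

/-- Half exactness passes to the satellite: in a pure tensor `x ⊗ y` that dies in `D`, the
element `x` comes from the pushout of the extension `y` along `B ⟶ D`, which by (ET4)
carries an extension by `A`. -/
theorem HalfExact.coendFunctor (hF : HalfExact T F) : HalfExact T (coendFunctor T.E F) := by
  intro A B D i p δ h z hz
  obtain ⟨M, x, y, rfl⟩ := T.exists_tensor z
  rw [coendFunctor_map_tensor] at hz
  obtain ⟨Y, j, q, hy⟩ := T.exists_realizes y
  obtain ⟨H, d, e, -, -, δ'', -, -, -, -, hde, -, h₂⟩ := T.et4 h hy
  obtain ⟨t, rfl⟩ := hF.mem_of_tensor_eq_zero hde x hz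
  exact ⟨T.tensor F t δ'', by rw [coendFunctor_map_tensor, map_tensor, h₂]⟩

end Satellite

theorem higherExt_additive_halfExact (W : C) (i : ℕ) :
    (higherExt T.E W i).Additive ∧ HalfExact T (higherExt T.E W i) := by
  induction i with
  | zero => exact ⟨T.additive_right _, fun _ _ _ _ _ _ h ε hε => h.half_exact ε hε⟩
  | succ i ih =>
    have := ih.1
    exact ⟨T.coendFunctor_additive, ih.2.coendFunctor⟩

/-- Dimension shifting: `Eⁱ(W, B) = 0` and `Eⁱ⁺¹(W, A) = 0` imply `Eⁱ(W, D) = 0`, for a conflation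
`A ⟶ B ⟶ D`. -/
theorem higherExt_eq_zero {A B D : C} {x : A ⟶ B} {y : B ⟶ D} (h : T.IsConflation x y) (W : C)
    (i : ℕ) (hB : ∀ t : (higherExt T.E W i).obj B, t = 0)
    (hA : ∀ t : (higherExt T.E W (i + 1)).obj A, t = 0) (t : (higherExt T.E W i).obj D) :
    t = 0 := by
  obtain ⟨δ, h⟩ := h
  obtain ⟨_, hF⟩ := higherExt_additive_halfExact (T := T) W i
  obtain ⟨s, rfl⟩ := hF.mem_of_tensor_eq_zero h t (hA _)
  rw [hB s, map_zero]

end Extriangulation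

/-! ### Finite sums and summands -/

section Additive

variable {A : Type u} [Category.{v} A] [Preadditive A]

theorem isBinarySum_iff {Y Y' Z : A} : IsBinarySum Y Y' Z ↔
    ∃ (i : Y ⟶ Z) (p : Z ⟶ Y) (i' : Y' ⟶ Z) (p' : Z ⟶ Y'), i ≫ p = 𝟙 Y ∧ i' ≫ p' = 𝟙 Y' ∧
      i ≫ p' = 0 ∧ i' ≫ p = 0 ∧ p ≫ i + p' ≫ i' = 𝟙 Z := by
  constructor
  · rintro ⟨b, ⟨hb⟩, ⟨e⟩⟩
    refine ⟨b.inl ≫ e.hom, e.inv ≫ b.fst, b.inr ≫ e.hom, e.inv ≫ b.snd, by simp, by simp,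
      by simp, by simp, ?_⟩
    have h : b.fst ≫ b.inl + b.snd ≫ b.inr = 𝟙 b.pt := by
      apply BinaryFan.IsLimit.hom_ext hb.isLimit <;> simp
    have h' := congrArg (fun f => e.inv ≫ f ≫ e.hom) h
    simpa using h'
  · rintro ⟨i, p, i', p', h₁, h₂, h₃, h₄, h⟩
    let b : BinaryBicone Y Y' :=
      { pt := Z, fst := p, snd := p', inl := i, inr := i', inl_fst := h₁, inl_snd := h₃,
        inr_fst := h₄, inr_snd := h₂ }
    exact ⟨b, ⟨isBinaryBilimitOfTotal b h⟩, ⟨Iso.refl _⟩⟩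

theorem IsBinarySum.of_iso {Y Y' Z W : A} (h : IsBinarySum Y Y' Z) (e : Z ≅ W) :
    IsBinarySum Y Y' W := by
  obtain ⟨b, hb, ⟨e'⟩⟩ := h
  exact ⟨b, hb, ⟨e' ≪≫ e⟩⟩

theorem IsBinarySum.symm {Y Y' Z : A} (h : IsBinarySum Y Y' Z) : IsBinarySum Y' Y Z := by
  obtain ⟨i, p, i', p', h₁, h₂, h₃, h₄, h⟩ := isBinarySum_iff.1 h
  exact isBinarySum_iff.2 ⟨i', p', i, p, h₂, h₁, h₄, h₃, by rw [add_comm, h]⟩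

theorem isFiniteSum_iff {k : ℕ} {f : Fin k → A} {Z : A} : IsFiniteSum f Z ↔
    ∃ (i : ∀ j, f j ⟶ Z) (p : ∀ j, Z ⟶ f j), (∀ j, i j ≫ p j = 𝟙 (f j)) ∧
      (∀ j l, j ≠ l → i j ≫ p l = 0) ∧ ∑ j, p j ≫ i j = 𝟙 Z := by
  classical
  constructor
  · rintro ⟨b, ⟨hb⟩, ⟨e⟩⟩
    refine ⟨fun j => b.ι j ≫ e.hom, fun j => e.inv ≫ b.π j, fun j => by simp, fun j l hjl => ?_, ?_⟩
    · simpa using bicone_ι_π_ne b hjl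
    · have h := congrArg (fun f => e.inv ≫ f ≫ e.hom) (IsBilimit.total hb)
      simpa [Preadditive.sum_comp, Preadditive.comp_sum] using h
  · rintro ⟨i, p, h₁, h₂, h⟩
    let b : Bicone f :=
      { pt := Z, π := p, ι := i
        ι_π := fun j l => by
          by_cases hjl : j = l
          · subst hjl
            simpa using h₁ j
          · simpa [hjl] using h₂ j l hjl }
    exact ⟨b, ⟨isBilimitOfTotal b h⟩, ⟨Iso.refl _⟩⟩

/-- The first summand of a finite sum can be split off. -/
theorem IsFiniteSum.exists_succ [HasFiniteBiproducts A] {k : ℕ} {f : Fin (k + 1) → A} {Z : A}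
    (h : IsFiniteSum f Z) :
    ∃ Z' : A, IsFiniteSum (fun j => f (Fin.succ j)) Z' ∧ IsBinarySum (f 0) Z' Z := by
  obtain ⟨i, p, h₁, h₂, h⟩ := isFiniteSum_iff.1 h
  refine ⟨⨁ fun j => f (Fin.succ j), ⟨biproduct.bicone _, ⟨biproduct.isBilimit _⟩, ⟨Iso.refl _⟩⟩,
    isBinarySum_iff.2 ⟨i 0, p 0, biproduct.desc fun j => i j.succ,
      biproduct.lift fun j => p j.succ, h₁ 0, ?_, ?_, ?_, ?_⟩⟩
  · ext l j
    by_cases hjl : j = l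
    · subst hjl
      simp [h₁]
    · have : j.succ ≠ l.succ := fun e => hjl (Fin.succ_injective _ e)
      simp [biproduct.ι_π_ne _ hjl, h₂ _ _ this]
  · ext l
    simpa using h₂ _ _ (Fin.succ_ne_zero l).symm
  · ext l
    simpa using h₂ _ _ (Fin.succ_ne_zero l)
  · rw [biproduct.lift_desc, ← Fin.sum_univ_succ (fun j => p j ≫ i j), h]

section Free

variable {P : ObjectProperty A} (hP : free P = P)

include hP

theorem free_of_iso {Y Z : A} (e : Y ≅ Z) (hY : P Y) : P Z := by
  rw [← hP] at hY ⊢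
  obtain ⟨k, f, hf, b, hb, ⟨e'⟩⟩ := hY
  exact ⟨k, f, hf, b, hb, ⟨e' ≪≫ e⟩⟩

theorem free_isZero {Z : A} (hZ : IsZero Z) : P Z := by
  rw [← hP]
  exact ⟨0, fun i => i.elim0, fun i => i.elim0, isFiniteSum_iff.2
    ⟨fun i => i.elim0, fun i => i.elim0, fun i => i.elim0, fun i => i.elim0, hZ.eq_of_src _ _⟩⟩

theorem free_binarySum {Y Y' Z : A} (h : IsBinarySum Y Y' Z) (hY : P Y) (hY' : P Y') : P Z := by
  rw [← hP]
  obtain ⟨i, p, i', p', h₁, h₂, h₃, h₄, h⟩ := isBinarySum_iff.1 h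
  let w : Fin 2 → A := fun j => Fin.cases Y (fun _ => Y') j
  refine ⟨2, w, fun j => Fin.cases (motive := fun j => P (w j)) hY (fun _ => hY') j,
    isFiniteSum_iff.2 ⟨fun j => Fin.cases (motive := fun j => w j ⟶ Z) i (fun _ => i') j,
      fun j => Fin.cases (motive := fun j => Z ⟶ w j) p (fun _ => p') j, ?_, ?_, ?_⟩⟩
  · intro j
    fin_cases j
    · exact h₁
    · exact h₂
  · intro j l hjl
    fin_cases j <;> fin_cases l
    · exact absurd rfl hjl
    · exact h₃
    · exact h₄
    · exact absurd rfl hjl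
  · rw [Fin.sum_univ_two]
    exact h

end Free

theorem isBinarySum_biprod [HasFiniteBiproducts A] (Y Y' : A) : IsBinarySum Y Y' (Y ⊞ Y') :=
  ⟨BinaryBiproduct.bicone Y Y', ⟨BinaryBiproduct.isBilimit Y Y'⟩, ⟨Iso.refl _⟩⟩

theorem IsBinarySum.nonempty_iso [HasFiniteBiproducts A] {Y Y' Z : A} (h : IsBinarySum Y Y' Z) :
    Nonempty (Y ⊞ Y' ≅ Z) := by
  obtain ⟨b, ⟨hb⟩, ⟨e⟩⟩ := h
  exact ⟨(biprod.uniqueUpToIso _ _ hb).symm ≪≫ e⟩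

/-- A category with a zero object and binary sums has finite biproducts. -/
theorem hasFiniteBiproducts_of_isBinarySum (h₀ : ∃ Z : A, IsZero Z)
    (h₂ : ∀ Y Y' : A, ∃ Z, IsBinarySum Y Y' Z) : HasFiniteBiproducts A := by
  have : HasZeroObject A := ⟨h₀⟩
  have : HasBinaryBiproducts A := ⟨fun Y Y' => by
    obtain ⟨Z, b, ⟨hb⟩, -⟩ := h₂ Y Y'
    exact HasBinaryBiproduct.mk ⟨b, hb⟩⟩
  have : HasFiniteProducts A := hasFiniteProducts_of_has_binary_and_terminal
  exact HasFiniteBiproducts.of_hasFiniteProducts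

end Additive

namespace Extriangulation

variable {C : Type u} [SmallCategory C] [Preadditive C] [HasFiniteBiproducts C]
  {T : Extriangulation C}

theorem Realizes.exists_lift {A B D : C} {x : A ⟶ B} {y : B ⟶ D} {δ : T.Ext D A}
    (h : T.Realizes x y δ) {Y : C} (u : Y ⟶ B) (hu : u ≫ y = 0) : ∃ v : Y ⟶ A, v ≫ x = u := by
  obtain ⟨a, ha, -⟩ := T.et3op (T.realizes_zero Y (zeroObj C)) h (biprod.fst ≫ u) 0 (by simp [hu])
  exact ⟨a, by simpa using ha.symm⟩

/-- An inflation that is a split monomorphism is the inclusion of a direct summand. -/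
theorem IsConflation.isBinarySum {B V Z : C} {x : B ⟶ V} {y : V ⟶ Z} (h : T.IsConflation x y)
    (r : V ⟶ B) (hr : x ≫ r = 𝟙 B) :
    ∃ v : Z ⟶ V, v ≫ y = 𝟙 Z ∧ v ≫ r = 0 ∧ r ≫ x + y ≫ v = 𝟙 V := by
  have hxy := h.comp_eq_zero
  obtain ⟨δ, h⟩ := h
  have hδ : δ = 0 := by
    rw [← T.push_id δ, ← hr, push_comp, h.push_eq_zero, push_zero]
  obtain ⟨s, hs⟩ := h.lifts_deflation (𝟙 Z) (by rw [hδ, pull_zero])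
  obtain ⟨v, hv⟩ := h.exists_desc (𝟙 V - r ≫ x) (by simp [reassoc_of% hr])
  refine ⟨v, ?_, ?_, by rw [hv]; abel⟩
  · have h₁ : s ≫ (y ≫ v) ≫ y = s ≫ (𝟙 V - r ≫ x) ≫ y := by rw [hv]
    simpa [reassoc_of% hs, hs, hxy] using h₁
  · have h₁ : s ≫ (y ≫ v) ≫ r = s ≫ (𝟙 V - r ≫ x) ≫ r := by rw [hv]
    simpa [reassoc_of% hs, hs, hr] using h₁

/-! ### Objects of finite resolution dimension -/

section ResClass

variable {X : ObjectProperty C} (hX : free X = X)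

include hX

theorem resClass_zero_iff {M : C} : T.resClass X 0 M ↔ X M := by
  constructor
  · rintro ⟨k, hk, h⟩
    obtain rfl := Nat.le_zero.1 hk
    obtain ⟨X₀, h₀, ⟨e⟩⟩ := h
    exact free_of_iso hX e h₀
  · exact fun h => ⟨0, le_rfl, M, h, ⟨Iso.refl M⟩⟩

omit hX in
theorem resClass_of_mem (k : ℕ) {M : C} (h : X M) : T.resClass X k M :=
  ⟨0, Nat.zero_le _, M, h, ⟨Iso.refl M⟩⟩

theorem resClass_succ_iff {k : ℕ} {M : C} : T.resClass X (k + 1) M ↔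
    ∃ (A X₀ : C) (f : A ⟶ X₀) (g : X₀ ⟶ M), T.resClass X k A ∧ X X₀ ∧ T.IsConflation f g := by
  constructor
  · rintro ⟨l, hl, h⟩
    cases l with
    | zero =>
      obtain ⟨X₀, h₀, ⟨e⟩⟩ := h
      exact ⟨zeroObj C, M, 0, 𝟙 M, resClass_of_mem k (free_isZero hX isZero_zeroObj),
        free_of_iso hX e h₀, isConflation_id_right isZero_zeroObj⟩
    | succ l =>
      obtain ⟨A, X₀, f, g, hA, h₀, h⟩ := h
      exact ⟨A, X₀, f, g, ⟨l, by omega, hA⟩, h₀, h⟩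
  · rintro ⟨A, X₀, f, g, ⟨l, hl, hA⟩, h₀, h⟩
    exact ⟨l + 1, by omega, A, X₀, f, g, hA, h₀, h⟩

theorem resClass_of_iso {k : ℕ} {M N : C} (e : M ≅ N) (hM : T.resClass X k M) :
    T.resClass X k N := by
  cases k with
  | zero => exact (resClass_zero_iff hX).2 (free_of_iso hX e ((resClass_zero_iff hX).1 hM))
  | succ k =>
    obtain ⟨A, X₀, f, g, hA, h₀, h⟩ := (resClass_succ_iff hX).1 hM
    exact (resClass_succ_iff hX).2 ⟨A, X₀, f, g ≫ e.hom, hA, h₀,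
      h.of_iso (Iso.refl A) (Iso.refl X₀) e (by simp) (by simp)⟩

theorem resClass_binarySum {k : ℕ} {M M' N : C} (hN : IsBinarySum M M' N)
    (hM : T.resClass X k M) (hM' : T.resClass X k M') : T.resClass X k N := by
  induction k generalizing M M' N with
  | zero =>
    rw [resClass_zero_iff hX] at *
    exact free_binarySum hX hN hM hM'
  | succ k ih =>
    obtain ⟨A, X₀, f, g, hA, h₀, h⟩ := (resClass_succ_iff hX).1 hM
    obtain ⟨A', X₀', f', g', hA', h₀', h'⟩ := (resClass_succ_iff hX).1 hM'
    obtain ⟨e⟩ := hN.nonempty_iso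
    exact resClass_of_iso hX e ((resClass_succ_iff hX).2 ⟨_, _, _, _,
      ih (isBinarySum_biprod A A') hA hA', free_binarySum hX (isBinarySum_biprod _ _) h₀ h₀',
      h.sum h'⟩)

/-- `Eⁱ⁺¹(X, X_k^∧) = 0` for `i + k ≤ n`, by dimension shifting along a resolution. -/
theorem ext_eq_zero_of_mem {n : ℕ} (hrigid : T.IsRigid n X) (k i : ℕ) (hik : i + k ≤ n) {W M : C}
    (hW : X W) (hM : T.resClass X k M) (t : (higherExt T.E W i).obj M) : t = 0 := by
  induction k generalizing i M with
  | zero => exact hrigid i hik W M hW ((resClass_zero_iff hX).1 hM) t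
  | succ k ih =>
    obtain ⟨A, X₀, f, g, hA, h₀, h⟩ := (resClass_succ_iff hX).1 hM
    exact higherExt_eq_zero h W i (hrigid i (by omega) W X₀ hW h₀)
      (fun t => ih (i + 1) (by omega) hA t) t

/-- `E(X, X_n^∧) = 0` for an `(n+2)`-rigid class `X`. -/
theorem ext_eq_zero {n : ℕ} (hrigid : T.IsRigid n X) {W M : C} (hW : X W)
    (hM : T.resClass X n M) (δ : T.Ext W M) : δ = 0 :=
  ext_eq_zero_of_mem hX hrigid n 0 (by omega) hW hM δ

/-- If `X` is closed under direct summands, then so is `X_k^∧` for `k ≤ n + 1`. Let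
`A ⟶ X₀ ⟶ M ⊞ M'` be a resolution, and `B` the kernel of the composite deflation `X₀ ⟶ M`, so that
`A ⟶ B ⟶ M'` is a conflation. As `E(X₀, A) = 0`, the map `X₀ ⟶ M'` lifts to `B`, which makes `B` a
direct summand of `A ⊞ X₀`. -/
theorem resClass_of_isBinarySum {n : ℕ} (hrigid : T.IsRigid n X) (hsmd : smd X = X) {k : ℕ}
    (hk : k ≤ n + 1) {M M' N : C} (hN : IsBinarySum M M' N) (h : T.resClass X k N) :
    T.resClass X k M := by
  induction k generalizing M M' N with
  | zero =>
    rw [resClass_zero_iff hX] at *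
    rw [← hsmd]
    exact ⟨M', N, h, hN⟩
  | succ k ih =>
    obtain ⟨A, X₀, f, g, hA, h₀, hfg⟩ := (resClass_succ_iff hX).1 h
    obtain ⟨i, p, i', p', h₁, h₂, h₃, h₄, h₅⟩ := isBinarySum_iff.1 hN
    obtain ⟨B, d, e, k', hk', hde, hke, hdk⟩ := hfg.comp_deflation
      (isConflation_of_split (x := i') (y := p) p' i h₂ h₁ h₄ (by rw [add_comm, h₅]))
    have hA0 : ∀ δ : T.Ext X₀ A, δ = 0 := by
      obtain ⟨l, hl, hA⟩ := hA
      exact ext_eq_zero hX hrigid h₀ ⟨l, by omega, hA⟩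
    obtain ⟨η, hη⟩ := hde
    obtain ⟨l, hl⟩ := hη.lifts_deflation (g ≫ p') (hA0 _)
    obtain ⟨a, ha⟩ := hη.exists_lift (𝟙 B - k' ≫ l) (by
      rw [Preadditive.sub_comp, Category.assoc, hl, ← Category.assoc, hke, Category.assoc, h₂]
      simp)
    obtain ⟨Z, q, hq⟩ := IsInflation.lift (T := T) (j := k') ⟨M, _, hk'⟩ a
    obtain ⟨v, hv₁, hv₂, hv⟩ := hq.isBinarySum (biprod.desc d l) (by simp [ha])
    have hB : IsBinarySum B Z (A ⊞ X₀) := isBinarySum_iff.2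
      ⟨_, _, v, q, by simp [ha], hv₁, hq.comp_eq_zero, hv₂, hv⟩
    refine (resClass_succ_iff hX).2 ⟨B, X₀, k', g ≫ p, ih (by omega) hB ?_, h₀, hk'⟩
    exact resClass_binarySum hX (isBinarySum_biprod _ _) hA (resClass_of_mem k h₀)

end ResClass

end Extriangulation

/-! ### Extension closed subcategories of abelian categories -/

section Exact

variable {A : Type*} [Category A] {D : Type*} [Category D] [Abelian D]

/-- The essential image of `F` contains a zero object and is closed under extensions. -/
structure ExtensionClosed (F : A ⥤ D) : Prop where
  exists_zero : ∃ Z : A, IsZero Z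
  extension : ∀ S : ShortComplex D, S.ShortExact → F.essImage S.X₁ → F.essImage S.X₃ →
    F.essImage S.X₂

variable {F : A ⥤ D}

theorem ExtensionClosed.op (h : ExtensionClosed F) : ExtensionClosed F.op where
  exists_zero := by
    obtain ⟨Z, hZ⟩ := h.exists_zero
    exact ⟨_, hZ.op⟩
  extension S hS := by
    rintro ⟨X₁, ⟨e₁⟩⟩ ⟨X₃, ⟨e₃⟩⟩
    obtain ⟨X₂, ⟨e₂⟩⟩ := h.extension S.unop hS.unop ⟨X₃.unop, ⟨e₃.unop.symm⟩⟩
      ⟨X₁.unop, ⟨e₁.unop.symm⟩⟩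
    exact ⟨Opposite.op X₂, ⟨e₂.symm.op⟩⟩

theorem inducedPairs_op_iff {X Y Z : A} (i : X ⟶ Y) (p : Y ⟶ Z) :
    inducedPairs F.op p.op i.op ↔ inducedPairs F i p := by
  constructor
  · rintro ⟨w, h⟩
    exact ⟨Quiver.Hom.op_inj w, h.unop⟩
  · rintro ⟨w, h⟩
    exact ⟨Quiver.Hom.unop_inj w, h.op⟩

theorem admMono_op_iff {Y Z : A} (p : Y ⟶ Z) :
    (inducedPairs F.op).AdmMono p.op ↔ (inducedPairs F).AdmEpi p := by
  constructor
  · rintro ⟨X, i, h⟩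
    exact ⟨X.unop, i.unop, (inducedPairs_op_iff _ _).1 h⟩
  · rintro ⟨X, i, h⟩
    exact ⟨op X, i.op, (inducedPairs_op_iff _ _).2 h⟩

theorem inducedPairs.of_iso {X Y Z X' Y' Z' : A} {i : X ⟶ Y} {p : Y ⟶ Z} {i' : X' ⟶ Y'}
    {p' : Y' ⟶ Z'} (a : X ≅ X') (b : Y ≅ Y') (c : Z ≅ Z') (h₁ : i ≫ b.hom = a.hom ≫ i')
    (h₂ : p ≫ c.hom = b.hom ≫ p') (h : inducedPairs F i p) : inducedPairs F i' p' := by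
  obtain ⟨w, h⟩ := h
  have k₁ : F.map i ≫ (F.mapIso b).hom = (F.mapIso a).hom ≫ F.map i' := by
    simpa using congrArg F.map h₁
  have k₂ : F.map p ≫ (F.mapIso c).hom = (F.mapIso b).hom ≫ F.map p' := by
    simpa using congrArg F.map h₂
  have w' : F.map i' ≫ F.map p' = 0 := by
    rw [← cancel_epi (F.mapIso a).hom, ← Category.assoc, ← k₁, Category.assoc, ← k₂,
      reassoc_of% w, zero_comp, comp_zero]
  exact ⟨w', ShortComplex.shortExact_of_iso
    (ShortComplex.isoMk (F.mapIso a) (F.mapIso b) (F.mapIso c) k₁.symm k₂.symm) h⟩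

variable [F.Full]

/-- Admissible monomorphisms are the maps that become monomorphisms with cokernel in the image. -/
theorem admMono_iff {X Y : A} (i : X ⟶ Y) :
    (inducedPairs F).AdmMono i ↔ Mono (F.map i) ∧ F.essImage (cokernel (F.map i)) := by
  constructor
  · rintro ⟨Z, p, w, h⟩
    exact ⟨h.mono_f, Z, ⟨(colimit.isoColimitCocone ⟨_, h.gIsCokernel⟩).symm⟩⟩
  · rintro ⟨hi, Z, ⟨e⟩⟩
    refine ⟨Z, F.preimage (cokernel.π (F.map i) ≫ e.inv), by simp, ?_⟩
    let S := ShortComplex.mk (F.map i) (cokernel.π (F.map i)) (by simp)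
    have hS : S.ShortExact :=
      { exact := ShortComplex.exact_of_g_is_cokernel _ (cokernelIsCokernel _)
        mono_f := hi
        epi_g := inferInstanceAs (Epi (cokernel.π (F.map i))) }
    exact ShortComplex.shortExact_of_iso
      (ShortComplex.isoMk (S₁ := S) (Iso.refl _) (Iso.refl _) e.symm (by simp [S]) (by simp [S])) hS

namespace ExtensionClosed

/-- The cokernel of a composite of monomorphisms is an extension of the two cokernels. -/
theorem admMono_comp (hF : ExtensionClosed F) {X Y Z : A} (i : X ⟶ Y) (j : Y ⟶ Z)
    (hi : (inducedPairs F).AdmMono i) (hj : (inducedPairs F).AdmMono j) :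
    (inducedPairs F).AdmMono (i ≫ j) := by
  rw [admMono_iff] at *
  obtain ⟨hi, hi'⟩ := hi
  obtain ⟨hj, hj'⟩ := hj
  rw [F.map_comp]
  refine ⟨inferInstance, ?_⟩
  let S := ShortComplex.mk (cokernel.map (F.map i) (F.map i ≫ F.map j) (𝟙 _) (F.map j) (by simp))
    (cokernel.map (F.map i ≫ F.map j) (F.map j) (F.map i) (𝟙 _) (by simp))
    (by ext; simp)
  have hm : Mono S.f := by
    refine Preadditive.mono_of_cancel_zero _ fun {W} t ht => ?_
    obtain ⟨W', π, hπ, y, hy⟩ := surjective_up_to_refinements_of_epi (cokernel.π (F.map i)) t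
    let R := ShortComplex.mk (F.map i ≫ F.map j) (cokernel.π (F.map i ≫ F.map j)) (by simp)
    have hR : R.Exact := ShortComplex.exact_of_g_is_cokernel _ (cokernelIsCokernel _)
    have hRf : Mono R.f := inferInstanceAs (Mono (F.map i ≫ F.map j))
    have hyj : (y ≫ F.map j) ≫ R.g = 0 := by
      have h : (y ≫ cokernel.π (F.map i)) ≫ S.f = 0 := by rw [← hy, Category.assoc, ht, comp_zero]
      simpa [S] using h
    have hx : hR.lift (y ≫ F.map j) hyj ≫ F.map i = y := by
      rw [← cancel_mono (F.map j), Category.assoc]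
      exact hR.lift_f _ _
    rw [← cancel_epi π, hy, ← hx, Category.assoc, cokernel.condition, comp_zero, comp_zero]
  have he : Epi S.g := by
    have : Epi (cokernel.π (F.map i ≫ F.map j) ≫ S.g) := by
      simp only [S, cokernel.π_desc]
      infer_instance
    exact epi_of_epi (cokernel.π (F.map i ≫ F.map j)) _
  have hS : S.ShortExact :=
    { exact := ShortComplex.exact_of_g_is_cokernel _ (CokernelCofork.IsColimit.ofπ _ _
        (fun {W} k hk => cokernel.desc _ (cokernel.π (F.map i ≫ F.map j) ≫ k) (by
          have h : cokernel.π (F.map i) ≫ S.f ≫ k = 0 := by rw [hk, comp_zero]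
          simpa [S] using h))
        (fun {W} k hk => by
          rw [← cancel_epi (cokernel.π (F.map i ≫ F.map j))]
          simp [S])
        (fun {W} k hk m hm => by
          rw [← cancel_epi S.g, hm, ← cancel_epi (cokernel.π (F.map i ≫ F.map j))]
          simp [S]))
      mono_f := hm
      epi_g := he }
  exact hF.extension S hS hi' hj'

variable [F.Faithful]

/-- The pushout of an admissible monomorphism has the same cokernel, so it is an extension of
objects of the subcategory. -/
theorem exists_pushout (hF : ExtensionClosed F) {X Y X' : A} (i : X ⟶ Y) (f : X ⟶ X')
    (hi : (inducedPairs F).AdmMono i) :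
    ∃ (Y' : A) (g : Y ⟶ Y') (i' : X' ⟶ Y'), IsPushout i f g i' ∧
      (inducedPairs F).AdmMono i' := by
  obtain ⟨Z, p, w, h⟩ := hi
  have hm : Mono (F.map i) := h.mono_f
  have hP := IsPushout.of_hasPushout (F.map i) (F.map f)
  let q : Limits.pushout (F.map i) (F.map f) ⟶ F.obj Z := pushout.desc (F.map p) 0 (by simp [w])
  let S := ShortComplex.mk (pushout.inr (F.map i) (F.map f)) q
    (pushout.inr_desc _ _ _)
  have hq : pushout.inl (F.map i) (F.map f) ≫ q = F.map p :=
    pushout.inl_desc _ _ _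
  have hS : S.ShortExact :=
    { exact := ShortComplex.exact_of_g_is_cokernel _
        (CokernelCofork.IsColimit.ofπ _ _
          (fun {W} k hk => h.gIsCokernel.desc (CokernelCofork.ofπ
            (f := F.map i) (pushout.inl (F.map i) (F.map f) ≫ k)
            (by rw [pushout.condition_assoc]; exact (congrArg _ hk).trans comp_zero)))
          (fun {W} k hk => by
            apply pushout.hom_ext
            · rw [← Category.assoc]
              erw [hq]
              exact h.gIsCokernel.fac _ WalkingParallelPair.one
            · exact (Category.assoc _ _ _).symm.trans
                ((congrArg (· ≫ _) S.zero).trans (zero_comp.trans hk.symm)))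
          (fun {W} k hk m hm => by
            have he : Epi (F.map p) := h.epi_g
            rw [← cancel_epi (F.map p)]
            refine Eq.trans ?_ (h.gIsCokernel.fac (CokernelCofork.ofπ _ _)
              WalkingParallelPair.one).symm
            change _ = pushout.inl (F.map i) (F.map f) ≫ k
            rw [← hm, ← hq, Category.assoc]))
      mono_f := inferInstanceAs (Mono (pushout.inr (F.map i) (F.map f)))
      epi_g := by
        have : Epi (pushout.inl (F.map i) (F.map f) ≫ q) := by
          rw [hq]
          exact h.epi_g
        exact epi_of_epi (pushout.inl (F.map i) (F.map f)) q }
  obtain ⟨Y', ⟨e⟩⟩ := hF.extension S hS (F.obj_mem_essImage X') (F.obj_mem_essImage Z)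
  let e' : F.obj Y' ≅ Limits.pushout (F.map i) (F.map f) := e
  refine ⟨Y', F.preimage (pushout.inl _ _ ≫ e'.inv), F.preimage (pushout.inr _ _ ≫ e'.inv), ?_,
    Z, F.preimage (e'.hom ≫ q), ?_⟩
  · refine IsPushout.of_map F (F.map_injective ?_) ?_
    · simp [pushout.condition_assoc]
    · refine hP.of_iso (Iso.refl _) (Iso.refl _) (Iso.refl _) e'.symm (by simp) (by simp)
        (by simp) (by simp)
  · have w' : pushout.inr (F.map i) (F.map f) ≫ q = 0 := S.zero
    refine ⟨by simp [w'], ShortComplex.shortExact_of_iso (ShortComplex.isoMk (S₁ := S)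
      (Iso.refl _) e'.symm (Iso.refl _) (by simp [S]) (by simp [S])) hS⟩

end ExtensionClosed

variable [Preadditive A] [F.Faithful]

theorem inducedPairs.isLimit {X Y Z : A} {i : X ⟶ Y} {p : Y ⟶ Z} (h : inducedPairs F i p)
    (w : i ≫ p = 0) [F.Additive] : Nonempty (IsLimit (KernelFork.ofι i w)) := by
  obtain ⟨w', h⟩ := h
  have hm : Mono (F.map i) := h.mono_f
  have hl := h.fIsKernel
  refine ⟨KernelFork.IsLimit.ofι i w (fun {W} k hk => F.preimage (hl.lift (KernelFork.ofι
    (f := F.map p) (F.map k) (by rw [← F.map_comp, hk, F.map_zero])))) (fun {W} k hk => ?_)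
    (fun {W} k hk m hm => ?_)⟩
  · apply F.map_injective
    rw [F.map_comp, F.map_preimage]
    exact hl.fac _ WalkingParallelPair.zero
  · apply F.map_injective
    rw [F.map_preimage, ← cancel_mono (F.map i)]
    refine Eq.trans ?_ (hl.fac (KernelFork.ofι _ _) WalkingParallelPair.zero).symm
    rw [← F.map_comp, hm]
    rfl

theorem inducedPairs.isColimit {X Y Z : A} {i : X ⟶ Y} {p : Y ⟶ Z} (h : inducedPairs F i p)
    (w : i ≫ p = 0) [F.Additive] : Nonempty (IsColimit (CokernelCofork.ofπ p w)) := by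
  obtain ⟨w', h⟩ := h
  have hm : Epi (F.map p) := h.epi_g
  have hl := h.gIsCokernel
  refine ⟨CokernelCofork.IsColimit.ofπ p w (fun {W} k hk => F.preimage (hl.desc (CokernelCofork.ofπ
    (f := F.map i) (F.map k) (by rw [← F.map_comp, hk, F.map_zero])))) (fun {W} k hk => ?_)
    (fun {W} k hk m hm => ?_)⟩
  · apply F.map_injective
    rw [F.map_comp, F.map_preimage]
    exact hl.fac _ WalkingParallelPair.one
  · apply F.map_injective
    rw [F.map_preimage, ← cancel_epi (F.map p)]
    refine Eq.trans ?_ (hl.fac (CokernelCofork.ofπ _ _) WalkingParallelPair.one).symm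
    rw [← F.map_comp, hm]
    rfl

namespace ExtensionClosed

variable [F.Additive]

omit [F.Faithful] in
theorem id_mono (hF : ExtensionClosed F) (X : A) : (inducedPairs F).AdmMono (𝟙 X) := by
  obtain ⟨Z, hZ⟩ := hF.exists_zero
  rw [admMono_iff, F.map_id]
  refine ⟨inferInstance, Z, ⟨(F.map_isZero hZ).iso ?_⟩⟩
  exact isZero_cokernel_of_epi _

theorem hasFiniteBiproducts (hF : ExtensionClosed F) : HasFiniteBiproducts A := by
  refine hasFiniteBiproducts_of_isBinarySum hF.exists_zero fun Y Y' => ?_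
  let S := ShortComplex.mk (biprod.inl : F.obj Y ⟶ F.obj Y ⊞ F.obj Y') biprod.snd (by simp)
  have hS : S.ShortExact := (ShortComplex.Splitting.mk (S := S) biprod.fst biprod.inr
    (by simp [S]) (by simp [S]) (by simp [S])).shortExact
  obtain ⟨Z, ⟨e⟩⟩ := hF.extension S hS (F.obj_mem_essImage Y) (F.obj_mem_essImage Y')
  let e' : F.obj Z ≅ F.obj Y ⊞ F.obj Y' := e
  refine ⟨Z, isBinarySum_iff.2 ⟨F.preimage (biprod.inl ≫ e'.inv), F.preimage (e'.hom ≫ biprod.fst),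
    F.preimage (biprod.inr ≫ e'.inv), F.preimage (e'.hom ≫ biprod.snd), ?_, ?_, ?_, ?_, ?_⟩⟩ <;>
  apply F.map_injective
  · simp
  · simp
  · simp
  · simp
  · rw [F.map_add]
    simp only [Functor.map_comp, Functor.map_preimage, Category.assoc]
    rw [← Preadditive.comp_add, ← Category.assoc, ← Category.assoc, ← Preadditive.add_comp,
      biprod.total]
    simp

/-- An extension closed full subcategory of an abelian category is exact. -/
theorem isExactCategory (hF : ExtensionClosed F) : IsExactCategory (inducedPairs F) where
  additive := hF.hasFiniteBiproducts
  kernel_cokernel _ _ _ i p h := by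
    have w : i ≫ p = 0 := F.map_injective (by
      rw [F.map_comp, F.map_zero]
      exact h.choose)
    exact ⟨w, h.isLimit w, h.isColimit w⟩
  iso_closed _ _ _ _ _ _ _ _ _ _ a b c h₁ h₂ h := h.of_iso a b c h₁ h₂
  id_mono := hF.id_mono
  id_epi X := (admMono_op_iff (F := F) (𝟙 X)).1 (hF.op.id_mono (Opposite.op X))
  comp_mono _ _ _ i j := hF.admMono_comp i j
  comp_epi _ _ _ p q hp hq := (admMono_op_iff (F := F) _).1
    (hF.op.admMono_comp q.op p.op ((admMono_op_iff _).2 hq) ((admMono_op_iff _).2 hp))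
  pushout _ _ _ i f := hF.exists_pushout i f
  pullback _ _ _ p f hp := by
    obtain ⟨Y', g, p', h, hp'⟩ := hF.op.exists_pushout p.op f.op ((admMono_op_iff _).2 hp)
    exact ⟨Y'.unop, g.unop, p'.unop, h.unop.flip, (admMono_op_iff _).1 hp'⟩

end ExtensionClosed

/-- The exact structure on `A` that is induced by a contravariant fully faithful functor with
extension closed essential image. -/
theorem isExactCategory_inducedPairsOp {F : Aᵒᵖ ⥤ D} [F.Full] [F.Faithful] [F.Additive]
    (hF : ExtensionClosed F) : IsExactCategory (inducedPairsOp F) := by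
  have h : IsExactCategory (inducedPairs F.rightOp) := by
    refine ExtensionClosed.isExactCategory ⟨?_, ?_⟩
    · obtain ⟨Z, hZ⟩ := hF.exists_zero
      exact ⟨_, hZ.unop⟩
    · rintro S hS ⟨X₁, ⟨e₁⟩⟩ ⟨X₃, ⟨e₃⟩⟩
      obtain ⟨X₂, ⟨e₂⟩⟩ := hF.extension S.unop hS.unop ⟨op X₃, ⟨e₃.unop.symm⟩⟩
        ⟨op X₁, ⟨e₁.unop.symm⟩⟩
      exact ⟨X₂.unop, ⟨e₂.symm.op⟩⟩
  have h' : inducedPairs F.rightOp = inducedPairsOp F := by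
    funext X Y Z i p
    refine propext ⟨?_, ?_⟩
    · rintro ⟨w, h⟩
      exact ⟨Quiver.Hom.op_inj w, h.unop⟩
    · rintro ⟨w, h⟩
      exact ⟨Quiver.Hom.unop_inj w, h.op⟩
  rwa [h'] at h

end Exact

/-! ### Modules given by a generator and relations -/

section Pointwise

variable {J : Type*} [Category J] {S : ShortComplex (J ⥤ AddCommGrpCat.{u})}

theorem exact_iff_app : S.Exact ↔
    ∀ (j : J) (x : S.X₂.obj j), S.g.app j x = 0 → ∃ y, S.f.app j y = x := by
  have h : S.Exact ↔ ∀ j, (S.map ((evaluation J AddCommGrpCat.{u}).obj j)).Exact := by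
    constructor
    · exact fun h j => h.map _
    · intro h
      rw [ShortComplex.exact_iff_isZero_homology]
      refine Functor.isZero _ fun j => ?_
      exact ((ShortComplex.exact_iff_isZero_homology _).1 (h j)).of_iso
        (S.mapHomologyIso ((evaluation J AddCommGrpCat.{u}).obj j)).symm
  rw [h]
  exact forall_congr' fun j => ShortComplex.ab_exact_iff _

theorem mono_iff_app {G G' : J ⥤ AddCommGrpCat.{u}} (φ : G ⟶ G') :
    Mono φ ↔ ∀ j, Function.Injective (φ.app j) := by
  rw [NatTrans.mono_iff_mono_app]
  exact forall_congr' fun j => AddCommGrpCat.mono_iff_injective _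

theorem epi_iff_app {G G' : J ⥤ AddCommGrpCat.{u}} (φ : G ⟶ G') :
    Epi φ ↔ ∀ j, Function.Surjective (φ.app j) := by
  rw [NatTrans.epi_iff_epi_app]
  exact forall_congr' fun j => AddCommGrpCat.epi_iff_surjective _

end Pointwise

section Modules

variable {Z : Type u} [SmallCategory Z] [Preadditive Z]

omit [Preadditive Z] in
theorem map_comp_elt (G : Z ⥤ AddCommGrpCat.{u}) {Y Y' Y'' : Z} (k : Y ⟶ Y') (l : Y' ⟶ Y'')
    (x : G.obj Y) : G.map (k ≫ l) x = G.map l (G.map k x) := by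
  rw [G.map_comp]
  rfl

theorem map_add_elt (G : Z ⥤ AddCommGrpCat.{u}) [G.Additive] {Y Y' : Z} (k l : Y ⟶ Y')
    (x : G.obj Y) : G.map (k + l) x = G.map k x + G.map l x := by
  rw [G.map_add]
  rfl

theorem map_sub_elt (G : Z ⥤ AddCommGrpCat.{u}) [G.Additive] {Y Y' : Z} (k l : Y ⟶ Y')
    (x : G.obj Y) : G.map (k - l) x = G.map k x - G.map l x := by
  rw [G.map_sub]
  rfl

theorem map_zero_elt (G : Z ⥤ AddCommGrpCat.{u}) [G.Additive] {Y Y' : Z} (x : G.obj Y) :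
    G.map (0 : Y ⟶ Y') x = 0 := by
  rw [G.map_zero]
  rfl

/-- The module `G` is generated by `e ∈ G(V)`. -/
def IsGenerator (G : Z ⥤ AddCommGrpCat.{u}) {V : Z} (e : G.obj V) : Prop :=
  ∀ (Y : Z) (x : G.obj Y), ∃ h : V ⟶ Y, G.map h e = x

/-- The module `G` is generated by `e ∈ G(V)` subject to the relation `f · e = 0`. -/
structure IsPresentation (G : Z ⥤ AddCommGrpCat.{u}) {V W : Z} (f : V ⟶ W) (e : G.obj V) :
    Prop where
  generator : IsGenerator G e
  relation : G.map f e = 0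
  exists_factor : ∀ ⦃Y : Z⦄ (h : V ⟶ Y), G.map h e = 0 → ∃ k : W ⟶ Y, f ≫ k = h

/-- The map from a representable module to an additive functor given by an element. -/
def repDesc (G : Z ⥤ AddCommGrpCat.{u}) [G.Additive] {V : Z} (e : G.obj V) : rep V ⟶ G where
  app Y := AddCommGrpCat.ofHom
    { toFun := fun h : V ⟶ Y => G.map h e
      map_zero' := map_zero_elt G e
      map_add' := fun h h' => map_add_elt G h h' e }
  naturality Y Y' k := by
    ext h
    exact map_comp_elt G h k e

/-- The Yoneda lemma for additive representable functors. -/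
theorem rep_hom_app {V : Z} {G : Z ⥤ AddCommGrpCat.{u}} (φ : rep V ⟶ G) {Y : Z} (h : V ⟶ Y) :
    φ.app Y h = G.map h (φ.app V (𝟙 V)) := by
  have := NatTrans.naturality_apply φ h (𝟙 V)
  rw [← this]
  change _ = φ.app Y (𝟙 V ≫ h)
  rw [Category.id_comp]

omit [Preadditive Z] in
theorem IsPresentation.comp_iso {G : Z ⥤ AddCommGrpCat.{u}} {V W W' : Z} {f : V ⟶ W}
    {e : G.obj V} (h : IsPresentation G f e) (i : W ≅ W') : IsPresentation G (f ≫ i.hom) e where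
  generator := h.generator
  relation := by rw [map_comp_elt, h.relation, map_zero]
  exists_factor Y k hk := by
    obtain ⟨l, hl⟩ := h.exists_factor k hk
    exact ⟨i.inv ≫ l, by simpa using hl⟩

theorem presentedBy_iff {P : ObjectProperty Z} {G : Z ⥤ AddCommGrpCat.{u}} :
    presentedBy P G ↔ G.Additive ∧ ∃ (W V : Z) (_ : P W) (f : V ⟶ W) (e : G.obj V),
      IsPresentation G f e := by
  constructor
  · rintro ⟨hG, W, V, hW, α, π, w, hex, hepi⟩
    rw [exact_iff_app] at hex
    rw [epi_iff_app] at hepi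
    let f : V ⟶ W := α.app W (𝟙 W)
    have hf : ∀ {Y : Z} (k : W ⟶ Y), α.app Y k = f ≫ k := fun k => rep_hom_app α k
    have he : ∀ {Y : Z} (h : V ⟶ Y), π.app Y h = G.map h (π.app V (𝟙 V)) :=
      fun h => rep_hom_app π h
    refine ⟨hG, W, V, hW, f, π.app V (𝟙 V), ?_, ?_, ?_⟩
    · intro Y x
      obtain ⟨h, rfl⟩ := hepi Y x
      exact ⟨h, (he h).symm⟩
    · refine (he f).symm.trans ?_
      exact ConcreteCategory.congr_hom (congrArg (fun φ => NatTrans.app φ W) w) (𝟙 W)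
    · intro Y h hh
      rw [← he] at hh
      obtain ⟨k, hk⟩ := hex Y h hh
      exact ⟨k, (hf k).symm.trans hk⟩
  · rintro ⟨hG, W, V, hW, f, e, h⟩
    refine ⟨hG, W, V, hW, preadditiveCoyoneda.map f.op, repDesc G e, ?_, ?_, ?_⟩
    · ext Y k
      exact (map_comp_elt G f k e).trans (by rw [h.relation, map_zero]; rfl)
    · rw [exact_iff_app]
      intro Y x hx
      obtain ⟨k, hk⟩ := h.exists_factor x hx
      exact ⟨k, hk⟩
    · rw [epi_iff_app]
      exact h.generator

/-- A generator may be sent to any element that satisfies the same relations. -/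
theorem IsGenerator.exists_hom {G G' : Z ⥤ AddCommGrpCat.{u}} [G.Additive] [G'.Additive] {V : Z}
    {e : G.obj V} (he : IsGenerator G e) (e' : G'.obj V)
    (h : ∀ (Y : Z) (k : V ⟶ Y), G.map k e = 0 → G'.map k e' = 0) :
    ∃ φ : G ⟶ G', ∀ (Y : Z) (k : V ⟶ Y), φ.app Y (G.map k e) = G'.map k e' := by
  choose c hc using he
  have hwd : ∀ {Y : Z} (k k' : V ⟶ Y), G.map k e = G.map k' e → G'.map k e' = G'.map k' e' := by
    intro Y k k' hk
    have := h Y (k - k') (by rw [G.map_sub]; exact sub_eq_zero.2 hk)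
    rw [G'.map_sub] at this
    exact sub_eq_zero.1 this
  let φ : G ⟶ G' :=
    { app := fun Y => AddCommGrpCat.ofHom
        (AddMonoidHom.mk' (fun x => G'.map (c Y x) e') fun x y => by
          have : G'.map (c Y (x + y)) e' = G'.map (c Y x + c Y y) e' := hwd _ _ (by
            rw [hc, G.map_add]
            exact (congrArg₂ (· + ·) (hc Y x) (hc Y y)).symm)
          rw [this, G'.map_add]
          rfl)
      naturality := fun Y Y' k => by
        ext x
        change G'.map (c Y' (G.map k x)) e' = G'.map k (G'.map (c Y x) e')
        rw [← ConcreteCategory.comp_apply, ← G'.map_comp]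
        refine hwd _ _ ?_
        rw [hc, G.map_comp, ConcreteCategory.comp_apply, hc] }
  exact ⟨φ, fun Y k => hwd _ _ (hc _ _)⟩

theorem IsGenerator.nonempty_iso {G G' : Z ⥤ AddCommGrpCat.{u}} [G.Additive] [G'.Additive] {V : Z}
    {e : G.obj V} (he : IsGenerator G e) {e' : G'.obj V} (he' : IsGenerator G' e')
    (h : ∀ (Y : Z) (k : V ⟶ Y), G.map k e = 0 ↔ G'.map k e' = 0) : Nonempty (G ≅ G') := by
  obtain ⟨φ, hφ⟩ := he.exists_hom e' fun Y k => (h Y k).1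
  obtain ⟨ψ, hψ⟩ := he'.exists_hom e fun Y k => (h Y k).2
  refine ⟨⟨φ, ψ, ?_, ?_⟩⟩
  · ext Y x
    obtain ⟨k, rfl⟩ := he Y x
    change ψ.app Y (φ.app Y _) = _
    rw [hφ, hψ]
    rfl
  · ext Y x
    obtain ⟨k, rfl⟩ := he' Y x
    change φ.app Y (ψ.app Y _) = _
    rw [hψ, hφ]
    rfl

theorem additive_of_iso {G G' : Z ⥤ AddCommGrpCat.{u}} (e : G ≅ G') (hG : G.Additive) :
    G'.Additive where
  map_add {Y Y' f g} := by
    rw [← cancel_epi (e.hom.app Y), Preadditive.comp_add, ← e.hom.naturality, ← e.hom.naturality,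
      ← e.hom.naturality, ← Preadditive.add_comp, G.map_add]

theorem presentedBy_of_iso {P : ObjectProperty Z} {G G' : Z ⥤ AddCommGrpCat.{u}} (e : G ≅ G')
    (h : presentedBy P G) : presentedBy P G' := by
  obtain ⟨hG, X₀, X₁, h₀, α, π, w, hex, hepi⟩ := h
  refine ⟨additive_of_iso e hG, X₀, X₁, h₀, α, π ≫ e.hom, by rw [reassoc_of% w, zero_comp], ?_,
    inferInstance⟩
  exact ShortComplex.exact_of_iso (ShortComplex.isoMk (S₁ := ShortComplex.mk α π w)
    (Iso.refl _) (Iso.refl _) e (by simp) (by simp)) hex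

theorem presentedBy_isZero {P : ObjectProperty Z} {W : Z} (hW : P W)
    {G : Z ⥤ AddCommGrpCat.{u}} (hG : IsZero G) : presentedBy P G := by
  have h₀ : ∀ (Y : Z) (x : G.obj Y), x = 0 := fun Y x =>
    ConcreteCategory.congr_hom (congrArg (fun φ => NatTrans.app φ Y) (hG.eq_of_src (𝟙 G) 0)) x
  refine presentedBy_iff.2 ⟨⟨fun {Y Y' f g} => ?_⟩, W, W, hW, 𝟙 W, 0, ?_, map_zero _, ?_⟩
  · ext x
    exact (h₀ Y' _).trans (h₀ Y' _).symm
  · exact fun Y x => ⟨0, (h₀ Y _).trans (h₀ Y _).symm⟩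
  · exact fun Y k _ => ⟨k, Category.id_comp k⟩

section Extension

variable {S : ShortComplex (Z ⥤ AddCommGrpCat.{u})}

/-- An extension `G` of additive functors is additive. For the two idempotents `e₁` and `e₂` of
`Y ⊞ Y`, the operator `1 - e₁ - e₂` on `G(Y ⊞ Y)` is zero on the subfunctor and on the quotient, so
its square is zero; but it is idempotent as `G(0) = 0`, and hence zero. -/
theorem additive_of_shortExact [HasFiniteBiproducts Z] (hS : S.ShortExact) (h₁ : S.X₁.Additive)
    (h₃ : S.X₃.Additive) : S.X₂.Additive := by
  have hex := exact_iff_app.1 hS.exact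
  set G := S.X₂ with hG
  have nat : ∀ {Y Y' : Z} (k : Y ⟶ Y') (x : S.X₁.obj Y),
      G.map k (S.f.app Y x) = S.f.app Y' (S.X₁.map k x) := fun k x =>
    (NatTrans.naturality_apply S.f k x).symm
  have nat' : ∀ {Y Y' : Z} (k : Y ⟶ Y') (x : G.obj Y),
      S.X₃.map k (S.g.app Y x) = S.g.app Y' (G.map k x) := fun k x =>
    (NatTrans.naturality_apply S.g k x).symm
  have comp : ∀ {Y Y' Y'' : Z} (k : Y ⟶ Y') (l : Y' ⟶ Y'') (x : G.obj Y),
      G.map l (G.map k x) = G.map (k ≫ l) x := fun k l x => by rw [G.map_comp]; rfl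
  have zero : ∀ {Y Y' : Z} (x : G.obj Y), G.map (0 : Y ⟶ Y') x = 0 := by
    intro Y Y' x
    obtain ⟨t, ht⟩ := hex Y' (G.map (0 : Y ⟶ Y') x) (by
      rw [← nat', S.X₃.map_zero]; rfl)
    have h₀ : G.map (0 : Y' ⟶ Y') (G.map (0 : Y ⟶ Y') x) = G.map (0 : Y ⟶ Y') x := by
      rw [comp, zero_comp]
    rw [← h₀, ← ht, nat, S.X₁.map_zero]
    exact map_zero _
  have split : ∀ {Y : Z} (x : G.obj (Y ⊞ Y)),
      x = G.map (biprod.fst ≫ biprod.inl) x + G.map (biprod.snd ≫ biprod.inr) x := by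
    intro Y x
    rw [← sub_eq_zero]
    have h1 : ∀ t : S.X₁.obj (Y ⊞ Y), t = S.X₁.map (biprod.fst ≫ biprod.inl) t +
        S.X₁.map (biprod.snd ≫ biprod.inr) t := fun t => by
      conv_lhs => rw [show t = S.X₁.map (𝟙 (Y ⊞ Y)) t by simp]
      rw [← biprod.total, S.X₁.map_add]
      rfl
    have h3 : ∀ t : S.X₃.obj (Y ⊞ Y), t = S.X₃.map (biprod.fst ≫ biprod.inl) t +
        S.X₃.map (biprod.snd ≫ biprod.inr) t := fun t => by
      conv_lhs => rw [show t = S.X₃.map (𝟙 (Y ⊞ Y)) t by simp]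
      rw [← biprod.total, S.X₃.map_add]
      rfl
    obtain ⟨t, ht⟩ := hex (Y ⊞ Y) (x - (G.map (biprod.fst ≫ biprod.inl) x +
        G.map (biprod.snd ≫ biprod.inr) x)) (by
      rw [map_sub, map_add, ← nat', ← nat', ← h3, sub_self])
    have hd := congrArg (S.f.app (Y ⊞ Y)) (h1 t)
    rw [map_add, ← nat, ← nat, ht] at hd
    rw [hd]
    simp only [map_sub, map_add, comp, Category.assoc, biprod.inl_fst_assoc, biprod.inr_snd_assoc,
      biprod.inl_snd_assoc, biprod.inr_fst_assoc, zero_comp, comp_zero, zero]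
    abel
  refine ⟨fun {Y Y' f g} => ?_⟩
  ext x
  change G.map (f + g) x = G.map f x + G.map g x
  have h₁ : G.map (f + g) x = G.map (biprod.desc f g) (G.map (biprod.lift (𝟙 Y) (𝟙 Y)) x) := by
    rw [comp]
    simp
  rw [h₁, split (G.map (biprod.lift (𝟙 Y) (𝟙 Y)) x), map_add]
  simp [comp]

/-- The horseshoe lemma for presentations with a single generator and relation. -/
theorem presentedBy_of_shortExact [HasFiniteBiproducts Z] {P : ObjectProperty Z}
    (hP : ∀ W W', P W → P W' → ∃ V, P V ∧ Nonempty (W ⊞ W' ≅ V))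
    (hS : S.ShortExact) (h₁ : presentedBy P S.X₁) (h₃ : presentedBy P S.X₃) :
    presentedBy P S.X₂ := by
  rw [presentedBy_iff] at *
  obtain ⟨a₁, W, V, hW, f, e, h⟩ := h₁
  obtain ⟨a₃, W', V', hW', f', e', h'⟩ := h₃
  have a₂ := additive_of_shortExact hS a₁ a₃
  have hex := exact_iff_app.1 hS.exact
  have hm := hS.mono_f
  have he := hS.epi_g
  rw [mono_iff_app] at hm
  rw [epi_iff_app] at he
  set G := S.X₂ with hG
  have nat : ∀ {Y Y' : Z} (k : Y ⟶ Y') (x : S.X₁.obj Y),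
      G.map k (S.f.app Y x) = S.f.app Y' (S.X₁.map k x) := fun k x =>
    (NatTrans.naturality_apply S.f k x).symm
  have nat' : ∀ {Y Y' : Z} (k : Y ⟶ Y') (x : G.obj Y),
      S.X₃.map k (S.g.app Y x) = S.g.app Y' (G.map k x) := fun k x =>
    (NatTrans.naturality_apply S.g k x).symm
  have wz : ∀ (Y : Z) (t : S.X₁.obj Y), S.g.app Y (S.f.app Y t) = 0 := fun Y t =>
    ConcreteCategory.congr_hom (congrArg (fun φ => NatTrans.app φ Y) S.zero) t
  obtain ⟨e'', he''⟩ := he V' e'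
  obtain ⟨t, ht⟩ := hex W' (G.map f' e'') (by rw [← nat', he'', h'.relation])
  obtain ⟨a, ha⟩ := h.generator W' t
  obtain ⟨U, hU, ⟨i⟩⟩ := hP _ _ hW hW'
  suffices h₂ : IsPresentation G (biprod.desc (f ≫ biprod.inl - a ≫ biprod.inr)
      (f' ≫ biprod.inr)) (G.map biprod.inl (S.f.app V e) + G.map biprod.inr e'') from
    ⟨a₂, U, V ⊞ V', hU, _, _, h₂.comp_iso i⟩
  refine ⟨?_, ?_, ?_⟩
  · intro Y x
    obtain ⟨k', hk'⟩ := h'.generator Y (S.g.app Y x)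
    obtain ⟨y, hy⟩ := hex Y (x - G.map k' e'') (by rw [map_sub, ← nat', he'', hk', sub_self])
    obtain ⟨k, rfl⟩ := h.generator Y y
    refine ⟨biprod.desc k k', ?_⟩
    rw [map_add, ← map_comp_elt, ← map_comp_elt, biprod.inl_desc, biprod.inr_desc, nat, hy]
    abel
  · rw [map_add, ← map_comp_elt, ← map_comp_elt, biprod.inl_desc, biprod.inr_desc, map_sub_elt,
      map_comp_elt, map_comp_elt, map_comp_elt, nat f, h.relation, nat a, ha, ht]
    simp
  · intro Y l hl
    rw [map_add, ← map_comp_elt, ← map_comp_elt] at hl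
    obtain ⟨m', hm'⟩ := h'.exists_factor (biprod.inr ≫ l) (by
      have h₀ := congrArg (S.g.app Y) hl
      rwa [map_add, nat, wz, zero_add, ← nat', he'', map_zero] at h₀)
    obtain ⟨m, hm₀⟩ := h.exists_factor (biprod.inl ≫ l + a ≫ m') (by
      apply hm Y
      rw [map_add_elt, map_add, ← nat, map_comp_elt _ a, ← nat, ha, ht, ← map_comp_elt G f', hm',
        hl, map_zero])
    refine ⟨biprod.desc m m', ?_⟩
    ext
    · simp [Preadditive.sub_comp, hm₀]
    · simp [hm']

end Extension

end Modules

/-! ### Quotients of full subcategories by ideals -/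

section Quotient

variable {C : Type u} [Category.{v} C] [Preadditive C] {I : CatIdeal C} {Q : ObjectProperty C}

instance (I : CatIdeal C) : (CategoryTheory.Quotient.functor I.rel).Additive :=
  CategoryTheory.Quotient.functor_additive _ _

/-- The class in `Q / I` of a morphism of `C`. -/
def quotMk {M N : (I.restrict Q).Quot} (c : M.as.obj ⟶ N.as.obj) : M ⟶ N :=
  (CategoryTheory.Quotient.functor (I.restrict Q).rel).map (ObjectProperty.homMk c)

theorem quotMk_surjective {M N : (I.restrict Q).Quot} (f : M ⟶ N) :
    ∃ c : M.as.obj ⟶ N.as.obj, quotMk c = f := by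
  obtain ⟨c, rfl⟩ := (CategoryTheory.Quotient.functor (I.restrict Q).rel).map_surjective
    (X := M.as) (Y := N.as) f
  exact ⟨c.hom, rfl⟩

theorem quotMk_eq_iff {M N : (I.restrict Q).Quot} (c d : M.as.obj ⟶ N.as.obj) :
    (quotMk c : M ⟶ N) = quotMk d ↔ c - d ∈ I.carrier _ _ :=
  CategoryTheory.Quotient.functor_map_eq_iff (I.restrict Q).rel _ _

theorem quotMk_id (M : (I.restrict Q).Quot) : (quotMk (𝟙 M.as.obj) : M ⟶ M) = 𝟙 M :=
  (CategoryTheory.Quotient.functor (I.restrict Q).rel).map_id M.as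

theorem quotMk_comp {M N L : (I.restrict Q).Quot} (c : M.as.obj ⟶ N.as.obj)
    (d : N.as.obj ⟶ L.as.obj) : (quotMk (c ≫ d) : M ⟶ L) = quotMk (M := M) (N := N) c ≫ quotMk d :=
  (CategoryTheory.Quotient.functor (I.restrict Q).rel).map_comp (X := M.as) (Y := N.as) (Z := L.as)
    (ObjectProperty.homMk c) (ObjectProperty.homMk d)

theorem quotMk_add {M N : (I.restrict Q).Quot} (c d : M.as.obj ⟶ N.as.obj) :
    (quotMk (c + d) : M ⟶ N) = quotMk c + quotMk d :=
  (CategoryTheory.Quotient.functor (I.restrict Q).rel).map_add (X := M.as) (Y := N.as)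
    (f := ObjectProperty.homMk c) (g := ObjectProperty.homMk d)

theorem quotMk_zero {M N : (I.restrict Q).Quot} :
    (quotMk (0 : M.as.obj ⟶ N.as.obj) : M ⟶ N) = 0 :=
  (CategoryTheory.Quotient.functor (I.restrict Q).rel).map_zero M.as N.as

theorem quotMk_eq_zero_iff {M N : (I.restrict Q).Quot} (c : M.as.obj ⟶ N.as.obj) :
    (quotMk c : M ⟶ N) = 0 ↔ c ∈ I.carrier _ _ := by
  rw [← quotMk_zero, quotMk_eq_iff, sub_zero]

theorem isBinarySum_quot {M M' N : (I.restrict Q).Quot}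
    (h : IsBinarySum M.as.obj M'.as.obj N.as.obj) : IsBinarySum M M' N := by
  obtain ⟨i, p, i', p', h₁, h₂, h₃, h₄, h⟩ := isBinarySum_iff.1 h
  refine isBinarySum_iff.2 ⟨quotMk i, quotMk p, quotMk i', quotMk p', ?_, ?_, ?_, ?_, ?_⟩
  · rw [← quotMk_comp, h₁, quotMk_id]
  · rw [← quotMk_comp, h₂, quotMk_id]
  · rw [← quotMk_comp, h₃, quotMk_zero]
  · rw [← quotMk_comp, h₄, quotMk_zero]
  · rw [← quotMk_comp, ← quotMk_comp, ← quotMk_add, h, quotMk_id]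

theorem isZero_quot {M : (I.restrict Q).Quot} (h : 𝟙 M.as.obj ∈ I.carrier _ _) : IsZero M := by
  rw [IsZero.iff_id_eq_zero, ← quotMk_id, quotMk_eq_zero_iff]
  exact h

theorem hasFiniteBiproducts_quot [HasFiniteBiproducts C] (h₀ : ∃ Z, IsZero Z ∧ Q Z)
    (h : ∀ Y Y', Q Y → Q Y' → Q (Y ⊞ Y')) : HasFiniteBiproducts (I.restrict Q).Quot := by
  refine hasFiniteBiproducts_of_isBinarySum ?_ fun M M' => ?_
  · obtain ⟨Z, hZ, hQ⟩ := h₀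
    refine ⟨⟨⟨Z, hQ⟩⟩, isZero_quot ?_⟩
    change 𝟙 Z ∈ _
    rw [hZ.eq_of_src (𝟙 Z) 0]
    exact (I.carrier _ _).zero_mem
  · exact ⟨⟨⟨M.as.obj ⊞ M'.as.obj, h _ _ M.as.property M'.as.property⟩⟩,
      isBinarySum_quot (isBinarySum_biprod _ _)⟩

end Quotient

namespace Extriangulation

variable {C : Type u} [SmallCategory C] [Preadditive C] [HasFiniteBiproducts C]
  {T : Extriangulation C} {X : ObjectProperty C} (hX : free X = X)

/-! ### The functor `M ↦ E(M, -)` -/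

theorem mem_through_of_factor {M N W : C} (a : M ⟶ W) (b : W ⟶ N) (hW : X W) :
    a ≫ b ∈ (CatIdeal.through X hX).carrier M N := ⟨W, a, b, hW, rfl⟩

include hX in
theorem resClass_biprod {k : ℕ} (M M' : C) (hM : T.resClass X k M) (hM' : T.resClass X k M') :
    T.resClass X k (M ⊞ M') := resClass_binarySum hX (isBinarySum_biprod _ _) hM hM'

include hX in
theorem resClass_exists_zero (k : ℕ) : ∃ Z, IsZero Z ∧ T.resClass X k Z :=
  ⟨zeroObj C, isZero_zeroObj, resClass_of_mem k (free_isZero hX isZero_zeroObj)⟩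

include hX in
theorem hasFiniteBiproducts_costable (k : ℕ) : HasFiniteBiproducts (T.Costable (T.resClass X k)) :=
  hasFiniteBiproducts_quot (resClass_exists_zero hX k) (resClass_biprod hX)

variable {n : ℕ}

/-- A morphism that factors through `X` acts as zero on `E(-, X_n^∧)`, since `E(X, X_n^∧) = 0`. -/
theorem kWellDefined (hrigid : T.IsRigid n X) : T.KWellDefined X n hX := by
  rintro M N f ⟨W, a, b, hW, hab⟩
  have h : ∀ (Y : C) (_ : T.resClass X n Y) (δ : T.Ext N.obj Y), pull T.E δ f.hom = 0 :=
    fun Y hY δ => by rw [← hab, pull_comp, ext_eq_zero hX hrigid hW hY (pull T.E δ b), pull_zero]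
  ext Y δ
  exact h Y.as.obj Y.as.property δ

theorem extModule_additive (P : ObjectProperty C) (M : C) : (T.extModule P M).Additive where
  map_add {Y Y' f g} := by
    obtain ⟨f, rfl⟩ := quotMk_surjective f
    obtain ⟨g, rfl⟩ := quotMk_surjective g
    rw [← quotMk_add]
    ext δ
    exact T.add_push f g δ

section K

variable {hX} {hK : T.KWellDefined X n hX}

instance K_obj_additive (M : (T.ResQuot X n hX)ᵒᵖ) : ((T.K X n hX hK).obj M).Additive :=
  extModule_additive _ _

instance K_additive : (T.K X n hX hK).Additive where
  map_add {M N f g} := by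
    obtain ⟨c, hc⟩ := quotMk_surjective f.unop
    obtain ⟨d, hd⟩ := quotMk_surjective g.unop
    obtain rfl : f = (quotMk c).op := by rw [hc]; rfl
    obtain rfl : g = (quotMk d).op := by rw [hd]; rfl
    rw [← op_add, ← quotMk_add]
    ext Y δ
    exact T.add_pull c d δ

/-- A conflation `A ⟶ X₀ ⟶ M` with `A ∈ X_n^∧` and `X₀ ∈ X` presents `E(M, -)`. -/
theorem K_presentation (hrigid : T.IsRigid n X) (M : T.ResQuot X n hX)
    {A X₀ : T.Costable (T.resClass X n)} (h₀ : X X₀.as.obj)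
    {f : A.as.obj ⟶ X₀.as.obj} {g : X₀.as.obj ⟶ M.as.obj} {δ : T.Ext M.as.obj A.as.obj}
    (h : T.Realizes f g δ) :
    IsPresentation ((T.K X n hX hK).obj (op M)) (quotMk f : A ⟶ X₀) δ where
  generator Y x := by
    obtain ⟨k, hk⟩ := h.exists_push_eq x (ext_eq_zero hX hrigid h₀ Y.as.property _)
    exact ⟨quotMk k, hk⟩
  relation := h.push_eq_zero
  exists_factor Y k hk := by
    obtain ⟨k, rfl⟩ := quotMk_surjective k
    obtain ⟨l, rfl⟩ := h.factors_inflation k hk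
    exact ⟨quotMk l, (quotMk_comp (M := A) (N := X₀) (L := Y) f l).symm⟩

theorem exists_resolution (M : T.ResQuot X n hX) :
    ∃ (A X₀ : T.Costable (T.resClass X n)) (_ : X X₀.as.obj) (f : A.as.obj ⟶ X₀.as.obj)
      (g : X₀.as.obj ⟶ M.as.obj) (δ : T.Ext M.as.obj A.as.obj), T.Realizes f g δ := by
  obtain ⟨A, X₀, f, g, hA, h₀, δ, h⟩ := (resClass_succ_iff hX).1 M.as.property
  exact ⟨⟨⟨A, hA⟩⟩, ⟨⟨X₀, resClass_of_mem n h₀⟩⟩, h₀, f, g, δ, h⟩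

theorem K_mem_lClass (hrigid : T.IsRigid n X) (M : (T.ResQuot X n hX)ᵒᵖ) :
    T.lClass X n ((T.K X n hX hK).obj M) := by
  obtain ⟨A, X₀, h₀, f, g, δ, h⟩ := exists_resolution M.unop
  exact presentedBy_iff.2 ⟨inferInstance, X₀, A, h₀, _, _, K_presentation hrigid M.unop h₀ h⟩

/-- A morphism of modules lifts to the generators of the presentations, and the lift extends to a
morphism of the resolutions, whose third component induces the given morphism. -/
theorem K_full (hrigid : T.IsRigid n X) : (T.K X n hX hK).Full where
  map_surjective {N' M'} φ := by
    obtain ⟨N, rfl⟩ : ∃ N, N' = op N := ⟨N'.unop, rfl⟩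
    obtain ⟨M, rfl⟩ : ∃ M, M' = op M := ⟨M'.unop, rfl⟩
    obtain ⟨A, X₀, h₀, f, g, δ, h⟩ := exists_resolution M
    obtain ⟨B, X₁, h₁, i, p, ε, h'⟩ := exists_resolution N
    have hM := K_presentation (hK := hK) hrigid M h₀ h
    have hN := K_presentation (hK := hK) hrigid N h₁ h'
    have nat : ∀ {Y Y' : T.Costable (T.resClass X n)} (a : Y.as.obj ⟶ Y'.as.obj)
        (η : T.Ext N.as.obj Y.as.obj),
        φ.app Y' (push T.E a η) = push T.E a (φ.app Y η) := fun a η =>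
      NatTrans.naturality_apply φ (quotMk a) η
    obtain ⟨b, hb⟩ := hM.generator B (φ.app B ε)
    obtain ⟨b, rfl⟩ := quotMk_surjective b
    replace hb : push T.E b δ = φ.app B ε := hb
    obtain ⟨b', hb'⟩ := h.factors_inflation (b ≫ i) (by
      rw [push_comp, hb]
      exact (nat i ε).symm.trans ((congrArg (φ.app X₁) h'.push_eq_zero).trans (map_zero _)))
    obtain ⟨c, -, hc⟩ := T.et3 h h' b b' hb'
    refine ⟨(quotMk c : M ⟶ N).op, ?_⟩
    ext Y x
    obtain ⟨k, rfl⟩ := hN.generator Y x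
    obtain ⟨k, rfl⟩ := quotMk_surjective k
    refine Eq.trans ?_ (nat k ε).symm
    change pull T.E (push T.E k ε) c = _
    rw [← push_pull, ← hc]
    exact congrArg (push T.E k) hb

/-- If `c` and `d` agree on the generator `ε ∈ E(N, B)`, then `c - d` lifts to the middle term of
`ε`, which lies in `X`. -/
theorem K_faithful : (T.K X n hX hK).Faithful where
  map_injective {N' M'} φ ψ hφ := by
    obtain ⟨N, rfl⟩ : ∃ N, N' = op N := ⟨N'.unop, rfl⟩
    obtain ⟨M, rfl⟩ : ∃ M, M' = op M := ⟨M'.unop, rfl⟩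
    obtain ⟨c, hc⟩ := quotMk_surjective φ.unop
    obtain ⟨d, hd⟩ := quotMk_surjective ψ.unop
    obtain rfl : φ = (quotMk c).op := by rw [hc]; rfl
    obtain rfl : ψ = (quotMk d).op := by rw [hd]; rfl
    obtain ⟨B, X₁, h₁, i, p, ε, h⟩ := exists_resolution N
    have h₀ : pull T.E ε c = pull T.E ε d :=
      ConcreteCategory.congr_hom (congrArg (fun α => NatTrans.app α B) hφ) ε
    obtain ⟨l, hl⟩ := h.lifts_deflation (c - d) (by rw [sub_pull, h₀, sub_self])
    congr 1
    rw [quotMk_eq_iff, ← hl]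
    exact mem_through_of_factor hX l p h₁

/-- Every object of `L` is in the image of `K`: to a relation `V ⟶ X₀` one adds the components of an
`E`-injective inflation `V ⟶ W`, which are zero in the costable category. The result is an
inflation, and its cone `M` has the module `E(M, -)`. -/
theorem K_essImage (hrigid : T.IsRigid n X) (hinj : T.EnoughInjMor (T.resClass X n) X)
    (G : T.CostableFunctors X n) :
    (T.K X n hX hK).essImage G ↔ T.lClass X n G := by
  constructor
  · rintro ⟨M, ⟨e⟩⟩
    exact presentedBy_of_iso e (K_mem_lClass hrigid M)
  · intro hG
    obtain ⟨aG, X₀, V, h₀, f, e, h⟩ := presentedBy_iff.1 hG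
    obtain ⟨f, rfl⟩ := quotMk_surjective f
    obtain ⟨W, j, hW, ⟨Z, q, ε, hj⟩, hjinj⟩ := hinj V.as.obj V.as.property
    obtain ⟨M, g, δ, hM⟩ := IsInflation.lift (T := T) ⟨Z, q, ε, hj⟩ f
    have hW' : X (X₀.as.obj ⊞ W) := free_binarySum hX (isBinarySum_biprod _ _) h₀ hW
    let M' : T.ResQuot X n hX := ⟨⟨M, (resClass_succ_iff hX).2
      ⟨_, _, _, _, V.as.property, hW', δ, hM⟩⟩⟩
    let B : T.Costable (T.resClass X n) := ⟨⟨X₀.as.obj ⊞ W, resClass_of_mem n hW'⟩⟩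
    have hp := K_presentation (hK := hK) hrigid M' (A := V) (X₀ := B) hW' hM
    refine ⟨op M', hp.generator.nonempty_iso h.generator fun Y k => ?_⟩
    obtain ⟨k, rfl⟩ := quotMk_surjective k
    constructor
    · intro hk
      obtain ⟨l, rfl⟩ := hM.factors_inflation k hk
      have hl : (quotMk (biprod.lift f j ≫ l) : V ⟶ Y) =
          quotMk (M := V) (N := X₀) f ≫ quotMk (biprod.inl ≫ l) := by
        rw [← quotMk_comp, quotMk_eq_iff]
        have : biprod.lift f j ≫ l - f ≫ biprod.inl ≫ l = j ≫ biprod.inr ≫ l := by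
          rw [← Category.assoc f, ← Preadditive.sub_comp, biprod.lift_eq, add_sub_cancel_left,
            Category.assoc]
        rw [this]
        exact T.injIdeal.postcomp _ hjinj
      rw [hl, map_comp_elt, h.relation, map_zero]
    · intro hk
      obtain ⟨l, hl⟩ := h.exists_factor _ hk
      obtain ⟨l, rfl⟩ := quotMk_surjective l
      rw [← quotMk_comp, quotMk_eq_iff] at hl
      obtain ⟨m, hm⟩ := hj.factors_inflation _ (hl Z ε)
      have : k = biprod.lift f j ≫ biprod.desc l (-m) := by
        rw [biprod.lift_desc, Preadditive.comp_neg, hm]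
        abel
      change push T.E k δ = 0
      rw [this, push_comp, hM.push_eq_zero, push_zero]

end K

end Extriangulation

/-! ### The duality -/

section Modules

variable {Z : Type u} [SmallCategory Z] [Preadditive Z]

instance : (preadditiveCoyoneda : Zᵒᵖ ⥤ Z ⥤ AddCommGrpCat.{u}).Additive where
  map_add {V W f g} := by
    ext Y h
    exact Preadditive.add_comp _ _ _ f.unop g.unop h

/-- If `Z` is additive, then finite coproducts of representable modules are representable, so one
generator and one relation suffice in a finite presentation. -/
theorem finitelyPresented_iff [HasFiniteBiproducts Z] {G : Z ⥤ AddCommGrpCat.{u}} :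
    finitelyPresented Z G ↔ presentedBy ⊤ G := by
  constructor
  · rintro ⟨hG, k, l, V, W, α, π, w, hex, hepi⟩
    have : HasFiniteBiproducts Zᵒᵖ := HasFiniteBiproducts.of_hasFiniteProducts
    let eV : rep (unop (⨁ fun i => op (V i))) ≅ ⨁ fun i => rep (V i) :=
      preadditiveCoyoneda.mapBiproduct fun i => op (V i)
    let eW : rep (unop (⨁ fun i => op (W i))) ≅ ⨁ fun i => rep (W i) :=
      preadditiveCoyoneda.mapBiproduct fun i => op (W i)
    refine ⟨hG, _, _, trivial, eV.hom ≫ α ≫ eW.inv, eW.hom ≫ π, by simp [w], ?_, inferInstance⟩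
    exact ShortComplex.exact_of_iso (ShortComplex.isoMk (S₁ := ShortComplex.mk α π w)
      eV.symm eW.symm (Iso.refl _) (by simp) (by simp)) hex
  · rintro ⟨hG, W, V, -, α, π, w, hex, hepi⟩
    let e : ∀ W : Z, (⨁ fun _ : Fin 1 => rep W) ≅ rep W := fun W => biproductUniqueIso _
    refine ⟨hG, 1, 1, fun _ => W, fun _ => V, (e W).hom ≫ α ≫ (e V).inv, (e V).hom ≫ π, by simp [w],
      ?_, inferInstance⟩
    exact ShortComplex.exact_of_iso (ShortComplex.isoMk (S₁ := ShortComplex.mk α π w)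
      (e W).symm (e V).symm (Iso.refl _) (by simp) (by simp)) hex

/-- The modules presented by `P` form an extension closed subcategory. -/
theorem extensionClosed_presentedBy [HasFiniteBiproducts Z] {P : ObjectProperty Z}
    (h₀ : ∃ W, P W) (hP : ∀ W W', P W → P W' → ∃ V, P V ∧ Nonempty (W ⊞ W' ≅ V)) :
    ExtensionClosed (presentedBy P).ι where
  exists_zero := by
    obtain ⟨W, hW⟩ := h₀
    obtain ⟨O, hO⟩ := HasZeroObject.zero (C := Z ⥤ AddCommGrpCat.{u})
    refine ⟨⟨O, presentedBy_isZero hW hO⟩, ?_⟩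
    rw [IsZero.iff_id_eq_zero]
    ext : 1
    exact hO.eq_of_src _ _
  extension S hS := by
    rintro ⟨A, ⟨a⟩⟩ ⟨B, ⟨b⟩⟩
    exact ⟨⟨S.X₂, presentedBy_of_shortExact hP hS (presentedBy_of_iso a A.property)
      (presentedBy_of_iso b B.property)⟩, ⟨Iso.refl _⟩⟩

end Modules

namespace Extriangulation

variable {C : Type u} [SmallCategory C] [Preadditive C] [HasFiniteBiproducts C]
  {T : Extriangulation C} {X : ObjectProperty C} {hX : free X = X} {n : ℕ}
  {hK : T.KWellDefined X n hX}

include hX in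
theorem extensionClosed_lClass : ExtensionClosed (T.lClass X n).ι := by
  have := hasFiniteBiproducts_costable (T := T) hX n
  refine extensionClosed_presentedBy ?_ fun W W' hW hW' => ?_
  · exact ⟨⟨⟨zeroObj C, resClass_of_mem n (free_isZero hX isZero_zeroObj)⟩⟩,
      free_isZero hX isZero_zeroObj⟩
  · let V : T.Costable (T.resClass X n) := ⟨⟨W.as.obj ⊞ W'.as.obj,
      resClass_biprod hX _ _ W.as.property W'.as.property⟩⟩
    exact ⟨V, free_binarySum hX (isBinarySum_biprod _ _) hW hW',
      (isBinarySum_quot (N := V) (isBinarySum_biprod _ _)).nonempty_iso⟩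

theorem extensionClosed_K (hrigid : T.IsRigid n X) (hinj : T.EnoughInjMor (T.resClass X n) X) :
    ExtensionClosed (T.K X n hX hK) where
  exists_zero := by
    have := hasFiniteBiproducts_quot (I := CatIdeal.through X hX)
      (resClass_exists_zero (T := T) hX (n + 1)) (resClass_biprod hX)
    obtain ⟨Z, hZ, hQ⟩ := resClass_exists_zero (T := T) hX (n + 1)
    refine ⟨op ⟨⟨Z, hQ⟩⟩, IsZero.op (isZero_quot ?_)⟩
    exact ⟨Z, 𝟙 Z, 𝟙 Z, free_isZero hX hZ, Category.id_comp _⟩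
  extension S hS h₁ h₃ := by
    rw [K_essImage hrigid hinj] at *
    obtain ⟨W, ⟨e⟩⟩ := (extensionClosed_lClass (hX := hX)).extension S hS ⟨⟨_, h₁⟩, ⟨Iso.refl _⟩⟩
      ⟨⟨_, h₃⟩, ⟨Iso.refl _⟩⟩
    exact presentedBy_of_iso e W.property

theorem isExactCategory_lClass (hX : free X = X) :
    IsExactCategory (subcategoryPairs (T.lClass X n)) :=
  (extensionClosed_lClass (hX := hX)).isExactCategory

theorem isExactCategory_resQuot (hrigid : T.IsRigid n X)
    (hinj : T.EnoughInjMor (T.resClass X n) X) :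
    IsExactCategory (inducedPairsOp (T.K X n hX hK)) := by
  have := K_full (hK := hK) hrigid
  have := K_faithful (hK := hK)
  exact isExactCategory_inducedPairsOp (extensionClosed_K hrigid hinj)

theorem isExactDuality_K (hrigid : T.IsRigid n X) (hinj : T.EnoughInjMor (T.resClass X n) X)
    (hL : ∀ M, T.lClass X n ((T.K X n hX hK).obj M)) :
    IsExactDuality (inducedPairsOp (T.K X n hX hK)) (subcategoryPairs (T.lClass X n))
      ((T.lClass X n).lift (T.K X n hX hK) hL) where
  isEquivalence :=
    { full := by
        have := K_full (hK := hK) hrigid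
        infer_instance
      faithful := by
        have := K_faithful (hK := hK)
        infer_instance
      essSurj := ⟨fun G => by
        obtain ⟨M, ⟨e⟩⟩ := (K_essImage (hK := hK) hrigid hinj G.obj).2 G.property
        exact ⟨M, ⟨(T.lClass X n).fullyFaithfulι.preimageIso e⟩⟩⟩ }
  additive := ⟨fun {M N f g} => by
    ext : 1
    exact (T.K X n hX hK).map_add⟩
  conflation_iff _ _ _ i p := Iff.rfl

/-- If `X_n^∧ = X`, then `L` is the class of all finitely presented modules. -/
theorem fpClass_eq_lClass (hX : free X = X) (h : T.resClass X n = X) :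
    T.fpClass X n = T.lClass X n := by
  have := hasFiniteBiproducts_costable (T := T) hX n
  funext G
  refine propext (finitelyPresented_iff.trans ?_)
  have : T.costableClass (T.resClass X n) X = ⊤ := by
    funext W
    exact propext ⟨fun _ => trivial, fun _ => h.le _ W.as.property⟩
  change _ ↔ presentedBy (T.costableClass (T.resClass X n) X) G
  rw [this]

/-! ### Weak idempotent completeness and the Krull-Schmidt property -/

/-- A section `s` of `p` in the quotient satisfies `s ≫ p - 1 = a ≫ b` in the original category,
for an intermediate object `W ∈ X`. Then `(s, a, j)`, where `j : Z ⟶ W'` is an inflation to `X`,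
is an inflation `Z ⟶ Y ⊞ W ⊞ W'` with retraction `(p, -b, 0)`; its cone is a direct summand of
`Y ⊞ W ⊞ W'`, and is the kernel of `p` in the quotient. -/
theorem isWeaklyIdempotentComplete_resQuot (hrigid : T.IsRigid n X) (hsmd : smd X = X)
    (hinf : T.EnoughInflations (T.resClass X (n + 1)) X) :
    IsWeaklyIdempotentComplete (T.ResQuot X n hX) where
  additive := hasFiniteBiproducts_quot (resClass_exists_zero hX _) (resClass_biprod hX)
  hasKernel := by
    rintro Y Z p ⟨⟨s, hs⟩⟩
    obtain ⟨p, rfl⟩ := quotMk_surjective p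
    obtain ⟨s, rfl⟩ := quotMk_surjective s
    rw [← quotMk_comp, ← quotMk_id, quotMk_eq_iff] at hs
    obtain ⟨W, a, b, hW, hab⟩ := hs
    obtain ⟨W', j, hW', hj⟩ := hinf _ Z.as.property
    -- in the quotient, `Y ⊞ W ⊞ W'` is isomorphic to `Y`
    obtain ⟨Z', y, hy⟩ := hj.lift (biprod.lift s a)
    obtain ⟨v, h₁, h₂, h₃⟩ := hy.isBinarySum (biprod.desc (biprod.desc p (-b)) 0) (by
      simp [hab])
    have hV : T.resClass X (n + 1) ((Y.as.obj ⊞ W) ⊞ W') :=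
      resClass_biprod hX _ _ (resClass_biprod hX _ _ Y.as.property (resClass_of_mem _ hW))
        (resClass_of_mem _ hW')
    have hZ' : T.resClass X (n + 1) Z' := resClass_of_isBinarySum hX hrigid hsmd le_rfl
      (isBinarySum_iff.2 ⟨v, y, _, _, h₁, by simp [hab], h₂, hy.comp_eq_zero,
        (add_comm _ _).trans h₃⟩) hV
    let K : T.ResQuot X n hX := ⟨⟨Z', hZ'⟩⟩
    let k : K ⟶ Y := quotMk (v ≫ biprod.fst ≫ biprod.fst)
    let r : Y ⟶ K := quotMk (biprod.inl ≫ biprod.inl ≫ y)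
    have hkp : k ≫ quotMk p = 0 := by
      rw [← quotMk_comp, quotMk_eq_zero_iff]
      refine ⟨W, v ≫ biprod.fst ≫ biprod.snd, b, hW, ?_⟩
      have : biprod.desc (biprod.desc p (-b)) (0 : W' ⟶ _) =
          biprod.fst ≫ biprod.fst ≫ p - biprod.fst ≫ biprod.snd ≫ b := by
        ext <;> simp
      rw [this, Preadditive.comp_sub, sub_eq_zero] at h₂
      simpa using h₂.symm
    have hkr : k ≫ r = 𝟙 K := by
      rw [← quotMk_comp, ← quotMk_id, quotMk_eq_iff]
      refine ⟨W ⊞ W', v ≫ biprod.lift (biprod.fst ≫ biprod.snd) biprod.snd,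
        -(biprod.desc (biprod.inr ≫ biprod.inl) biprod.inr) ≫ y,
        free_binarySum hX (isBinarySum_biprod _ _) hW hW', ?_⟩
      have h : biprod.lift (biprod.fst ≫ biprod.snd) biprod.snd ≫
          (biprod.desc (biprod.inr ≫ biprod.inl) biprod.inr) =
          𝟙 ((Y.as.obj ⊞ W) ⊞ W') - biprod.fst ≫ biprod.fst ≫ biprod.inl ≫ biprod.inl := by
        ext <;> simp
      have h' := congrArg (fun t => -(v ≫ t ≫ y)) h
      simp only [Preadditive.sub_comp, Preadditive.comp_sub, Category.id_comp, h₁, neg_sub] at h'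
      simpa using h'
    have hrk : quotMk p ≫ quotMk s + r ≫ k = 𝟙 Y := by
      rw [← quotMk_comp, ← quotMk_comp, ← quotMk_add, ← quotMk_id]
      congr 1
      have h := congrArg (fun t => biprod.inl ≫ biprod.inl ≫ t ≫ biprod.fst ≫ biprod.fst) h₃
      simpa [Preadditive.add_comp, Preadditive.comp_add] using h
    exact ⟨⟨KernelFork.ofι k hkp, KernelFork.IsLimit.ofι k hkp (fun g _ => g ≫ r)
      (fun g hg => by
        have h := congrArg (fun t => g ≫ t) hrk
        simpa [Preadditive.comp_add, reassoc_of% hg] using h)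
      (fun g hg m hm => by rw [← hm, Category.assoc, hkr, Category.comp_id])⟩⟩

end Extriangulation

section Local

variable {A : Type u} [Category.{v} A] [Preadditive A]

/-- The endomorphism ring of `M` is local or zero. -/
def LocalEnd (M : A) : Prop := ∀ a b : M ⟶ M, a + b = 𝟙 M → IsIso a ∨ IsIso b

theorem localEnd_of_isLocalRing {M : A} (h : IsLocalRing (End M)) : LocalEnd M := by
  intro a b hab
  have := h.isUnit_or_isUnit_of_add_one (a := (a : End M)) (b := b) hab
  rwa [isUnit_iff_isIso, isUnit_iff_isIso] at this

theorem LocalEnd.isLocalRing {M : A} (h : LocalEnd M) (hM : ¬ IsZero M) : IsLocalRing (End M) where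
  exists_pair_ne := ⟨𝟙 M, 0, fun h => hM ((IsZero.iff_id_eq_zero M).2 h)⟩
  isUnit_or_isUnit_of_add_one {a b} hab := by
    rw [isUnit_iff_isIso, isUnit_iff_isIso]
    exact h a b hab

theorem LocalEnd.quot {I : CatIdeal A} {Q : ObjectProperty A} {M : (I.restrict Q).Quot}
    (h : LocalEnd M.as.obj) : LocalEnd M := by
  intro a b hab
  obtain ⟨a, rfl⟩ := quotMk_surjective a
  have hiso : ∀ c : M.as.obj ⟶ M.as.obj, IsIso c → IsIso (quotMk c : M ⟶ M) := fun c hc =>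
    ⟨quotMk (inv c), by rw [← quotMk_comp, IsIso.hom_inv_id, quotMk_id],
      by rw [← quotMk_comp, IsIso.inv_hom_id, quotMk_id]⟩
  have hb : b = quotMk (𝟙 _ - a) := by
    have : (quotMk (𝟙 _ - a) : M ⟶ M) + quotMk a = 𝟙 M := by
      rw [← quotMk_add, sub_add_cancel, quotMk_id]
    rw [← eq_sub_iff_add_eq] at this
    rw [this, ← hab, add_sub_cancel_left]
  rw [hb]
  exact (h a (𝟙 _ - a) (add_sub_cancel _ _)).imp (hiso _) (hiso _)

/-- The zero summands of a finite sum may be omitted. -/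
theorem IsFiniteSum.exists_nonzero {k : ℕ} {f : Fin k → A} {Z : A} (h : IsFiniteSum f Z) :
    ∃ (m : ℕ) (e : Fin m → Fin k), (∀ l, ¬ IsZero (f (e l))) ∧
      IsFiniteSum (fun l => f (e l)) Z := by
  classical
  obtain ⟨i, p, h₁, h₂, h⟩ := isFiniteSum_iff.1 h
  let s : Finset (Fin k) := Finset.univ.filter fun j => ¬ IsZero (f j)
  refine ⟨s.card, fun l => (s.equivFin.symm l : Fin k), fun l => ?_,
    isFiniteSum_iff.2 ⟨fun l => i _, fun l => p _, fun l => h₁ _, fun l l' hl => h₂ _ _ ?_, ?_⟩⟩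
  · exact (Finset.mem_filter.1 (s.equivFin.symm l).2).2
  · exact fun e => hl (s.equivFin.symm.injective (Subtype.ext e))
  · rw [← h, Equiv.sum_comp s.equivFin.symm (fun j : s => p (j : Fin k) ≫ i (j : Fin k)),
      Finset.sum_coe_sort s fun j => p j ≫ i j]
    refine Finset.sum_subset (Finset.subset_univ s) fun j _ hj => ?_
    have hz : IsZero (f j) := by simpa [s] using hj
    rw [hz.eq_of_tgt (p j) 0, zero_comp]

theorem isFiniteSum_quot {I : CatIdeal A} {Q : ObjectProperty A} {k : ℕ}
    {f : Fin k → (I.restrict Q).Quot} {M : (I.restrict Q).Quot}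
    (h : IsFiniteSum (fun j => (f j).as.obj) M.as.obj) : IsFiniteSum f M := by
  obtain ⟨i, p, h₁, h₂, h⟩ := isFiniteSum_iff.1 h
  refine isFiniteSum_iff.2 ⟨fun j => quotMk (i j), fun j => quotMk (p j), fun j => ?_,
    fun j l hjl => ?_, ?_⟩
  · rw [← quotMk_comp, h₁, quotMk_id]
  · rw [← quotMk_comp, h₂ j l hjl, quotMk_zero]
  · rw [← quotMk_id, ← h]
    simp only [← quotMk_comp]
    exact (map_sum (AddMonoidHom.mk' (fun c : M.as.obj ⟶ M.as.obj => (quotMk c : M ⟶ M))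
      quotMk_add) _ _).symm

/-- A class that is closed under direct summands contains the terms of the finite sums in it. -/
theorem mem_of_isFiniteSum [HasFiniteBiproducts A] {Q : ObjectProperty A}
    (hQ : ∀ Y Y' Z, IsBinarySum Y Y' Z → Q Z → Q Y) {k : ℕ} {f : Fin k → A} {Z : A}
    (h : IsFiniteSum f Z) (hZ : Q Z) (j : Fin k) : Q (f j) := by
  induction k generalizing Z with
  | zero => exact j.elim0
  | succ k ih =>
    obtain ⟨Z', h', hs⟩ := h.exists_succ
    refine Fin.cases ?_ (fun j => ?_) j
    · exact hQ _ _ _ hs hZ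
    · exact ih h' (hQ _ _ _ hs.symm hZ) j

/-- The endomorphism rings in the quotient are quotients of the original ones, so they are local or
zero, and the summands that become zero are omitted. -/
theorem isKrullSchmidt_quot [HasFiniteBiproducts A] (I : CatIdeal A) {Q : ObjectProperty A}
    (hQ : ∀ Y Y' Z, IsBinarySum Y Y' Z → Q Z → Q Y) (hA : IsKrullSchmidt A) :
    IsKrullSchmidt (I.restrict Q).Quot := by
  intro M
  obtain ⟨k, f, hf, h⟩ := hA M.as.obj
  let f' : Fin k → (I.restrict Q).Quot := fun j =>
    ⟨⟨f j, mem_of_isFiniteSum hQ h M.as.property j⟩⟩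
  obtain ⟨m, e, he, h'⟩ := (isFiniteSum_quot (f := f') h).exists_nonzero
  exact ⟨m, fun l => f' (e l), fun l => (LocalEnd.quot (M := f' (e l))
    (localEnd_of_isLocalRing (hf (e l)))).isLocalRing (he l), h'⟩

end Local

/-! ### Cokernels of finitely presented modules -/

section Cokernels

variable {Z : Type u} [SmallCategory Z] [Preadditive Z]

/-- Over an additive category, the finitely presented modules are closed under cokernels. -/
theorem presentedBy_cokernel [HasFiniteBiproducts Z] {G G' : Z ⥤ AddCommGrpCat.{u}}
    (hG : presentedBy ⊤ G) (hG' : presentedBy ⊤ G') (φ : G ⟶ G') :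
    presentedBy ⊤ (cokernel φ) := by
  rw [presentedBy_iff] at *
  obtain ⟨_, _, V', _, _, e', h'⟩ := hG
  obtain ⟨_, W, V, _, f, e, h⟩ := hG'
  set π := cokernel.π φ with hπ
  have hepi := (epi_iff_app π).1 inferInstance
  have hex : (ShortComplex.mk φ π (cokernel.condition φ)).Exact :=
    ShortComplex.exact_of_g_is_cokernel _ (cokernelIsCokernel φ)
  rw [exact_iff_app] at hex
  have wz : ∀ {Y : Z} (x : G.obj Y), π.app Y (φ.app Y x) = 0 := fun {Y} x =>
    ConcreteCategory.congr_hom (congrArg (fun α => NatTrans.app α Y) (cokernel.condition φ)) x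
  have nat : ∀ {Y Y' : Z} (k : Y ⟶ Y') (x : G'.obj Y),
      (cokernel φ).map k (π.app Y x) = π.app Y' (G'.map k x) := fun k x =>
    (NatTrans.naturality_apply π k x).symm
  have natφ : ∀ {Y Y' : Z} (k : Y ⟶ Y') (x : G.obj Y),
      G'.map k (φ.app Y x) = φ.app Y' (G.map k x) := fun k x =>
    (NatTrans.naturality_apply φ k x).symm
  have hadd : (cokernel φ).Additive := ⟨fun {Y Y' k l} => by
    ext x
    obtain ⟨x, rfl⟩ := hepi Y x
    refine (nat _ x).trans ?_
    rw [map_add_elt, map_add]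
    exact (congrArg₂ (· + ·) (nat k x) (nat l x)).symm⟩
  obtain ⟨a, ha⟩ := h.generator V' (φ.app V' e')
  refine ⟨hadd, W ⊞ V', V, trivial, biprod.lift f a, π.app V e, ?_, ?_, ?_⟩
  · intro Y x
    obtain ⟨x, rfl⟩ := hepi Y x
    obtain ⟨k, rfl⟩ := h.generator Y x
    exact ⟨k, nat k e⟩
  · rw [nat, biprod.lift_eq, map_add_elt, map_comp_elt, map_comp_elt, h.relation, ha, natφ,
      map_zero, zero_add, wz]
  · intro Y k hk
    rw [nat] at hk
    obtain ⟨x, hx⟩ := hex Y _ hk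
    obtain ⟨b, rfl⟩ := h'.generator Y x
    obtain ⟨l, hl⟩ := h.exists_factor (k - a ≫ b) (by
      rw [map_sub_elt, map_comp_elt, ha, natφ, sub_eq_zero]
      exact hx.symm)
    exact ⟨biprod.desc l b, by rw [biprod.lift_desc, hl]; abel⟩

variable {A : Type*} [Category A] [Preadditive A] {D : Type*} [Category D] [Abelian D]
  {F : Aᵒᵖ ⥤ D} [F.Full] [F.Faithful]

/-- A contravariant fully faithful functor takes a monomorphism to an epimorphism, provided that the
cokernel of its image is in the essential image. -/
theorem epi_map_op_of_mono [F.Additive] {N N' : A} (g : N ⟶ N') [Mono g]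
    (h : F.essImage (cokernel (F.map g.op))) : Epi (F.map g.op) := by
  obtain ⟨L, ⟨e⟩⟩ := h
  have ht : g.op ≫ F.preimage (cokernel.π (F.map g.op) ≫ e.inv) = 0 :=
    F.map_injective (by simp)
  have ht' := congrArg Quiver.Hom.unop ht
  rw [unop_comp, Quiver.Hom.unop_op, unop_zero] at ht'
  have h₀ : F.preimage (cokernel.π (F.map g.op) ≫ e.inv) = 0 :=
    Quiver.Hom.unop_inj (zero_of_comp_mono g ht')
  have h₁ := congrArg F.map h₀
  rw [F.map_preimage, F.map_zero] at h₁
  refine Abelian.epi_of_cokernel_π_eq_zero _ ?_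
  rw [← cancel_mono e.inv, h₁, zero_comp]

/-- A retract has a complement, provided that the cokernel of the image of the retraction is in the
essential image of the contravariant fully faithful functor `F`. -/
theorem exists_complement {M S : A} (m : M ⟶ S) (r : S ⟶ M) (hmr : m ≫ r = 𝟙 M) [F.Additive]
    (h : F.essImage (cokernel (F.map r.op))) :
    ∃ (M' : A) (i : M' ⟶ S) (p : S ⟶ M'), i ≫ p = 𝟙 M' ∧ m ≫ p = 0 ∧ i ≫ r = 0 ∧
      r ≫ m + p ≫ i = 𝟙 S := by
  obtain ⟨L, ⟨e⟩⟩ := h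
  have h₁ : F.map r.op ≫ F.map m.op = 𝟙 _ := by rw [← F.map_comp, ← op_comp, hmr]; simp
  let σ : cokernel (F.map r.op) ⟶ F.obj (op S) :=
    cokernel.desc _ (𝟙 _ - F.map m.op ≫ F.map r.op) (by
      rw [Preadditive.comp_sub, reassoc_of% h₁, Category.comp_id, sub_self])
  have hσ : cokernel.π (F.map r.op) ≫ σ = 𝟙 _ - F.map m.op ≫ F.map r.op := by simp [σ]
  let p : op S ⟶ L := F.preimage (cokernel.π (F.map r.op) ≫ e.inv)
  let i : L ⟶ op S := F.preimage (e.hom ≫ σ)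
  have hpi : p ≫ i = 𝟙 _ - m.op ≫ r.op := F.map_injective (by simp [p, i, hσ])
  have hip : i ≫ p = 𝟙 _ := F.map_injective (by
    have : σ ≫ cokernel.π (F.map r.op) = 𝟙 _ := by
      rw [← cancel_epi (cokernel.π (F.map r.op)), reassoc_of% hσ]
      simp
    simp [p, i, reassoc_of% this])
  have hrp : r.op ≫ p = 0 := F.map_injective (by simp [p])
  have him : i ≫ m.op = 0 := by
    have : Epi p := ⟨fun a b hab => by
      have := congrArg (fun t => i ≫ t) hab
      simpa [reassoc_of% hip] using this⟩
    rw [← cancel_epi p, reassoc_of% hpi, Preadditive.sub_comp, Category.assoc, ← op_comp, hmr]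
    simp
  refine ⟨L.unop, p.unop, i.unop, ?_, ?_, ?_, ?_⟩
  · exact congrArg Quiver.Hom.unop hip
  · exact congrArg Quiver.Hom.unop him
  · exact congrArg Quiver.Hom.unop hrp
  · have := congrArg Quiver.Hom.unop hpi
    change i.unop ≫ p.unop = 𝟙 S - r ≫ m at this
    rw [this]
    abel

end Cokernels

/-! ### The exchange property of objects with local endomorphism rings -/

section Exchange

variable {A : Type u} [Category.{v} A] [Preadditive A]

/-- If all retracts of `K` have the property `R`, and if `S` has it and has a local (or zero)
endomorphism ring, then all retracts of `S ⊕ K` have the property: for a retract `M` of `S ⊕ K`, one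
of the components at `S` of the idempotent and of its complement is invertible; so either `S` splits
off `M` and the rest of `M` is a retract of `K`, or `M` itself is a retract of `K`. -/
theorem retract_of_binarySum {R : ObjectProperty A}
    (hsplit : ∀ ⦃M S : A⦄ (m : M ⟶ S) (r : S ⟶ M), m ≫ r = 𝟙 M →
      ∃ (M' : A) (i : M' ⟶ S) (p : S ⟶ M'), i ≫ p = 𝟙 M' ∧ m ≫ p = 0 ∧ i ≫ r = 0 ∧
        r ≫ m + p ≫ i = 𝟙 S)
    (hR : ∀ Y Y' Z, IsBinarySum Y Y' Z → R Y → R Y' → R Z) {S K Y : A} (hS : LocalEnd S)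
    (hRS : R S) (hRK : ∀ M (m : M ⟶ K) (r : K ⟶ M), m ≫ r = 𝟙 M → R M) (hY : IsBinarySum S K Y)
    (M : A) (m : M ⟶ Y) (r : Y ⟶ M) (hmr : m ≫ r = 𝟙 M) : R M := by
  obtain ⟨i, p, i', p', h₁, h₂, h₃, h₄, h₅⟩ := isBinarySum_iff.1 hY
  have h₆ : p' ≫ i' = 𝟙 Y - p ≫ i := by rw [← h₅]; abel
  rcases hS (i ≫ (r ≫ m) ≫ p) (i ≫ (𝟙 Y - r ≫ m) ≫ p) (by
    rw [← Preadditive.comp_add, ← Preadditive.add_comp, add_sub_cancel, Category.id_comp, h₁])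
    with ha | hb
  · obtain ⟨a, hadef⟩ : ∃ a, a = i ≫ (r ≫ m) ≫ p := ⟨_, rfl⟩
    rw [← hadef] at ha
    have huv : (i ≫ r) ≫ (m ≫ p ≫ inv a) = 𝟙 S := by
      have : (i ≫ r) ≫ (m ≫ p ≫ inv a) = (i ≫ (r ≫ m) ≫ p) ≫ inv a := by
        simp only [Category.assoc]
      rw [this, ← hadef, IsIso.hom_inv_id]
    obtain ⟨M₁, j, q, hjq, huq, hjv, hsum⟩ := hsplit _ _ huv
    have hjp : j ≫ m ≫ p = 0 := by
      have := congrArg (fun t => t ≫ a) hjv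
      simpa using this
    refine hR S M₁ M (isBinarySum_iff.2 ⟨_, _, j, q, huv, hjq, huq, hjv, hsum⟩) hRS
      (hRK M₁ (j ≫ m ≫ p') (i' ≫ r ≫ q) ?_)
    have : (j ≫ m ≫ p') ≫ i' ≫ r ≫ q = j ≫ m ≫ (p' ≫ i') ≫ r ≫ q := by simp
    rw [this, h₆, Preadditive.sub_comp, Preadditive.comp_sub, Preadditive.comp_sub,
      Category.id_comp, reassoc_of% hmr, hjq]
    have : j ≫ m ≫ (p ≫ i) ≫ r ≫ q = (j ≫ m ≫ p) ≫ i ≫ r ≫ q := by simp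
    rw [this, hjp, zero_comp, sub_zero]
  · obtain ⟨f, hf⟩ : ∃ f, f = 𝟙 Y - r ≫ m := ⟨_, rfl⟩
    obtain ⟨b, hbdef⟩ : ∃ b, b = i ≫ f ≫ p := ⟨_, rfl⟩
    rw [← hf, ← hbdef] at hb
    have hfr : f ≫ r = 0 := by simp [hf, hmr]
    obtain ⟨m', hm'⟩ : ∃ m' : M ⟶ Y, m' = m - m ≫ p ≫ inv b ≫ i ≫ f := ⟨_, rfl⟩
    have hm'r : m' ≫ r = 𝟙 M := by simp [hm', hmr, hfr]
    have hm'p : m' ≫ p = 0 := by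
      have : m' ≫ p = m ≫ p - m ≫ p ≫ inv b ≫ (i ≫ f ≫ p) := by
        rw [hm', Preadditive.sub_comp]
        simp only [Category.assoc]
      rw [this, ← hbdef, IsIso.inv_hom_id, Category.comp_id, sub_self]
    refine hRK M (m' ≫ p') (i' ≫ r) ?_
    have : (m' ≫ p') ≫ i' ≫ r = m' ≫ (p' ≫ i') ≫ r := by simp
    rw [this, h₆, Preadditive.sub_comp, Preadditive.comp_sub, Category.id_comp, hm'r,
      Category.assoc, reassoc_of% hm'p, zero_comp, sub_zero]

end Exchange

namespace Extriangulation

variable {C : Type u} [SmallCategory C] [Preadditive C] [HasFiniteBiproducts C]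
  {T : Extriangulation C} {X : ObjectProperty C} {hX : free X = X} {n : ℕ}
  {hK : T.KWellDefined X n hX}

/-! ### Injective objects -/

theorem ext_eq_zero_of_injObj {I Z : C} (hI : T.injObj I) (δ : T.Ext Z I) : δ = 0 := by
  obtain ⟨Y, x, y, h⟩ := T.exists_realizes δ
  obtain ⟨g, hg⟩ := hI x y ⟨δ, h⟩ (𝟙 I)
  rw [← T.push_id δ, ← hg, push_comp, h.push_eq_zero, push_zero]

theorem injObj_biprod {I I' : C} (h : T.injObj I) (h' : T.injObj I') : T.injObj (I ⊞ I') := by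
  intro Y Z W x y hxy f
  obtain ⟨g, hg⟩ := h x y hxy (f ≫ biprod.fst)
  obtain ⟨g', hg'⟩ := h' x y hxy (f ≫ biprod.snd)
  exact ⟨biprod.lift g g', by ext <;> simp [hg, hg']⟩

theorem cosyzygy_le (hX : free X = X) (hI : T.injObj ≤ X) :
    T.cosyzygy X ≤ T.resClass X (n + 1) := by
  rintro Z ⟨X', I, f, g, hX', hI', h⟩
  exact (resClass_succ_iff hX).2 ⟨X', I, f, g, resClass_of_mem n hX', hI _ hI', h⟩

/-- Morphisms from `N` to a cosyzygy of `W` are extensions of `N` by `W`. -/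
theorem exists_pull_eq_of_injObj {W I M N : C} {f : W ⟶ I} {g : I ⟶ M} {δ : T.Ext M W}
    (h : T.Realizes f g δ) (hI : T.injObj I) (ε : T.Ext N W) : ∃ c : N ⟶ M, pull T.E δ c = ε :=
  h.exists_pull_eq ε (ext_eq_zero_of_injObj hI _)

/-- If the middle term of `δ` lies in `X`, then a morphism to the third term is determined, modulo
`[X]`, by the pullback of `δ`. -/
theorem quotMk_eq_of_pull_eq {W I : C} {N M : T.ResQuot X n hX} {f : W ⟶ I} {g : I ⟶ M.as.obj}
    {δ : T.Ext M.as.obj W} (h : T.Realizes f g δ) (hI : X I) {c d : N.as.obj ⟶ M.as.obj}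
    (hcd : pull T.E δ c = pull T.E δ d) : (quotMk c : N ⟶ M) = quotMk d := by
  obtain ⟨l, hl⟩ := h.lifts_deflation (c - d) (by rw [sub_pull, hcd, sub_self])
  rw [quotMk_eq_iff, ← hl]
  exact mem_through_of_factor hX l g hI

variable (hrigid : T.IsRigid n X) (hinj : T.EnoughInjMor (T.resClass X n) X)
  (hn : T.resClass X n = X)

include hX hn in
theorem lClass_eq : T.lClass X n = presentedBy ⊤ := by
  rw [← fpClass_eq_lClass hX hn]
  have := hasFiniteBiproducts_costable (T := T) hX n
  funext G
  exact propext finitelyPresented_iff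

include hrigid hinj hn in
/-- If `X_n^∧ = X`, then the essential image of `K` is closed under cokernels. -/
theorem essImage_cokernel {M N : (T.ResQuot X n hX)ᵒᵖ} (f : M ⟶ N) :
    (T.K X n hX hK).essImage (cokernel ((T.K X n hX hK).map f)) := by
  have := hasFiniteBiproducts_costable (T := T) hX n
  have hM := K_mem_lClass (hK := hK) hrigid M
  have hN := K_mem_lClass (hK := hK) hrigid N
  rw [K_essImage hrigid hinj, lClass_eq (hX := hX) hn]
  rw [lClass_eq (hX := hX) hn] at hM hN
  exact presentedBy_cokernel hM hN _

include hrigid hinj hn in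
/-- Cosyzygies of objects of `X` correspond to representable modules, and so are injective. -/
theorem injective_of_cosyzygy (hI : T.injObj ≤ X) (M : T.ResQuot X n hX)
    (hM : T.cosyzygyQuot X n hX M) : Injective M where
  factors {N N'} f g hg := by
    have hK := kWellDefined hX hrigid
    have := K_full (hK := hK) hrigid
    have := K_faithful (hK := hK)
    obtain ⟨f, rfl⟩ := quotMk_surjective f
    obtain ⟨g, rfl⟩ := quotMk_surjective g
    obtain ⟨W, I, i, p, hW, hI', δ, h⟩ := hM
    have hepi := epi_map_op_of_mono (F := T.K X n hX hK) (quotMk g : N ⟶ N')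
      (essImage_cokernel hrigid hinj hn _)
    rw [epi_iff_app] at hepi
    obtain ⟨η, hη⟩ := hepi ⟨⟨W, resClass_of_mem n hW⟩⟩ (pull T.E δ f)
    replace hη : pull T.E η g = pull T.E δ f := hη
    obtain ⟨c, rfl⟩ := exists_pull_eq_of_injObj h hI' η
    refine ⟨quotMk c, ?_⟩
    rw [← quotMk_comp]
    exact quotMk_eq_of_pull_eq h (hI _ hI') ((T.pull_comp g c δ).trans hη)

include hrigid hinj hn in
theorem resQuot_split ⦃M S : T.ResQuot X n hX⦄ (m : M ⟶ S) (r : S ⟶ M) (hmr : m ≫ r = 𝟙 M) :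
    ∃ (M' : T.ResQuot X n hX) (i : M' ⟶ S) (p : S ⟶ M'), i ≫ p = 𝟙 M' ∧ m ≫ p = 0 ∧ i ≫ r = 0 ∧
      r ≫ m + p ≫ i = 𝟙 S := by
  have hK := kWellDefined hX hrigid
  have := K_full (hK := hK) hrigid
  have := K_faithful (hK := hK)
  exact exists_complement (F := T.K X n hX hK) m r hmr (essImage_cokernel hrigid hinj hn _)

include hrigid in
/-- Every object `M` embeds into a cosyzygy: if `A ⟶ X₀ ⟶ M` and `A ⟶ I ⟶ S` are conflations, then
`M ⟶ S` corresponds to the epimorphism from the representable module at `A` to `E(M, -)`. -/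
theorem exists_mono_cosyzygy (hn : T.resClass X n = X) (hC : T.EnoughInjectives)
    (hI : T.injObj ≤ X) (M : T.ResQuot X n hX) :
    ∃ (S : T.ResQuot X n hX) (m : M ⟶ S), T.cosyzygyQuot X n hX S ∧ Mono m := by
  obtain ⟨A, X₀, h₀, f, g, δ, h⟩ := exists_resolution M
  obtain ⟨I, S, x, y, hI', ε, hε⟩ := hC A.as.obj
  have hA : X A.as.obj := hn.le _ A.as.property
  have hS : T.cosyzygy X S := ⟨_, I, x, y, hA, hI', ε, hε⟩
  let S' : T.ResQuot X n hX := ⟨⟨S, cosyzygy_le hX hI S hS⟩⟩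
  obtain ⟨m, hm⟩ := exists_pull_eq_of_injObj hε hI' δ
  refine ⟨S', quotMk m, hS, Preadditive.mono_of_cancel_zero _ fun {N} t ht => ?_⟩
  obtain ⟨t, rfl⟩ := quotMk_surjective t
  rw [← quotMk_comp, quotMk_eq_zero_iff] at ht
  obtain ⟨W, a, b, hW, hab⟩ := ht
  rw [← quotMk_zero]
  refine quotMk_eq_of_pull_eq h h₀ ?_
  rw [zero_pull, ← hm, ← pull_comp, ← hab, pull_comp,
    ext_eq_zero hX hrigid hW A.as.property (pull T.E ε b), pull_zero]

include hrigid hinj in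
theorem injective_iff_smd (hn : T.resClass X n = X) (hC : T.EnoughInjectives)
    (hI : T.injObj ≤ X) (M : T.ResQuot X n hX) :
    Injective M ↔ smd (T.cosyzygyQuot X n hX) M := by
  constructor
  · intro hM
    obtain ⟨S, m, hS, hm⟩ := exists_mono_cosyzygy hrigid hn hC hI M
    obtain ⟨r, hr⟩ := hM.factors (𝟙 M) m
    obtain ⟨M', i, p, h₁, h₂, h₃, h₄⟩ := resQuot_split hrigid hinj hn m r hr
    exact ⟨M', S, hS, isBinarySum_iff.2 ⟨m, r, i, p, hr, h₁, h₂, h₃, h₄⟩⟩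
  · rintro ⟨M', S, hS, h⟩
    obtain ⟨i, p, -, -, h₁, -⟩ := isBinarySum_iff.1 h
    have := injective_of_cosyzygy hrigid hinj hn hI S hS
    exact Retract.injective ⟨i, p, h₁⟩

/-! ### Krull-Schmidt decompositions of cosyzygies -/

/-- A cosyzygy of `W` in the quotient category depends on `W` alone. -/
theorem nonempty_iso_of_cosyzygy {M M' : T.ResQuot X n hX} {W I W' I' : C} {f : W ⟶ I}
    {g : I ⟶ M.as.obj} {δ : T.Ext M.as.obj W} {f' : W' ⟶ I'} {g' : I' ⟶ M'.as.obj}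
    {δ' : T.Ext M'.as.obj W'} (hI : T.injObj ≤ X) (h : T.Realizes f g δ) (hf : T.injObj I)
    (h' : T.Realizes f' g' δ') (hf' : T.injObj I') (e : W ≅ W') : Nonempty (M ≅ M') := by
  obtain ⟨c, hc⟩ := exists_pull_eq_of_injObj h' hf' (push T.E e.hom δ)
  obtain ⟨d, hd⟩ := exists_pull_eq_of_injObj h hf (push T.E e.inv δ')
  refine ⟨⟨quotMk c, quotMk d, ?_, ?_⟩⟩
  · rw [← quotMk_comp, ← quotMk_id]
    refine quotMk_eq_of_pull_eq h (hI _ hf) ?_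
    rw [pull_comp, hd, ← push_pull, hc, ← push_comp, Iso.hom_inv_id, push_id, pull_id]
  · rw [← quotMk_comp, ← quotMk_id]
    refine quotMk_eq_of_pull_eq h' (hI _ hf') ?_
    rw [pull_comp, hc, ← push_pull, hd, ← push_comp, Iso.inv_hom_id, push_id, pull_id]

include hrigid in
/-- The endomorphism ring of a cosyzygy of `W` is local if that of `W` is. -/
theorem localEnd_of_cosyzygy {M : T.ResQuot X n hX} {W I : C} {f : W ⟶ I} {g : I ⟶ M.as.obj}
    {δ : T.Ext M.as.obj W} (hI : T.injObj ≤ X) (h : T.Realizes f g δ) (hW : X W)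
    (hf : T.injObj I) (hloc : LocalEnd W) : LocalEnd M := by
  have key : ∀ (c : M.as.obj ⟶ M.as.obj) (α : W ⟶ W), pull T.E δ c = push T.E α δ → IsIso α →
      IsIso (quotMk c : M ⟶ M) := by
    intro c α hα hiso
    obtain ⟨d, hd⟩ := exists_pull_eq_of_injObj h hf (push T.E (inv α) δ)
    refine ⟨quotMk d, ?_, ?_⟩ <;> rw [← quotMk_comp, ← quotMk_id] <;>
      refine quotMk_eq_of_pull_eq h (hI _ hf) ?_
    · rw [pull_comp, hd, ← push_pull, hα, ← push_comp, IsIso.hom_inv_id, push_id, pull_id]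
    · rw [pull_comp, hα, ← push_pull, hd, ← push_comp, IsIso.inv_hom_id, push_id, pull_id]
  intro a b hab
  obtain ⟨a, rfl⟩ := quotMk_surjective a
  have hb : b = quotMk (𝟙 _ - a) := by
    have : (quotMk a : M ⟶ M) + quotMk (𝟙 _ - a) = 𝟙 M := by
      rw [← quotMk_add, add_sub_cancel, quotMk_id]
    exact add_left_cancel (hab.trans this.symm)
  obtain ⟨α, hα⟩ := h.exists_push_eq (pull T.E δ a)
    (ext_eq_zero hX hrigid (hI _ hf) (resClass_of_mem n hW) _)
  rw [hb]
  refine (hloc α (𝟙 W - α) (add_sub_cancel _ _)).imp (key a α hα.symm)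
    (key (𝟙 _ - a) (𝟙 W - α) ?_)
  rw [sub_pull, sub_push, hα, pull_id, push_id]

include hrigid hinj in
/-- A retract of a cosyzygy of `W` is isomorphic to a cosyzygy, by induction on the number of the
indecomposable summands of `W`: a cosyzygy of `w ⊞ W'` is the sum of cosyzygies of `w` and of `W'`,
and the first one splits off by `retract_of_binarySum`. -/
theorem isoClosure_of_retract (hn : T.resClass X n = X) (hC : T.EnoughInjectives)
    (hI : T.injObj ≤ X) (hsmd : smd X = X) {k : ℕ} (w : Fin k → C) (hw : ∀ j, LocalEnd (w j))
    {W I : C} (hW : IsFiniteSum w W) (hXW : X W) {Y : T.ResQuot X n hX} {f : W ⟶ I}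
    {g : I ⟶ Y.as.obj} {δ : T.Ext Y.as.obj W} (h : T.Realizes f g δ) (hf : T.injObj I)
    (M : T.ResQuot X n hX) (m : M ⟶ Y) (r : Y ⟶ M) (hmr : m ≫ r = 𝟙 M) :
    (T.cosyzygyQuot X n hX).isoClosure M := by
  induction k generalizing W I Y M with
  | zero =>
    have hW₀ : IsZero W := by
      obtain ⟨_, _, _, _, h₀⟩ := isFiniteSum_iff.1 hW
      rw [IsZero.iff_id_eq_zero, ← h₀]
      simp
    have hY : 𝟙 Y = 0 := by
      rw [← quotMk_id, ← quotMk_zero]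
      refine quotMk_eq_of_pull_eq h (hI _ hf) ?_
      rw [ext_eq_zero_right hW₀ δ, pull_zero, pull_zero]
    have hY₀ : IsZero Y := (IsZero.iff_id_eq_zero Y).2 hY
    have hM : IsZero M := by
      rw [IsZero.iff_id_eq_zero, ← hmr, hY₀.eq_of_src r 0, comp_zero]
    exact ⟨Y, ⟨W, I, f, g, hXW, hf, δ, h⟩, ⟨hM.iso hY₀⟩⟩
  | succ k ih =>
    obtain ⟨W', hW', hsum⟩ := hW.exists_succ
    have hmem : ∀ Y Y' Z : C, IsBinarySum Y Y' Z → X Z → X Y := fun Y Y' Z hYZ hZ => by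
      rw [← hsmd]
      exact ⟨Y', Z, hZ, hYZ⟩
    have hX₀ : X (w 0) := hmem _ _ _ hsum hXW
    have hXW' : X W' := hmem _ _ _ hsum.symm hXW
    obtain ⟨I₀, S₀, x₀, y₀, hI₀, δ₀, h₀⟩ := hC (w 0)
    obtain ⟨I', S', x', y', hI', δ', h'⟩ := hC W'
    have hS₀ : T.cosyzygy X S₀ := ⟨_, _, x₀, y₀, hX₀, hI₀, δ₀, h₀⟩
    have hS' : T.cosyzygy X S' := ⟨_, _, x', y', hXW', hI', δ', h'⟩
    have hS : T.cosyzygy X (S₀ ⊞ S') := ⟨_, _, _, _, free_binarySum hX (isBinarySum_biprod _ _)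
      hX₀ hXW', injObj_biprod hI₀ hI', _, T.realizes_sum h₀ h'⟩
    let Q₀ : T.ResQuot X n hX := ⟨⟨S₀, cosyzygy_le hX hI _ hS₀⟩⟩
    let Q' : T.ResQuot X n hX := ⟨⟨S', cosyzygy_le hX hI _ hS'⟩⟩
    let Q : T.ResQuot X n hX := ⟨⟨S₀ ⊞ S', cosyzygy_le hX hI _ hS⟩⟩
    obtain ⟨e⟩ := hsum.nonempty_iso
    obtain ⟨e'⟩ := nonempty_iso_of_cosyzygy (M := Q) (M' := Y) hI (T.realizes_sum h₀ h')
      (injObj_biprod hI₀ hI') h hf e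
    have hY : IsBinarySum Q₀ Q' Y :=
      (isBinarySum_quot (N := Q) (isBinarySum_biprod S₀ S')).of_iso e'
    refine retract_of_binarySum (resQuot_split hrigid hinj hn) ?_
      (localEnd_of_cosyzygy (M := Q₀) hrigid hI h₀ hX₀ hI₀ (hw 0)) ⟨Q₀, hS₀, ⟨Iso.refl _⟩⟩
      (fun M m r hmr => ih (fun j => w j.succ) (fun j => hw _) hW' hXW' (Y := Q') h' hI' M m r hmr)
      hY M m r hmr
    rintro U V Z hZ ⟨U', ⟨A, J, a, b, hA, hJ, α, hα⟩, ⟨eU⟩⟩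
      ⟨V', ⟨A', J', a', b', hA', hJ', α', hα'⟩, ⟨eV⟩⟩
    have hUV : T.cosyzygy X (U'.as.obj ⊞ V'.as.obj) := ⟨_, _, _, _, free_binarySum hX
      (isBinarySum_biprod _ _) hA hA', injObj_biprod hJ hJ', _, T.realizes_sum hα hα'⟩
    let N : T.ResQuot X n hX := ⟨⟨_, cosyzygy_le hX hI _ hUV⟩⟩
    have hN : IsBinarySum U' V' N := isBinarySum_quot (isBinarySum_biprod _ _)
    have := hasFiniteBiproducts_quot (I := CatIdeal.through X hX)
      (resClass_exists_zero (T := T) hX (n + 1)) (resClass_biprod hX)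
    obtain ⟨e₁⟩ := hN.nonempty_iso
    obtain ⟨e₂⟩ := hZ.nonempty_iso
    exact ⟨N, hUV, ⟨e₂.symm ≪≫ biprod.mapIso eU eV ≪≫ e₁⟩⟩

include hrigid hinj in
theorem injective_iff_isoClosure (hn : T.resClass X n = X) (hC : T.EnoughInjectives)
    (hI : T.injObj ≤ X) (hKS : IsKrullSchmidt C) (hsmd : smd X = X) (M : T.ResQuot X n hX) :
    Injective M ↔ (T.cosyzygyQuot X n hX).isoClosure M := by
  constructor
  · intro hM
    obtain ⟨M', S, ⟨W, I, f, g, hW, hf, δ, h⟩, hS⟩ :=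
      (injective_iff_smd hrigid hinj hn hC hI M).1 hM
    obtain ⟨i, p, -, -, h₁, -⟩ := isBinarySum_iff.1 hS
    obtain ⟨k, w, hw, hWs⟩ := hKS W
    exact isoClosure_of_retract hrigid hinj hn hC hI hsmd w
      (fun j => localEnd_of_isLocalRing (hw j)) hWs hW h hf M i p h₁
  · rintro ⟨S, hS, ⟨e⟩⟩
    have := injective_of_cosyzygy hrigid hinj hn hI S hS
    exact Injective.of_iso e.symm this

end Extriangulation

end ExtriQuot

end

theorem mainTheorem5 {C : Type u} [SmallCategory C] [Preadditive C] [HasFiniteBiproducts C]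
    (T : Extriangulation C) (n : ℕ) (X : ObjectProperty C) (hX : free X = X)
    (hrigid : T.IsRigid n X) (hinj : T.EnoughInjMor (T.resClass X n) X) :
    ∃ hK : T.KWellDefined X n hX,
      (∃ hL : ∀ M, T.lClass X n ((T.K X n hX hK).obj M),
        IsExactCategory (inducedPairsOp (T.K X n hX hK)) ∧
        IsExactCategory (subcategoryPairs (T.lClass X n)) ∧
        IsExactDuality (inducedPairsOp (T.K X n hX hK)) (subcategoryPairs (T.lClass X n))
          ((T.lClass X n).lift (T.K X n hX hK) hL)) ∧
      (smd X = X →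
        (T.EnoughInflations (T.resClass X (n + 1)) X →
          IsWeaklyIdempotentComplete (T.ResQuot X n hX)) ∧
        (IsKrullSchmidt C → IsKrullSchmidt (T.ResQuot X n hX))) ∧
      (T.resClass X n = X →
        (∃ hfp : ∀ M, T.fpClass X n ((T.K X n hX hK).obj M),
          IsExactCategory (subcategoryPairs (T.fpClass X n)) ∧
          IsExactDuality (inducedPairsOp (T.K X n hX hK)) (subcategoryPairs (T.fpClass X n))
            ((T.fpClass X n).lift (T.K X n hX hK) hfp)) ∧
        (T.EnoughInjectives → T.injObj ≤ X →
          T.cosyzygy X ≤ T.resClass X (n + 1) ∧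
          (∀ M : T.ResQuot X n hX, Injective M ↔ smd (T.cosyzygyQuot X n hX) M) ∧
          (IsKrullSchmidt C → smd X = X →
            ∀ M : T.ResQuot X n hX, Injective M ↔ (T.cosyzygyQuot X n hX).isoClosure M))) := by
  have hK := Extriangulation.kWellDefined hX hrigid
  have hL := Extriangulation.K_mem_lClass (hK := hK) hrigid
  refine ⟨hK, ⟨hL, Extriangulation.isExactCategory_resQuot hrigid hinj,
    Extriangulation.isExactCategory_lClass hX, Extriangulation.isExactDuality_K hrigid hinj hL⟩,
    fun hsmd => ⟨Extriangulation.isWeaklyIdempotentComplete_resQuot hrigid hsmd,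
      isKrullSchmidt_quot _ fun _ _ _ h hZ =>
        Extriangulation.resClass_of_isBinarySum hX hrigid hsmd le_rfl h hZ⟩,
    fun hn => ⟨?_, fun hC hI => ⟨Extriangulation.cosyzygy_le hX hI,
      Extriangulation.injective_iff_smd hrigid hinj hn hC hI, fun hKS hsmd =>
        Extriangulation.injective_iff_isoClosure hrigid hinj hn hC hI hKS hsmd⟩⟩⟩
  rw [Extriangulation.fpClass_eq_lClass hX hn]
  exact ⟨hL, Extriangulation.isExactCategory_lClass hX,
    Extriangulation.isExactDuality_K hrigid hinj hL⟩
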